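/- **Circuits.** Gates are one-qubit and two-qubit unitary matrices with entries in the dense field $\mathbb{Q}(\sqrt2,i)$, described exactly by the binary expansions of their rational coordinates; a circuit is described by its number of qubits in unary and the list of its gates, each with the qubits it acts on. Let $\mathcal G$ be any set of such gates that contains the Hadamard gate $H$, $T=\mathrm{diag}(1,e^{i\pi/4})$ and CNOT (for instance exactly these three gates, or all gates as above). **PromiseBQP.** A promise problem $(A_{\rm yes},A_{\rm no})$, a pair of disjoint sets of bit strings, is in $\mathsf{PromiseBQP}$ if some polynomial-time Turing machine maps every $x\in A_{\rm yes}\cup A_{\rm no}$ to the description of a circuit $Q_x$ over $\mathcal G$, on $q_x$ qubits, such that measuring the first qubit of $Q_x|0\rangle^{\otimes q_x}$ yields $1$ with probability at least $2/3$ if $x\in A_{\rm yes}$ and at most $1/3$ if $x\in A_{\rm no}$. A promise problem is $\mathsf{PromiseBQP}$-complete if it is in $\mathsf{PromiseBQP}$ and every problem in $\mathsf{PromiseBQP}$ reduces to it by a polynomial-time computable map of bit strings that sends yes-instances to yes-instances and no-instances to no-instances. **APPROX-QCIRCUIT-OVER.** Let $p$ be a polynomial with nonnegative integer coefficients. An instance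 of $\textsf{APPROX-QCIRCUIT-OVER}_p$ is a description of two circuits $C$ and $C'$ over $\mathcal G$, acting on $n$ qubits with $m$ gates and on $n'\ge n$ qubits with $m'$ gates, respectively, with $m,n',m'\le p(n)$, and of two rational numbers $a,b\in[0,1]$ in binary with $(b-a)\,p(n)>1$, that is, $b-a>1/p(n)$. With $|\psi\rangle=C|0\rangle^{\otimes n}$ and $|\psi'\rangle=C'|0\rangle^{\otimes n'}$, it is a yes-instance if the overlap $$\mathrm{Tr}\big[(|\psi\rangle\langle\psi|\otimes\mathbb I_{n'-n})\,|\psi'\rangle\langle\psi'|\big]$$ is greater than $b$, and a no-instance if it is smaller than $a$. **Lemma 1.** $\textsf{APPROX-QCIRCUIT-OVER}$ is $\mathsf{PromiseBQP}$-complete: for every polynomial $p$, $\textsf{APPROX-QCIRCUIT-OVER}_p$ is in $\mathsf{PromiseBQP}$, and there is a polynomial $p_0$ such that $\textsf{APPROX-QCIRCUIT-OVER}_p$ is $\mathsf{PromiseBQP}$-complete for every polynomial $p$ with $p(n)\ge p_0(n)$ for all $n$. -/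

import Mathlib

noncomputable section

namespace QOver

/-! ### States and gates -/

/-- Computational basis labels of `n` qubits. -/
abbrev Basis (n : ℕ) : Type := Fin n → Fin 2

/-- (Not necessarily normalised) state vectors of `n` qubits. -/
abbrev State (n : ℕ) : Type := Basis n → ℂ

/-- The state `|0⟩^{⊗ n}`. -/
def zeroState (n : ℕ) : State n := Pi.single (fun _ => 0) 1

/-- Exactly described complex numbers `(a + b√2) + (c + d√2) i` with rational `a, b, c, d`,
i.e. elements of `ℚ(√2, i)`. -/
@[ext] structure Amp where
  a : ℚ
  b : ℚ
  c : ℚ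
  d : ℚ

/-- The complex number described by an `Amp`. -/
def Amp.toComplex (z : Amp) : ℂ :=
  ⟨(z.a : ℝ) + (z.b : ℝ) * Real.sqrt 2, (z.c : ℝ) + (z.d : ℝ) * Real.sqrt 2⟩

/-- A one-qubit gate: a `2 × 2` unitary matrix with exactly described entries. -/
def OneQubitGate : Type :=
  {U : Matrix (Fin 2) (Fin 2) Amp // U.map Amp.toComplex ∈ Matrix.unitaryGroup (Fin 2) ℂ}

/-- A two-qubit gate: a `4 × 4` unitary matrix with exactly described entries, the rows and
columns being indexed by the values of the first and the second qubit. -/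
def TwoQubitGate : Type :=
  {U : Matrix (Fin 2 × Fin 2) (Fin 2 × Fin 2) Amp //
    U.map Amp.toComplex ∈ Matrix.unitaryGroup (Fin 2 × Fin 2) ℂ}

/-- A gate of a circuit on `n` qubits: a one-qubit gate with the qubit it acts on, or a two-qubit
gate with the two distinct qubits it acts on. -/
inductive Gate (n : ℕ) : Type
  | one (i : Fin n) (U : OneQubitGate) : Gate n
  | two (i j : Fin n) (h : i ≠ j) (U : TwoQubitGate) : Gate n

/-- The action of a gate on state vectors. -/
def Gate.apply {n : ℕ} : Gate n → State n → State n
  | .one i U, ψ => fun x =>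
      ∑ s : Fin 2, (U.1 (x i) s).toComplex * ψ (Function.update x i s)
  | .two i j _ U, ψ => fun x =>
      ∑ s : Fin 2, ∑ t : Fin 2,
        (U.1 (x i, x j) (s, t)).toComplex * ψ (Function.update (Function.update x i s) j t)

/-- A circuit on `n` qubits: the list of its gates, the first one being applied first. -/
abbrev Circuit (n : ℕ) : Type := List (Gate n)

/-- The state `C|0⟩^{⊗ n}`. -/
def Circuit.output {n : ℕ} (C : Circuit n) : State n :=
  C.foldl (fun ψ g => g.apply ψ) (zeroState n)

/-! ### Gate sets -/

/-- A set of allowed one-qubit gates and a set of allowed two-qubit gates. -/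
structure GateSet where
  oneQubit : Set OneQubitGate
  twoQubit : Set TwoQubitGate

/-- The gate belongs to the gate set. -/
def Gate.IsIn {n : ℕ} (G : GateSet) : Gate n → Prop
  | .one _ U => U ∈ G.oneQubit
  | .two _ _ _ U => U ∈ G.twoQubit

/-- All the gates of the circuit belong to the gate set. -/
def Circuit.IsOver {n : ℕ} (C : Circuit n) (G : GateSet) : Prop := ∀ g ∈ C, g.IsIn G


/-! The numbers `0`, `1`, `1/√2`, `-1/√2` and `e^{iπ/4} = (1 + i)/√2` as described numbers. -/
def Amp.zero : Amp := ⟨0, 0, 0, 0⟩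
def Amp.one : Amp := ⟨1, 0, 0, 0⟩
def Amp.invSqrtTwo : Amp := ⟨0, 1 / 2, 0, 0⟩
def Amp.negInvSqrtTwo : Amp := ⟨0, -1 / 2, 0, 0⟩
def Amp.zeta : Amp := ⟨0, 1 / 2, 0, 1 / 2⟩

/-- The Hadamard gate. -/
def hadamard : OneQubitGate :=
  ⟨!![Amp.invSqrtTwo, Amp.invSqrtTwo; Amp.invSqrtTwo, Amp.negInvSqrtTwo], by
    have h2 : Real.sqrt 2 * Real.sqrt 2 = 2 := Real.mul_self_sqrt (by norm_num)
    rw [Matrix.mem_unitaryGroup_iff]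
    ext i j
    fin_cases i <;> fin_cases j <;> apply Complex.ext <;>
      simp [Matrix.mul_apply, Fin.sum_univ_two, Matrix.star_apply, Amp.toComplex,
        Amp.invSqrtTwo, Amp.negInvSqrtTwo] <;> nlinarith [h2]⟩

/-- The `π/8` gate `T = diag(1, e^{iπ/4})`. -/
def tGate : OneQubitGate :=
  ⟨!![Amp.one, Amp.zero; Amp.zero, Amp.zeta], by
    have h2 : Real.sqrt 2 * Real.sqrt 2 = 2 := Real.mul_self_sqrt (by norm_num)
    rw [Matrix.mem_unitaryGroup_iff]
    ext i j
    fin_cases i <;> fin_cases j <;> apply Complex.ext <;>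
      simp [Matrix.mul_apply, Fin.sum_univ_two, Matrix.star_apply, Amp.toComplex,
        Amp.one, Amp.zero, Amp.zeta] <;> nlinarith [h2]⟩

/-- The CNOT gate, `|s, t⟩ ↦ |s, s + t⟩`. -/
def cnot : TwoQubitGate :=
  ⟨Matrix.of fun r c => if r = (c.1, c.1 + c.2) then Amp.one else Amp.zero, by
    rw [Matrix.mem_unitaryGroup_iff]
    ext ⟨i, j⟩ ⟨k, l⟩
    fin_cases i <;> fin_cases j <;> fin_cases k <;> fin_cases l <;> apply Complex.ext <;>
      simp [Matrix.mul_apply, Fintype.sum_prod_type, Fin.sum_univ_two, Matrix.star_apply,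
        Amp.toComplex, Amp.one, Amp.zero]⟩

/-- The gate set contains the standard universal gates `H`, `T` and CNOT. -/
structure GateSet.ContainsCliffordT (G : GateSet) : Prop where
  hadamard_mem : hadamard ∈ G.oneQubit
  tGate_mem : tGate ∈ G.oneQubit
  cnot_mem : cnot ∈ G.twoQubit

/-! ### Overlap and acceptance probability -/

/-- Splitting a basis label of `k` qubits into the first `n` and the last `k - n` qubits. -/
def splitBasis {n k : ℕ} (h : n ≤ k) (x : Basis k) : Basis n × Basis (k - n) :=
  (fun i => x (Fin.castLE h i), fun j => x ⟨n + j.1, by omega⟩)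

/-- The operator `|φ⟩⟨φ|`. -/
def ketBra {n : ℕ} (φ : State n) : Matrix (Basis n) (Basis n) ℂ :=
  Matrix.vecMulVec φ (star φ)

open scoped Kronecker in
/-- The overlap `Tr[(|φ⟩⟨φ| ⊗ 𝟙_{k-n}) |χ⟩⟨χ|]` of an `n`-qubit state with a `k`-qubit state. The
trace is a nonnegative real number, of which we take the real part. -/
def overlap {n k : ℕ} (h : n ≤ k) (φ : State n) (χ : State k) : ℝ :=
  (Matrix.trace
    ((ketBra φ ⊗ₖ (1 : Matrix (Basis (k - n)) (Basis (k - n)) ℂ)).submatrix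
        (splitBasis h) (splitBasis h) * ketBra χ)).re

/-- A quantum circuit together with its number of qubits. -/
structure QCircuit where
  qubits : ℕ
  gates : Circuit qubits

/-- The probability that measuring the first qubit of `Q|0⟩^{⊗ q}` yields `1`. -/
def QCircuit.acceptProb (Q : QCircuit) : ℝ :=
  open scoped Classical in
  ∑ x : Basis Q.qubits with ∃ h : 0 < Q.qubits, x ⟨0, h⟩ = 1, ‖Q.gates.output x‖ ^ 2

/-! ### Binary descriptions -/

/-- No code word is a proper prefix of another one, and distinct objects have distinct codes. -/
def PrefixFree {α : Type} (e : α → List Bool) : Prop :=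
  ∀ x y s t, e x ++ s = e y ++ t → x = y ∧ s = t

/-- Unary code of a number. -/
def encUnary (n : ℕ) : List Bool := List.replicate n true ++ [false]

/-- Self-delimiting code of a bit string. -/
def encBits : List Bool → List Bool
  | [] => [false]
  | b :: l => true :: b :: encBits l

/-- Self-delimiting binary code of a number. -/
def encBinary (n : ℕ) : List Bool := encBits (Computability.encodeNat n)

/-- Code of a rational number: sign, numerator and denominator (in lowest terms), in binary. -/
def encRat (r : ℚ) : List Bool :=
  decide (r.num < 0) :: (encBinary r.num.natAbs ++ encBinary r.den)

/-- Self-delimiting code of a list. -/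
def encList {α : Type} (e : α → List Bool) : List α → List Bool
  | [] => [false]
  | x :: l => true :: (e x ++ encList e l)

def Amp.enc (z : Amp) : List Bool := encRat z.a ++ (encRat z.b ++ (encRat z.c ++ encRat z.d))

/-- Row-wise code of a one-qubit gate. -/
def OneQubitGate.enc (U : OneQubitGate) : List Bool :=
  [((0 : Fin 2), (0 : Fin 2)), (0, 1), (1, 0), (1, 1)].flatMap fun p => (U.1 p.1 p.2).enc

/-- Row-wise code of a two-qubit gate. -/
def TwoQubitGate.enc (U : TwoQubitGate) : List Bool :=
  [((0 : Fin 2), (0 : Fin 2)), (0, 1), (1, 0), (1, 1)].flatMap fun r =>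
    [((0 : Fin 2), (0 : Fin 2)), (0, 1), (1, 0), (1, 1)].flatMap fun c => (U.1 r c).enc

/-- Code of a gate: its arity, the qubits it acts on and its matrix. -/
def Gate.enc {n : ℕ} : Gate n → List Bool
  | .one i U => false :: (encUnary i ++ U.enc)
  | .two i j _ U => true :: (encUnary i ++ (encUnary j ++ U.enc))

/-- Code of a circuit: the number of qubits in unary, and the list of gates. -/
def QCircuit.enc (Q : QCircuit) : List Bool :=
  encUnary Q.qubits ++ encList Gate.enc Q.gates

/-! ### Promise problems and complexity classes -/

/-- A promise problem over the binary alphabet. -/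
structure PromiseProblem where
  yes : Set (List Bool)
  no : Set (List Bool)
  disjoint : Disjoint yes no

/-- `f` is computed by a Turing machine in time polynomial in the length of the input. -/
def PolyTime (f : List Bool → List Bool) : Prop :=
  Nonempty (Turing.TM2ComputableInPolyTime (id : List Bool → List Bool)
    (id : List Bool → List Bool) f)

/-- Polynomial-time many-one reducibility of promise problems. -/
def Reduces (A B : PromiseProblem) : Prop :=
  ∃ f : List Bool → List Bool, PolyTime f ∧
    (∀ x ∈ A.yes, f x ∈ B.yes) ∧ (∀ x ∈ A.no, f x ∈ B.no)

/-- The class PromiseBQP: some classical polynomial-time algorithm maps every input `x` that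
satisfies the promise to the description of a quantum circuit over the gate set `G` which, run on
`|0⟩^{⊗ q}`, accepts (its first qubit is measured to be `1`) with probability at least `2/3` if `x`
is a yes-instance and at most `1/3` if `x` is a no-instance. -/
def PromiseBQP (G : GateSet) : Set PromiseProblem :=
  {A | ∃ f : List Bool → List Bool, PolyTime f ∧
    (∀ x ∈ A.yes, ∃ Q : QCircuit, Q.gates.IsOver G ∧ f x = Q.enc ∧ 2 / 3 ≤ Q.acceptProb) ∧
    (∀ x ∈ A.no, ∃ Q : QCircuit, Q.gates.IsOver G ∧ f x = Q.enc ∧ Q.acceptProb ≤ 1 / 3)}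

/-- Every problem of PromiseBQP reduces to `B`. -/
def PromiseBQPHard (G : GateSet) (B : PromiseProblem) : Prop :=
  ∀ A ∈ PromiseBQP G, Reduces A B

/-- PromiseBQP-completeness. -/
def PromiseBQPComplete (G : GateSet) (B : PromiseProblem) : Prop :=
  B ∈ PromiseBQP G ∧ PromiseBQPHard G B

/-! ### The overlap problem -/

/-- An instance: a circuit `C` on `n` qubits, a circuit `D` on `k ≥ n` qubits, thresholds. -/
structure OverInstance where
  n : ℕ
  k : ℕ
  le : n ≤ k
  C : Circuit n
  D : Circuit k
  a : ℚ
  b : ℚ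

/-- The overlap of the output states of the two circuits. -/
def OverInstance.value (I : OverInstance) : ℝ := overlap I.le I.C.output I.D.output

/-- The description of an instance. -/
def OverInstance.enc (I : OverInstance) : List Bool :=
  QCircuit.enc ⟨I.n, I.C⟩ ++ (QCircuit.enc ⟨I.k, I.D⟩ ++ (encRat I.a ++ encRat I.b))

/-- The promise on the circuits and the thresholds, for the polynomial bound `p`: the sizes are at
most `p(n)`, and `b - a > 1 / p(n)`. -/
structure OverInstance.Valid (G : GateSet) (p : Polynomial ℕ) (I : OverInstance) : Prop where
  C_over : I.C.IsOver G
  D_over : I.D.IsOver G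
  C_size : I.C.length ≤ p.eval I.n
  k_le : I.k ≤ p.eval I.n
  D_size : I.D.length ≤ p.eval I.n
  a_nonneg : 0 ≤ I.a
  a_le_one : I.a ≤ 1
  b_nonneg : 0 ≤ I.b
  b_le_one : I.b ≤ 1
  gap : 1 < (I.b - I.a) * ((p.eval I.n : ℕ) : ℚ)

/-! The description determines the instance. -/

theorem prefixFree_encUnary : PrefixFree encUnary := by
  intro x
  induction x with
  | zero =>
    intro y s t h
    cases y with
    | zero => simpa [encUnary] using h
    | succ y => simp [encUnary, List.replicate_succ] at h
  | succ x ih =>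
    intro y s t h
    cases y with
    | zero => simp [encUnary, List.replicate_succ] at h
    | succ y =>
      have h' : encUnary x ++ s = encUnary y ++ t := by
        simpa [encUnary, List.replicate_succ] using h
      obtain ⟨h1, h2⟩ := ih y s t h'
      exact ⟨by rw [h1], h2⟩

theorem prefixFree_encBits : PrefixFree encBits := by
  intro x
  induction x with
  | nil => intro y s t h; cases y <;> simp_all [encBits]
  | cons b x ih =>
    intro y s t h
    cases y with
    | nil => simp [encBits] at h
    | cons c y =>
      simp only [encBits, List.cons_append, List.cons.injEq, true_and] at h
      obtain ⟨h1, h2⟩ := ih y s t h.2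
      exact ⟨by rw [h.1, h1], h2⟩

theorem prefixFree_encBinary : PrefixFree encBinary := by
  intro x y s t h
  obtain ⟨h1, h2⟩ := prefixFree_encBits _ _ s t h
  have h3 := congrArg Computability.decodeNat h1
  rw [Computability.decode_encodeNat, Computability.decode_encodeNat] at h3
  exact ⟨h3, h2⟩

theorem prefixFree_encRat : PrefixFree encRat := by
  intro x y s t h
  simp only [encRat, List.cons_append, List.cons.injEq, List.append_assoc,
    decide_eq_decide] at h
  obtain ⟨h0, h⟩ := h
  obtain ⟨h1, h⟩ := prefixFree_encBinary _ _ _ _ h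
  obtain ⟨h2, h⟩ := prefixFree_encBinary _ _ _ _ h
  refine ⟨Rat.ext ?_ h2, h⟩
  by_cases hx : x.num < 0
  · have := h0.1 hx; omega
  · have := mt h0.2 hx; omega

theorem prefixFree_encList {α : Type} {e : α → List Bool} (he : PrefixFree e) :
    PrefixFree (encList e) := by
  intro x
  induction x with
  | nil => intro y s t h; cases y <;> simp_all [encList]
  | cons b x ih =>
    intro y s t h
    cases y with
    | nil => simp [encList] at h
    | cons c y =>
      simp only [encList, List.cons_append, List.cons.injEq, true_and, List.append_assoc] at h
      obtain ⟨h0, h⟩ := he _ _ _ _ h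
      obtain ⟨h1, h2⟩ := ih y s t h
      exact ⟨by rw [h0, h1], h2⟩

theorem prefixFree_amp : PrefixFree Amp.enc := by
  intro x y s t h
  simp only [Amp.enc, List.append_assoc] at h
  obtain ⟨h1, h⟩ := prefixFree_encRat _ _ _ _ h
  obtain ⟨h2, h⟩ := prefixFree_encRat _ _ _ _ h
  obtain ⟨h3, h⟩ := prefixFree_encRat _ _ _ _ h
  obtain ⟨h4, h⟩ := prefixFree_encRat _ _ _ _ h
  exact ⟨Amp.ext h1 h2 h3 h4, h⟩

/-- Codes of equally indexed families of objects are prefix-free. -/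
theorem flatMap_prefixFree {ι α : Type} {e : α → List Bool} (he : PrefixFree e)
    (l : List ι) (u v : ι → α) (s t : List Bool)
    (h : (l.flatMap fun i => e (u i)) ++ s = (l.flatMap fun i => e (v i)) ++ t) :
    (∀ i ∈ l, u i = v i) ∧ s = t := by
  induction l with
  | nil => simpa using h
  | cons i l ih =>
    simp only [List.flatMap_cons, List.append_assoc] at h
    obtain ⟨h1, h⟩ := he _ _ _ _ h
    obtain ⟨h2, h⟩ := ih h
    exact ⟨by simpa using ⟨h1, h2⟩, h⟩

theorem prefixFree_oneQubitGate : PrefixFree OneQubitGate.enc := by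
  intro U V s t h
  obtain ⟨h1, h2⟩ := flatMap_prefixFree prefixFree_amp _
    (fun p : Fin 2 × Fin 2 => U.1 p.1 p.2) (fun p => V.1 p.1 p.2) s t h
  refine ⟨Subtype.ext (Matrix.ext fun i j => h1 (i, j) ?_), h2⟩
  fin_cases i <;> fin_cases j <;> simp

theorem prefixFree_twoQubitGate : PrefixFree TwoQubitGate.enc := by
  intro U V s t h
  have he : PrefixFree fun w : Fin 2 × Fin 2 → Amp =>
      [((0 : Fin 2), (0 : Fin 2)), (0, 1), (1, 0), (1, 1)].flatMap fun c => (w c).enc := by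
    intro w z s t h
    obtain ⟨h1, h2⟩ := flatMap_prefixFree prefixFree_amp _ w z s t h
    refine ⟨funext fun p => h1 p ?_, h2⟩
    obtain ⟨i, j⟩ := p
    fin_cases i <;> fin_cases j <;> simp
  obtain ⟨h1, h2⟩ := flatMap_prefixFree he _ U.1 V.1 s t h
  refine ⟨Subtype.ext (funext fun p => h1 p ?_), h2⟩
  obtain ⟨i, j⟩ := p
  fin_cases i <;> fin_cases j <;> simp

theorem prefixFree_gate (n : ℕ) : PrefixFree (Gate.enc (n := n)) := by
  intro x y s t h
  cases x with
  | one i U =>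
    cases y with
    | one j V =>
      simp only [Gate.enc, List.cons_append, List.cons.injEq, true_and, List.append_assoc] at h
      obtain ⟨h1, h⟩ := prefixFree_encUnary _ _ _ _ h
      obtain ⟨h2, h⟩ := prefixFree_oneQubitGate _ _ _ _ h
      exact ⟨by rw [Fin.ext h1, h2], h⟩
    | two j k hjk V => simp [Gate.enc] at h
  | two i k hik U =>
    cases y with
    | one j V => simp [Gate.enc] at h
    | two j l hjl V =>
      simp only [Gate.enc, List.cons_append, List.cons.injEq, true_and, List.append_assoc] at h
      obtain ⟨h1, h⟩ := prefixFree_encUnary _ _ _ _ h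
      obtain ⟨h2, h⟩ := prefixFree_encUnary _ _ _ _ h
      obtain ⟨h3, hst⟩ := prefixFree_twoQubitGate _ _ _ _ h
      obtain rfl := Fin.ext h1
      obtain rfl := Fin.ext h2
      subst h3
      exact ⟨rfl, hst⟩

theorem prefixFree_qCircuit : PrefixFree QCircuit.enc := by
  rintro ⟨n, C⟩ ⟨m, D⟩ s t h
  simp only [QCircuit.enc, List.append_assoc] at h
  obtain ⟨h1, h⟩ := prefixFree_encUnary _ _ _ _ h
  subst h1
  obtain ⟨h2, hst⟩ := prefixFree_encList (prefixFree_gate n) _ _ _ _ h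
  subst h2
  exact ⟨rfl, hst⟩

theorem overInstance_enc_injective : Function.Injective OverInstance.enc := by
  rintro ⟨n, k, hle, C, D, a, b⟩ ⟨m, l, hml, E, F, c, d⟩ h
  simp only [OverInstance.enc] at h
  obtain ⟨h1, h⟩ := prefixFree_qCircuit _ _ _ _ h
  obtain ⟨h2, h⟩ := prefixFree_qCircuit _ _ _ _ h
  obtain ⟨h3, h⟩ := prefixFree_encRat _ _ _ _ h
  obtain ⟨h4, -⟩ := prefixFree_encRat b d [] [] (by simpa using h)
  cases h1
  cases h2
  subst h3 h4
  rfl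

/-- The promise problem APPROX-QCIRCUIT-OVER for circuits over the gate set `G`, with polynomial
bound `p`: decide whether the overlap is greater than `b` or smaller than `a`. -/
def approxQCircuitOver (G : GateSet) (p : Polynomial ℕ) : PromiseProblem where
  yes := {x | ∃ I : OverInstance, x = I.enc ∧ I.Valid G p ∧ (I.b : ℝ) < I.value}
  no := {x | ∃ I : OverInstance, x = I.enc ∧ I.Valid G p ∧ I.value < (I.a : ℝ)}
  disjoint := by
    rw [Set.disjoint_left]
    rintro x ⟨I, rfl, hI, hb⟩ ⟨J, hJ, -, ha⟩
    obtain rfl := overInstance_enc_injective hJ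
    have hab : I.a < I.b := by
      by_contra hlt
      have h1 : (I.b - I.a) * ((p.eval I.n : ℕ) : ℚ) ≤ 0 :=
        mul_nonpos_of_nonpos_of_nonneg (by linarith) (Nat.cast_nonneg _)
      exact absurd hI.gap (by linarith)
    have hab' : (I.a : ℝ) < (I.b : ℝ) := by exact_mod_cast hab
    linarith

end QOver

end

/-! ### Polynomial-time computation by loop programs. -/

noncomputable section

namespace QOver

/-! ### Loop programs on registers of bits -/

/-! Membership. The swap test of the first state with the first `n` qubits of the second has an
outcome of probability (1 + overlap)/2 (`prob_swapTest`), so this probability must be estimated with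
a precision of order 1/p(n). The test is repeated R = 4m times on fresh blocks of qubits, without
intermediate measurements: a counter with R + 1 positions, exactly one of which is occupied, moves
down by one for each success. A fresh block is independent of everything done before
(`weight_block`), so the position is binomially distributed (`weight_eq`, in terms of Bernstein
polynomials), and Chebyshev's inequality (`sum_weight_le`) bounds the error by 1/3 once m ≥ 12
p(n)². Acceptance means that the counter is below a threshold T, which is m(2 - a - b) up to
rounding; T CNOT gates from the positions to the output qubit perform this comparison, so no quantum
arithmetic is needed. All gates are exact over H, T and CNOT: a doubly controlled Z is made of
powers of T on parities of qubits, and it gives the Toffoli gate and the controlled swap.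

Hardness. Given a circuit Q, let C be the empty circuit on `n` qubits, and let D run Q on qubits
beyond the first `n` and write the negated result to qubit 0. The overlap is the probability that
the first `n` qubits of D are all zero, which is exactly the acceptance probability of Q
(`overlap_shiftedCircuit`). With the length of the description of Q as `n`, all sizes are linear in
`n`, and the thresholds 2/5 and 3/5 separate 1/3 from 2/3.

Polynomial time. Both maps have to be computed by actual Turing machines. They are written in a
small language in which a loop has at most N rounds, N being the length of the input, so that every
program runs in polynomial time by construction. `runs_entry` shows that the compiled code is
correct and fast, and `PolyTime.program` runs a program after an arbitrary polynomial-time function,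
as the reduction requires. `Trans` and `Reads` form a calculus for verifying programs, with which
`emitted_reductionProg` and `emitted_decisionProg` identify the written word with the intended
description. Nested loops give N ^ e rounds, which replace values of polynomials. The threshold is a
sum of numbers m - ⌊mc⌋ for rational c; that many gates are produced by adding the numerator of c
repeatedly modulo its denominator and writing a gate whenever there is no overflow
(`flatMap_steps`), so no multiplication or division is programmed. -/

/-- Programs on registers holding bit strings. A loop has at most as many rounds as the input of the
program has bits; with a guard register, every round pops a bit from it, and the loop ends unless
this bit is `true`. -/
inductive Prog (R : Type) : Type
  | skip : Prog R
  | push (r : R) (b : Bool) : Prog R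
  | seq (p q : Prog R) : Prog R
  | popCase (r : R) (p q z : Prog R) : Prog R
  | loop (g : Option R) (p : Prog R) : Prog R

namespace Prog

variable {R : Type} [DecidableEq R]

/-- Testing the guard of a loop. -/
def test : Option R → (R → List Bool) → Bool × (R → List Bool)
  | none, s => (true, s)
  | some r, s => ((s r).head? == some true, Function.update s r (s r).tail)

/-- At most `m` rounds of a loop with guard `g` and body `f`. -/
def rounds (g : Option R) (f : (R → List Bool) → (R → List Bool)) :
    ℕ → (R → List Bool) → (R → List Bool)
  | 0, s => s
  | m + 1, s => bif (test g s).1 then rounds g f m (f (test g s).2) else (test g s).2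

/-- The effect of a program on the registers, for inputs with `N` bits. -/
def eval (N : ℕ) : Prog R → (R → List Bool) → (R → List Bool)
  | skip, s => s
  | push r b, s => Function.update s r (b :: s r)
  | seq p q, s => eval N q (eval N p s)
  | popCase r p q z, s =>
    bif (s r).head? == some true then eval N p (Function.update s r (s r).tail)
    else bif (s r).head? == some false then eval N q (Function.update s r (s r).tail)
    else eval N z (Function.update s r (s r).tail)
  | loop g p, s => rounds g (eval N p) N s

/-- A bound on the running time. -/
def cost : Prog R → Polynomial ℕ
  | skip => 0
  | push _ _ => 0
  | seq p q => cost p + cost q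
  | popCase _ p q z => cost p + cost q + cost z
  | loop _ p => Polynomial.X * (cost p + 1) + Polynomial.X + 2

/-- A bound on the growth of each register. -/
def growth : Prog R → Polynomial ℕ
  | skip => 0
  | push _ _ => 1
  | seq p q => growth p + growth q
  | popCase _ p q z => growth p + growth q + growth z
  | loop _ p => Polynomial.X * growth p

theorem length_test_le (g : Option R) (s : R → List Bool) (r : R) :
    ((test g s).2 r).length ≤ (s r).length := by
  cases g with
  | none => exact le_rfl
  | some r' =>
    by_cases h : r = r'
    · subst h; simp [test]
    · simp [test, h]

theorem length_rounds_le {g : Option R} {f : (R → List Bool) → (R → List Bool)} {c : ℕ}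
    (hf : ∀ s r, (f s r).length ≤ (s r).length + c) (m : ℕ) (s : R → List Bool) (r : R) :
    (rounds g f m s r).length ≤ (s r).length + m * c := by
  induction m generalizing s with
  | zero => simp [rounds]
  | succ m ih =>
    have h1 := length_test_le g s r
    rw [rounds]
    cases (test g s).1
    · simp only [cond_false]; nlinarith
    · simp only [cond_true]
      have h2 := ih (f (test g s).2)
      have h3 := hf (test g s).2 r
      rw [Nat.succ_mul]; omega

/-- The bound is polynomial in `N` because a loop repeats its body at most `N` times. It limits the
time for emptying the stacks and for moving the result at the end. -/
theorem length_eval_le (N : ℕ) (p : Prog R) (s : R → List Bool) (r : R) :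
    (eval N p s r).length ≤ (s r).length + (growth p).eval N := by
  induction p generalizing s r with
  | skip => simp [eval, growth]
  | push r' b =>
    by_cases h : r = r'
    · subst h; simp [eval, growth]
    · simp [eval, growth, h]
  | seq p q ihp ihq =>
    simp only [eval, growth, Polynomial.eval_add]
    have := ihp s r
    have := ihq (eval N p s) r
    omega
  | popCase r' p q z ihp ihq ihz =>
    have h0 : (Function.update s r' (s r').tail r).length ≤ (s r).length := by
      by_cases h : r = r'
      · subst h; simp
      · simp [h]
    simp only [eval, growth, Polynomial.eval_add]
    have := ihp (Function.update s r' (s r').tail) r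
    have := ihq (Function.update s r' (s r').tail) r
    have := ihz (Function.update s r' (s r').tail) r
    cases (s r').head? == some true
    · cases (s r').head? == some false
      · simp only [cond_false]; omega
      · simp only [cond_false, cond_true]; omega
    · simp only [cond_true]; omega
  | loop g p ih =>
    simp only [eval, growth, Polynomial.eval_mul, Polynomial.eval_X]
    exact length_rounds_le ih N s r

/-- The loops of a program. -/
def Lab : Prog R → Type
  | skip => Empty
  | push _ _ => Empty
  | seq p q => Lab p ⊕ Lab q
  | popCase _ p q z => Lab p ⊕ (Lab q ⊕ Lab z)
  | loop _ p => Option (Lab p)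

instance instDecidableEqLab : (p : Prog R) → DecidableEq (Lab p)
  | skip => inferInstanceAs (DecidableEq Empty)
  | push _ _ => inferInstanceAs (DecidableEq Empty)
  | seq p q =>
    have := instDecidableEqLab p
    have := instDecidableEqLab q
    inferInstanceAs (DecidableEq (Lab p ⊕ Lab q))
  | popCase _ p q z =>
    have := instDecidableEqLab p
    have := instDecidableEqLab q
    have := instDecidableEqLab z
    inferInstanceAs (DecidableEq (Lab p ⊕ (Lab q ⊕ Lab z)))
  | loop _ p =>
    have := instDecidableEqLab p
    inferInstanceAs (DecidableEq (Option (Lab p)))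

instance instFintypeLab : (p : Prog R) → Fintype (Lab p)
  | skip => inferInstanceAs (Fintype Empty)
  | push _ _ => inferInstanceAs (Fintype Empty)
  | seq p q =>
    have := instFintypeLab p
    have := instFintypeLab q
    inferInstanceAs (Fintype (Lab p ⊕ Lab q))
  | popCase _ p q z =>
    have := instFintypeLab p
    have := instFintypeLab q
    have := instFintypeLab z
    inferInstanceAs (Fintype (Lab p ⊕ (Lab q ⊕ Lab z)))
  | loop _ p =>
    have := instFintypeLab p
    inferInstanceAs (Fintype (Option (Lab p)))

end Prog

/-! ### The compiled machine -/

/-- The stacks of the machine that runs a given machine with stacks `K` and then a program with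
registers `R` and loops `L`; every loop has two stacks that serve as its clock. -/
inductive Stack (K R L : Type) : Type
  | old (k : K)
  | reg (r : R)
  | clk (i : L × Bool)
  | tmp
  | fin
  deriving DecidableEq, Fintype

/-- The stack alphabets. -/
abbrev Stack.Alph {K : Type} (Γ : K → Type) (R L : Type) : Stack K R L → Type
  | .old k => Γ k
  | .reg _ => Bool
  | .clk _ => Bool
  | .tmp => Bool
  | .fin => Bool

/-- The labels of this machine. -/
inductive Label (Λ L : Type) : Type
  | old (l : Λ)
  | feed
  | load
  | run (i : L × Bool)
  | clean
  | finish
  deriving Fintype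

section Machine

variable {K : Type} {Γ : K → Type} {R L Λ σ : Type} [DecidableEq K] [DecidableEq R] [DecidableEq L]

/-- Contents of all the stacks. -/
def Stack.mk (S : ∀ k, List (Γ k)) (s : R → List Bool) (c : L × Bool → List Bool)
    (t f : List Bool) : ∀ k : Stack K R L, List (Stack.Alph Γ R L k)
  | .old k => S k
  | .reg r => s r
  | .clk i => c i
  | .tmp => t
  | .fin => f

/-- With this and the next four lemmas, symbolic execution keeps all stack contents in the form
`Stack.mk`. -/
theorem Stack.update_old (S : ∀ k, List (Γ k)) (s : R → List Bool) (c : L × Bool → List Bool)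
    (t f : List Bool) (k : K) (l : List (Γ k)) :
    Function.update (Stack.mk S s c t f) (.old k) l = Stack.mk (Function.update S k l) s c t f := by
  funext j
  cases j with
  | old j =>
    by_cases h : j = k
    · subst h; simp [Stack.mk]
    · simp [Stack.mk, h]
  | _ => simp [Stack.mk]

theorem Stack.update_reg (S : ∀ k, List (Γ k)) (s : R → List Bool) (c : L × Bool → List Bool)
    (t f : List Bool) (r : R) (l : List Bool) :
    Function.update (Stack.mk S s c t f) (.reg r) l = Stack.mk S (Function.update s r l) c t f := by
  funext j
  cases j with
  | reg j =>
    by_cases h : j = r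
    · subst h; simp [Stack.mk]
    · simp [Stack.mk, h]
  | _ => simp [Stack.mk]

theorem Stack.update_clk (S : ∀ k, List (Γ k)) (s : R → List Bool) (c : L × Bool → List Bool)
    (t f : List Bool) (i : L × Bool) (l : List Bool) :
    Function.update (Stack.mk S s c t f) (.clk i) l = Stack.mk S s (Function.update c i l) t f := by
  funext j
  cases j with
  | clk j =>
    by_cases h : j = i
    · subst h; simp [Stack.mk]
    · simp only [Stack.mk, ne_eq, Stack.clk.injEq, h, not_false_eq_true, Function.update_of_ne]
  | _ => simp [Stack.mk]

theorem Stack.update_tmp (S : ∀ k, List (Γ k)) (s : R → List Bool) (c : L × Bool → List Bool)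
    (t f l : List Bool) :
    Function.update (Stack.mk S s c t f) .tmp l = Stack.mk S s c l f := by
  funext j
  cases j <;> simp [Stack.mk]

theorem Stack.update_fin (S : ∀ k, List (Γ k)) (s : R → List Bool) (c : L × Bool → List Bool)
    (t f l : List Bool) :
    Function.update (Stack.mk S s c t f) .fin l = Stack.mk S s c t l := by
  funext j
  cases j <;> simp [Stack.mk]

variable (Γ R L Λ σ) in
/-- The statements of the compiled machine, which stores the bits that it pops. -/
abbrev MStmt : Type := Turing.TM2.Stmt (Stack.Alph Γ R L) (Label Λ L) (σ × Option Bool)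

variable (Γ R L Λ σ) in
/-- The configurations of the compiled machine. -/
abbrev MCfg : Type := Turing.TM2.Cfg (Stack.Alph Γ R L) (Label Λ L) (σ × Option Bool)

open Turing.TM2.Stmt

/-- Jump to a label. -/
def jump (l : Label Λ L) : MStmt Γ R L Λ σ := goto fun _ => l

/-- Pop a bit from a register and store it. -/
def popReg (r : R) (k : MStmt Γ R L Λ σ) : MStmt Γ R L Λ σ := pop (.reg r) (fun v o => (v.1, o)) k

/-- Pop a bit from a clock and store it. -/
def popClk (i : L × Bool) (k : MStmt Γ R L Λ σ) : MStmt Γ R L Λ σ :=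
  pop (.clk i) (fun v o => (v.1, o)) k

/-- Pop a bit from the auxiliary stack and store it. -/
def popTmp (k : MStmt Γ R L Λ σ) : MStmt Γ R L Λ σ :=
  pop .tmp (fun v o => (v.1, o)) k

/-- Code at the beginning of a loop body: the test of the guard. -/
def testCode (g : Option R) (k k' : MStmt Γ R L Λ σ) : MStmt Γ R L Λ σ :=
  match g with
  | none => k
  | some r => popReg r (branch (fun v => v.2 == some true) k k')

namespace Prog

/-- The code of a program outside of its loops, with continuation `k`. -/
def entry : (p : Prog R) → (Lab p → L) → MStmt Γ R L Λ σ → MStmt Γ R L Λ σ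
  | skip, _, k => k
  | push r b, _, k => Turing.TM2.Stmt.push (.reg r) (fun _ => b) k
  | seq p q, e, k => entry p (fun l => e (.inl l)) (entry q (fun l => e (.inr l)) k)
  | popCase r p q z, e, k =>
    popReg r (branch (fun v => v.2 == some true) (entry p (fun l => e (.inl l)) k)
      (branch (fun v => v.2 == some false) (entry q (fun l => e (.inr (.inl l))) k)
        (entry z (fun l => e (.inr (.inr l))) k)))
  | loop _ _, e, _ => jump (.run (e none, true))

/-- The code at the labels belonging to the loops of a program. -/
def code : (p : Prog R) → (Lab p → L) → MStmt Γ R L Λ σ → Lab p × Bool → MStmt Γ R L Λ σ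
  | skip, _, _, (l, _) => nomatch l
  | push _ _, _, _, (l, _) => nomatch l
  | seq p q, e, k, (.inl l, b) =>
    code p (fun l => e (.inl l)) (entry q (fun l => e (.inr l)) k) (l, b)
  | seq _ q, e, k, (.inr l, b) => code q (fun l => e (.inr l)) k (l, b)
  | popCase _ p _ _, e, k, (.inl l, b) => code p (fun l => e (.inl l)) k (l, b)
  | popCase _ _ q _, e, k, (.inr (.inl l), b) => code q (fun l => e (.inr (.inl l))) k (l, b)
  | popCase _ _ _ z, e, k, (.inr (.inr l), b) => code z (fun l => e (.inr (.inr l))) k (l, b)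
  | loop g p, e, _, (none, true) =>
    popClk (e none, true) (branch (fun v => v.2.isSome)
      (Turing.TM2.Stmt.push (.clk (e none, false)) (fun _ => true)
        (testCode g (entry p (fun l => e (some l)) (jump (.run (e none, true))))
          (jump (.run (e none, false)))))
      (jump (.run (e none, false))))
  | loop _ _, e, k, (none, false) =>
    popClk (e none, false) (branch (fun v => v.2.isSome)
      (Turing.TM2.Stmt.push (.clk (e none, true)) (fun _ => true) (jump (.run (e none, false)))) k)
  | loop _ p, e, _, (some l, b) =>
    code p (fun l => e (some l)) (jump (.run (e none, true))) (l, b)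

end Prog

/-- `n` steps of the machine lead from one configuration to another. -/
def Runs (m : Label Λ L → MStmt Γ R L Λ σ) (n : ℕ) (c d : MCfg Γ R L Λ σ) : Prop :=
  (flip bind (Turing.TM2.step m))^[n] (some c) = some d

theorem Runs.trans {m : Label Λ L → MStmt Γ R L Λ σ} {n n' : ℕ} {c d e : MCfg Γ R L Λ σ}
    (h : Runs m n c d) (h' : Runs m n' d e) : Runs m (n + n') c e := by
  unfold Runs at *
  rw [Nat.add_comm, Function.iterate_add_apply, h, h']

theorem Runs.step (m : Label Λ L → MStmt Γ R L Λ σ) (l : Label Λ L) (v : σ × Option Bool)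
    (T : ∀ k, List (Stack.Alph Γ R L k)) :
    Runs m 1 ⟨some l, v, T⟩ (Turing.TM2.stepAux (m l) v T) := rfl

/-- Iterating one-step moves. -/
theorem Runs.head {m : Label Λ L → MStmt Γ R L Λ σ} {n : ℕ} {l : Label Λ L} {v : σ × Option Bool}
    {T : ∀ k, List (Stack.Alph Γ R L k)} {d : MCfg Γ R L Λ σ}
    (h : Runs m n (Turing.TM2.stepAux (m l) v T) d) : Runs m (n + 1) ⟨some l, v, T⟩ d := by
  rw [Nat.add_comm]
  exact (Runs.step m l v T).trans h

section StepAux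

variable (v : σ × Option Bool) (S : ∀ k, List (Γ k)) (s : R → List Bool)
  (c : L × Bool → List Bool) (t f : List Bool) (k k' : MStmt Γ R L Λ σ)

open Turing.TM2 (stepAux)

@[simp] theorem stepAux_jump (l : Label Λ L) (T : ∀ k, List (Stack.Alph Γ R L k)) :
    stepAux (jump l : MStmt Γ R L Λ σ) v T = ⟨some l, v, T⟩ := rfl

@[simp] theorem stepAux_popReg (r : R) : stepAux (popReg r k) v (Stack.mk S s c t f) =
    stepAux k (v.1, (s r).head?) (Stack.mk S (Function.update s r (s r).tail) c t f) := by
  rw [← Stack.update_reg]; rfl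

@[simp] theorem stepAux_popClk (i : L × Bool) : stepAux (popClk i k) v (Stack.mk S s c t f) =
    stepAux k (v.1, (c i).head?) (Stack.mk S s (Function.update c i (c i).tail) t f) := by
  rw [← Stack.update_clk]; rfl

@[simp] theorem stepAux_popTmp : stepAux (popTmp k) v (Stack.mk S s c t f) =
    stepAux k (v.1, t.head?) (Stack.mk S s c t.tail f) := by
  rw [← Stack.update_tmp S s c t f t.tail]; rfl

theorem stepAux_pushReg (r : R) (b : σ × Option Bool → Bool) :
    stepAux (Turing.TM2.Stmt.push (.reg r) b k) v (Stack.mk S s c t f) =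
      stepAux k v (Stack.mk S (Function.update s r (b v :: s r)) c t f) := by
  rw [← Stack.update_reg]; rfl

theorem stepAux_pushClk (i : L × Bool) (b : σ × Option Bool → Bool) :
    stepAux (Turing.TM2.Stmt.push (.clk i) b k) v (Stack.mk S s c t f) =
      stepAux k v (Stack.mk S s (Function.update c i (b v :: c i)) t f) := by
  rw [← Stack.update_clk]; rfl

theorem stepAux_pushTmp (b : σ × Option Bool → Bool) :
    stepAux (Turing.TM2.Stmt.push .tmp b k) v (Stack.mk S s c t f) =
      stepAux k v (Stack.mk S s c (b v :: t) f) := by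
  rw [← Stack.update_tmp S s c t f (b v :: t)]; rfl

theorem stepAux_pushFin (b : σ × Option Bool → Bool) :
    stepAux (Turing.TM2.Stmt.push .fin b k) v (Stack.mk S s c t f) =
      stepAux k v (Stack.mk S s c t (b v :: f)) := by
  rw [← Stack.update_fin S s c t f (b v :: f)]; rfl

@[simp] theorem stepAux_branch (p : σ × Option Bool → Bool)
    (T : ∀ k, List (Stack.Alph Γ R L k)) :
    stepAux (branch p k k') v T = cond (p v) (stepAux k v T) (stepAux k' v T) := rfl

/-- The bit left in the scratch cell is existentially quantified, here and below: later code
overwrites the cell before reading it. -/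
theorem stepAux_testCode (g : Option R) :
    ∃ o, stepAux (testCode g k k') v (Stack.mk S s c t f) =
      bif (Prog.test g s).1 then stepAux k (v.1, o) (Stack.mk S (Prog.test g s).2 c t f)
      else stepAux k' (v.1, o) (Stack.mk S (Prog.test g s).2 c t f) := by
  cases g with
  | none => exact ⟨v.2, rfl⟩
  | some r => exact ⟨(s r).head?, by simp [testCode, Prog.test]⟩

end StepAux

open Turing.TM2 (stepAux)

/-- Emptying the second stack of a clock onto the first one. -/
theorem runs_restore {m : Label Λ L → MStmt Γ R L Λ σ} {i : L} {k : MStmt Γ R L Λ σ}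
    (hm : m (.run (i, false)) = popClk (i, false) (branch (fun v => v.2.isSome)
      (Turing.TM2.Stmt.push (.clk (i, true)) (fun _ => true) (jump (.run (i, false)))) k))
    (S : ∀ k, List (Γ k)) (s : R → List Bool) (c : L × Bool → List Bool) (t f : List Bool)
    (N a b : ℕ) (hab : a + b = N) (v : σ × Option Bool) :
    ∃ o, Runs m (b + 1)
      ⟨some (.run (i, false)), v, Stack.mk S s (Function.update (Function.update c (i, true)
        (List.replicate a true)) (i, false) (List.replicate b true)) t f⟩
      (stepAux k (v.1, o) (Stack.mk S s (Function.update (Function.update c (i, true)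
        (List.replicate N true)) (i, false) []) t f)) := by
  induction b generalizing a v with
  | zero =>
    obtain rfl : a = N := by omega
    exact ⟨none, Runs.head (by rw [hm]; simp [Runs])⟩
  | succ b ih =>
    obtain ⟨o, h⟩ := ih (a + 1) (by omega) (v.1, some true)
    refine ⟨o, Runs.head ?_⟩
    rw [hm]
    simp only [stepAux_popClk, stepAux_branch, stepAux_pushClk, stepAux_jump,
      Function.update_self, List.replicate_succ, List.head?_cons, Option.isSome_some, cond_true,
      List.tail_cons, Function.update_idem]
    have hne : ((i, true) : L × Bool) ≠ (i, false) := by simp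
    rw [Function.update_of_ne hne, Function.update_self, Function.update_comm hne,
      Function.update_idem, ← List.replicate_succ]
    rw [Function.update_comm hne] at h
    exact h

/-- The clocks of the loops of a program are set. -/
def ClocksSet {p : Prog R} (e : Prog.Lab p → L) (N : ℕ) (c : L × Bool → List Bool) : Prop :=
  ∀ l, c (e l, true) = List.replicate N true ∧ c (e l, false) = []

open Prog in
/-- The compiled program works as specified. -/
theorem runs_entry {m : Label Λ L → MStmt Γ R L Λ σ} (S : ∀ k, List (Γ k)) (t f : List Bool)
    (N : ℕ) (p : Prog R) :
    ∀ (e : Lab p → L) (_ : Function.Injective e) (k : MStmt Γ R L Λ σ)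
      (_ : ∀ l b, m (.run (e l, b)) = code p e k (l, b))
      (c : L × Bool → List Bool) (_ : ClocksSet e N c) (s : R → List Bool) (v : σ × Option Bool),
    ∃ n o, n ≤ (cost p).eval N ∧ Runs m n (stepAux (entry p e k) v (Stack.mk S s c t f))
      (stepAux k (v.1, o) (Stack.mk S (Prog.eval N p s) c t f)) := by
  induction p with
  -- Code without jumps is executed within the machine step that reached it, so it costs nothing;
  -- only passing through a label counts.
  | skip => exact fun e he k hm c hc s v => ⟨0, v.2, by simp [cost], rfl⟩
  | push r b =>
    intro e he k hm c hc s v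
    refine ⟨0, v.2, by simp [cost], ?_⟩
    rw [entry, stepAux_pushReg]; rfl
  | seq p q ihp ihq =>
    intro e he k hm c hc s v
    obtain ⟨n, o, hn, h⟩ := ihp (fun l => e (.inl l)) (he.comp Sum.inl_injective)
      (entry q (fun l => e (.inr l)) k) (fun l b => hm (.inl l) b) c (fun l => hc (.inl l)) s v
    obtain ⟨n', o', hn', h'⟩ := ihq (fun l => e (.inr l)) (he.comp Sum.inr_injective) k
      (fun l b => hm (.inr l) b) c (fun l => hc (.inr l)) (Prog.eval N p s) (v.1, o)
    refine ⟨n + n', o', ?_, h.trans h'⟩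
    simp only [cost, Polynomial.eval_add]; omega
  | popCase r p q z ihp ihq ihz =>
    intro e he k hm c hc s v
    simp only [entry, cost, stepAux_popReg, stepAux_branch, Prog.eval, Polynomial.eval_add]
    cases (s r).head? == some true
    · cases (s r).head? == some false
      · obtain ⟨n, o, hn, h⟩ := ihz (fun l => e (.inr (.inr l)))
          (he.comp (Sum.inr_injective.comp Sum.inr_injective)) k
          (fun l b => hm (.inr (.inr l)) b) c (fun l => hc (.inr (.inr l)))
          (Function.update s r (s r).tail) (v.1, (s r).head?)
        exact ⟨n, o, by omega, h⟩
      · obtain ⟨n, o, hn, h⟩ := ihq (fun l => e (.inr (.inl l)))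
          (he.comp (Sum.inr_injective.comp Sum.inl_injective)) k
          (fun l b => hm (.inr (.inl l)) b) c (fun l => hc (.inr (.inl l)))
          (Function.update s r (s r).tail) (v.1, (s r).head?)
        exact ⟨n, o, by omega, h⟩
    · obtain ⟨n, o, hn, h⟩ := ihp (fun l => e (.inl l)) (he.comp Sum.inl_injective) k
        (fun l b => hm (.inl l) b) c (fun l => hc (.inl l))
        (Function.update s r (s r).tail) (v.1, (s r).head?)
      exact ⟨n, o, by omega, h⟩
  -- The first stack of the clock counts the rounds that remain and the second one those that were
  -- used. On leaving the loop the second is emptied onto the first, so the clock is full again when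
  -- an outer loop re-enters this one.
  | loop g p ih =>
    intro e he k hm c hc s v
    have hne : ((e none, true) : L × Bool) ≠ (e none, false) := by simp
    have hm1 := hm none true
    have hm0 := hm none false
    simp only [code] at hm1 hm0
    -- the state of the clock after `N - a` rounds
    let ck : ℕ → ℕ → L × Bool → List Bool := fun a b =>
      Function.update (Function.update c (e none, true)
        (List.replicate a true)) (e none, false) (List.replicate b true)
    have hck : ck N 0 = c := by
      funext j
      by_cases h1 : j = (e none, false)
      · subst h1; simp [ck, (hc none).2]
      by_cases h2 : j = (e none, true)
      · subst h2; simp [ck, (hc none).1]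
      · simp [ck, h1, h2]
    -- Injectivity of `e` separates the clock of this loop from the clocks of the loops in its body.
    have hset : ∀ a b, ClocksSet (fun l => e (some l)) N (ck a b) := by
      intro a b l
      have h0 : e (some l) ≠ e none := fun h => by simpa using he h
      refine ⟨?_, ?_⟩
      · simp [ck, h0, (hc (some l)).1]
      · simp [ck, h0, (hc (some l)).2]
    have hrest : ∀ a b s v, a + b = N → ∃ n o, n ≤ N + 1 ∧
        Runs m n ⟨some (.run (e none, false)), v, Stack.mk S s (ck a b) t f⟩
          (stepAux k (v.1, o) (Stack.mk S s c t f)) := by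
      intro a b s v hab
      obtain ⟨o, h⟩ := runs_restore hm0 S s c t f N a b hab v
      refine ⟨b + 1, o, by omega, ?_⟩
      rwa [← hck]
    -- Each round costs one step for clock and guard besides its body; `N + 2` covers the final
    -- failed test and restoring the clock.
    have key : ∀ a b s v, a + b = N → ∃ n o, n ≤ a * ((cost p).eval N + 1) + N + 2 ∧
        Runs m n ⟨some (.run (e none, true)), v, Stack.mk S s (ck a b) t f⟩
          (stepAux k (v.1, o) (Stack.mk S (rounds g (Prog.eval N p) a s) c t f)) := by
      intro a
      induction a with
      | zero =>
        intro b s v hab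
        obtain ⟨n, o, hn, h⟩ := hrest 0 b s (v.1, none) hab
        refine ⟨n + 1, o, by omega, Runs.head ?_⟩
        rw [hm1]
        have h1 : ck 0 b (e none, true) = [] := by simp [ck]
        simp only [stepAux_popClk, h1, List.head?_nil, stepAux_branch, Option.isSome_none,
          cond_false, stepAux_jump, List.tail_nil]
        rwa [← h1, Function.update_eq_self]
      | succ a iha =>
        intro b s v hab
        have h1 : ck (a + 1) b (e none, true) = true :: List.replicate a true := by
          simp [ck, List.replicate_succ]
        have h2 : Function.update (Function.update (ck (a + 1) b) (e none, true)
            (List.replicate a true)) (e none, false) (true :: ck (a + 1) b (e none, false)) =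
            ck a (b + 1) := by
          simp only [ck, Function.update_self]
          rw [Function.update_comm hne, Function.update_idem, Function.update_comm hne.symm,
            Function.update_idem, Function.update_comm hne, List.replicate_succ,
            Function.update_comm hne.symm]
        have h3 : Function.update (ck (a + 1) b) (e none, true) (List.replicate a true)
            (e none, false) = ck (a + 1) b (e none, false) := by
          rw [Function.update_of_ne hne.symm]
        obtain ⟨o, ht⟩ := stepAux_testCode (v.1, some true) S s (ck a (b + 1)) t f
          (entry p (fun l => e (some l)) (jump (.run (e none, true))))
          (jump (.run (e none, false)) : MStmt Γ R L Λ σ) g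
        have hstep : stepAux (m (.run (e none, true))) v (Stack.mk S s (ck (a + 1) b) t f) =
            stepAux (testCode g (entry p (fun l => e (some l)) (jump (.run (e none, true))))
              (jump (.run (e none, false)))) (v.1, some true)
              (Stack.mk S s (ck a (b + 1)) t f) := by
          rw [hm1]
          simp only [stepAux_popClk, h1, List.head?_cons, stepAux_branch, Option.isSome_some,
            cond_true, List.tail_cons, stepAux_pushClk]
          rw [h3, h2]
        rw [rounds]
        cases hg : (test g s).1 with
        | false =>
          obtain ⟨n, o', hn, h⟩ := hrest a (b + 1) (test g s).2 (v.1, o) (by omega)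
          refine ⟨n + 1, o', by nlinarith, Runs.head ?_⟩
          rw [hstep, ht, hg]
          exact h
        | true =>
          obtain ⟨n, o1, hn, h⟩ := ih (fun l => e (some l))
            (he.comp (Option.some_injective _)) (jump (.run (e none, true)))
            (fun l b => hm (some l) b) (ck a (b + 1)) (hset _ _) (test g s).2 (v.1, o)
          obtain ⟨n', o2, hn', h'⟩ := iha (b + 1) (Prog.eval N p (test g s).2) (v.1, o1) (by omega)
          refine ⟨n + n' + 1, o2, by nlinarith, Runs.head ?_⟩
          rw [hstep, ht, hg]
          exact h.trans h'
    obtain ⟨n, o, hn, h⟩ := key N 0 s v (by omega)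
    refine ⟨n, o, ?_, ?_⟩
    · simpa [cost] using hn
    · rw [hck] at h
      exact h

end Machine

end QOver

end

noncomputable section

namespace QOver

open Turing.TM2 (stepAux)
open Turing.TM2.Stmt

theorem natPolynomial_eval_mono (p : Polynomial ℕ) {a b : ℕ} (h : a ≤ b) : p.eval a ≤ p.eval b := by
  rw [Polynomial.eval_eq_sum_range, Polynomial.eval_eq_sum_range]
  gcongr

/-! ### Running a machine and then a program -/

/-- The number of pushes in a statement. -/
def pushes {K Λ σ : Type} {Γ : K → Type} : Turing.TM2.Stmt Γ Λ σ → ℕ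
  | push _ _ q => pushes q + 1
  | peek _ _ q => pushes q
  | pop _ _ q => pushes q
  | load _ q => pushes q
  | branch _ q q' => pushes q + pushes q'
  | goto _ => 0
  | halt => 0

theorem length_stepAux_le {K Λ σ : Type} {Γ : K → Type} [DecidableEq K]
    (q : Turing.TM2.Stmt Γ Λ σ) (v : σ) (S : ∀ k, List (Γ k)) (k : K) :
    ((stepAux q v S).stk k).length ≤ (S k).length + pushes q := by
  induction q generalizing v S with
  | push k' f q ih =>
    refine (ih _ _).trans ?_
    by_cases h : k = k'
    · subst h; simp [pushes]; omega
    · simp [pushes, h]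
  | peek k' f q ih => exact ih _ _
  | pop k' f q ih =>
    refine (ih _ _).trans ?_
    by_cases h : k = k'
    · subst h; simp [pushes]
    · simp [pushes, h]
  | load f q ih => exact ih _ _
  | branch f q q' ih ih' =>
    simp only [stepAux, pushes]
    have := ih v S
    have := ih' v S
    cases f v
    · simp only [cond_false]; omega
    · simp only [cond_true]; omega
  | goto f => simp [pushes]
  | halt => simp [pushes]

section Simulation

variable {K : Type} {Γ : K → Type} {R L Λ σ : Type} [DecidableEq K] [DecidableEq R] [DecidableEq L]

theorem iterate_bind_none {α : Type} (f : α → Option α) (n : ℕ) :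
    (flip bind f)^[n] none = none := by
  induction n with
  | zero => rfl
  | succ n ih => rw [Function.iterate_succ_apply]; exact ih

/-- One step pushes no more than the code at one label does. This bounds the output of the first
machine, whose length becomes the loop bound of the program that follows. -/
theorem length_iterate_le [Fintype Λ] (m : Λ → Turing.TM2.Stmt Γ Λ σ) (n : ℕ)
    (c d : Turing.TM2.Cfg Γ Λ σ) (h : (flip bind (Turing.TM2.step m))^[n] (some c) = some d)
    (k : K) : (d.stk k).length ≤ (c.stk k).length + n * ∑ l, pushes (m l) := by
  induction n generalizing c with
  | zero => cases h; simp
  | succ n ih =>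
    rw [Function.iterate_succ_apply] at h
    obtain ⟨l, v, S⟩ := c
    cases l with
    | none =>
      change (flip bind (Turing.TM2.step m))^[n] none = _ at h
      rw [iterate_bind_none] at h
      cases h
    | some l =>
      have h1 := ih (stepAux (m l) v S) h
      have h2 := length_stepAux_le (m l) v S k
      have h3 : pushes (m l) ≤ ∑ l, pushes (m l) :=
        Finset.single_le_sum (f := fun l => pushes (m l)) (fun _ _ => Nat.zero_le _)
          (Finset.mem_univ l)
      rw [Nat.succ_mul]
      simp only
      omega

/-- The statements of the first machine, as statements of the compiled machine. -/
def liftStmt : Turing.TM2.Stmt Γ Λ σ → MStmt Γ R L Λ σ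
  | push k f q => push (.old k) (fun v => f v.1) (liftStmt q)
  | peek k f q => peek (.old k) (fun v o => (f v.1 o, v.2)) (liftStmt q)
  | pop k f q => pop (.old k) (fun v o => (f v.1 o, v.2)) (liftStmt q)
  | load f q => load (fun v => (f v.1, v.2)) (liftStmt q)
  | branch f q q' => branch (fun v => f v.1) (liftStmt q) (liftStmt q')
  | goto f => goto fun v => .old (f v.1)
  | halt => jump .feed

/-- The configurations of the first machine, as configurations of the compiled machine. -/
def liftCfg (o : Option Bool) (s : R → List Bool) (c : L × Bool → List Bool) (t f : List Bool)
    (d : Turing.TM2.Cfg Γ Λ σ) : MCfg Γ R L Λ σ :=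
  ⟨some (d.l.elim .feed .old), (d.var, o), Stack.mk d.stk s c t f⟩

theorem stepAux_liftStmt (q : Turing.TM2.Stmt Γ Λ σ) (v : σ) (o : Option Bool)
    (S : ∀ k, List (Γ k)) (s : R → List Bool) (c : L × Bool → List Bool) (t f : List Bool) :
    stepAux (liftStmt q) (v, o) (Stack.mk S s c t f) = liftCfg o s c t f (stepAux q v S) := by
  induction q generalizing v S with
  | push k' g q ih =>
    refine Eq.trans ?_ (ih v _)
    rw [← Stack.update_old]; rfl
  | peek k' g q ih => exact ih _ _
  | pop k' g q ih =>
    refine Eq.trans ?_ (ih _ _)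
    rw [← Stack.update_old]; rfl
  | load g q ih => exact ih _ _
  | branch g q q' ih ih' =>
    simp only [liftStmt, stepAux]
    cases g v
    · exact ih' _ _
    · exact ih _ _
  | goto g => rfl
  | halt => rfl

/-- The simulation is step by step. Halting becomes a jump to `.feed`, which is why the label `none`
is translated to it. -/
theorem runs_liftCfg {m₀ : Λ → Turing.TM2.Stmt Γ Λ σ} {m : Label Λ L → MStmt Γ R L Λ σ}
    (hm : ∀ l, m (.old l) = liftStmt (m₀ l)) (o : Option Bool)
    (s : R → List Bool) (c : L × Bool → List Bool) (t f : List Bool) (n : ℕ)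
    (d e : Turing.TM2.Cfg Γ Λ σ)
    (h : (flip bind (Turing.TM2.step m₀))^[n] (some d) = some e) :
    Runs m n (liftCfg o s c t f d) (liftCfg o s c t f e) := by
  induction n generalizing d with
  | zero => cases h; rfl
  | succ n ih =>
    rw [Function.iterate_succ_apply] at h
    obtain ⟨l, v, S⟩ := d
    cases l with
    | none =>
      change (flip bind (Turing.TM2.step m₀))^[n] none = _ at h
      rw [iterate_bind_none] at h
      cases h
    | some l =>
      refine Runs.head ?_
      change Runs m n (stepAux (m (.old l)) (v, o) (Stack.mk S s c t f)) _
      rw [hm, stepAux_liftStmt]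
      exact ih _ h

/-- Push a bit on the first stack of each clock in a list. -/
def pushClocks : List L → MStmt Γ R L Λ σ → MStmt Γ R L Λ σ
  | [], k => k
  | i :: l, k => push (.clk (i, true)) (fun _ => true) (pushClocks l k)

/-- All clocks show the same number. -/
def clocks (n : ℕ) : L × Bool → List Bool
  | (_, true) => List.replicate n true
  | (_, false) => []

theorem stepAux_pushClocks (l : List L) (hl : l.Nodup) (k : MStmt Γ R L Λ σ) (v : σ × Option Bool)
    (S : ∀ k, List (Γ k)) (s : R → List Bool) (c : L × Bool → List Bool) (t f : List Bool) :
    stepAux (pushClocks l k) v (Stack.mk S s c t f) = stepAux k v (Stack.mk S s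
      (fun i => if i.1 ∈ l ∧ i.2 = true then true :: c i else c i) t f) := by
  induction l generalizing c with
  | nil => simp [pushClocks]
  | cons i l ih =>
    rw [pushClocks, stepAux_pushClk, ih hl.of_cons]
    congr 2
    funext j
    obtain ⟨j, b⟩ := j
    have hi := (List.nodup_cons.1 hl).1
    by_cases h1 : j = i
    · subst h1
      cases b <;> simp [hi]
    · simp [h1]

/-- Pop from each stack in a list, and remember whether one of them was nonempty. -/
def popAll : List (Stack K R L) → MStmt Γ R L Λ σ → MStmt Γ R L Λ σ
  | [], k => k
  | i :: l, k => pop i (fun v o => (v.1, bif o.isSome then some true else v.2)) (popAll l k)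

/-- The remembered bit is the exit condition of the cleaning loop: starting from `none`, it stays
`none` exactly if all listed stacks were empty. The length bounds show that every round makes
progress on all of them. -/
theorem stepAux_popAll (l : List (Stack K R L)) (k : MStmt Γ R L Λ σ) (v : σ × Option Bool)
    (T : ∀ k, List (Stack.Alph Γ R L k)) :
    ∃ o T', stepAux (popAll l k) v T = stepAux k (v.1, o) T' ∧
      (∀ i ∉ l, T' i = T i) ∧ (∀ i, (T' i).length ≤ (T i).length) ∧
      (∀ i ∈ l, (T' i).length ≤ (T i).length - 1) ∧
      (o = none → v.2 = none ∧ T' = T ∧ ∀ i ∈ l, T i = []) ∧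
      (v.2 = none → (∀ i ∈ l, T i = []) → o = none) := by
  induction l generalizing v T with
  | nil => exact ⟨v.2, T, rfl, by simp, by simp, by simp, by simp, by simp⟩
  | cons i l ih =>
    obtain ⟨o, T', h0, h1, h2, h3, h4, h5⟩ := ih
      (v.1, bif (T i).head?.isSome then some true else v.2) (Function.update T i (T i).tail)
    have hup : ∀ j, (Function.update T i (T i).tail j).length ≤ (T j).length := by
      intro j
      by_cases h : j = i
      · subst h; simp
      · simp [h]
    refine ⟨o, T', h0, ?_, ?_, ?_, ?_, ?_⟩
    · intro j hj
      rw [List.mem_cons, not_or] at hj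
      rw [h1 j hj.2, Function.update_of_ne hj.1]
    · exact fun j => (h2 j).trans (hup j)
    · intro j hj
      by_cases h : j = i
      · subst h
        refine (h2 j).trans ?_
        simp
      · refine (h3 j (by simpa [h] using hj)).trans ?_
        rw [Function.update_of_ne h]
    · intro ho
      obtain ⟨h6, h7, h8⟩ := h4 ho
      have h9 : T i = [] := by
        cases hT : T i with
        | nil => rfl
        | cons a b => simp [hT] at h6
      have h10 : Function.update T i (T i).tail = T := by
        rw [h9, List.tail_nil, ← h9, Function.update_eq_self]
      rw [h10] at h7 h8
      refine ⟨by simpa [h9] using h6, h7, ?_⟩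
      simpa [h9] using h8
    · intro hv hT
      have h9 : T i = [] := hT i (by simp)
      have h10 : Function.update T i (T i).tail = T := by
        rw [h9, List.tail_nil, ← h9, Function.update_eq_self]
      refine h5 (by simp [h9, hv]) ?_
      rw [h10]
      exact fun j hj => hT j (by simp [hj])

end Simulation

section Compose

variable {R : Type} [DecidableEq R]

open Prog

/-- The code of the machine that runs `M` and then the program `p`; the stacks in the list `ks`
are emptied in the end. -/
def composedCode (M : Turing.FinTM2) (out : M.Γ M.k₁ ≃ Bool) (p : Prog R) (ri ro : R)
    (ks : List (Stack M.K R (Lab p))) :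
    Label M.Λ (Lab p) → MStmt M.Γ R (Lab p) M.Λ M.σ
  | .old l => liftStmt (M.m l)
  | .feed => pop (.old M.k₁) (fun v o => (v.1, o.map out)) (branch (fun v => v.2.isSome)
      (push .tmp (fun v => v.2.getD false) (jump .feed)) (jump .load))
  | .load => popTmp (branch (fun v => v.2.isSome)
      (push (.reg ri) (fun v => v.2.getD false)
        (pushClocks (Finset.univ : Finset (Lab p)).toList (jump .load)))
      (entry p id (jump .clean)))
  | .run i => code p id (jump .clean) i
  | .clean => load (fun v => (v.1, none))
      (popAll ks (branch (fun v => v.2.isSome) (jump .clean) (jump .finish)))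
  | .finish => popReg ro (branch (fun v => v.2.isSome)
      (push .fin (fun v => v.2.getD false) (jump .finish))
      (load (fun _ => (M.initialState, none)) halt))

/-- The machine that runs `M` and then the program `p`. -/
def composed [Fintype R] (M : Turing.FinTM2) (out : M.Γ M.k₁ ≃ Bool) (p : Prog R) (ri ro : R) :
    Turing.FinTM2 :=
  have := M.kFin
  have := M.ΛFin
  have := M.σFin
  have : Fintype (M.Γ M.k₀) := M.Γk₀Fin
  { K := Stack M.K R (Lab p)
    k₀ := .old M.k₀
    k₁ := .fin
    Γ := Stack.Alph M.Γ R (Lab p)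
    Λ := Label M.Λ (Lab p)
    main := .old M.main
    σ := M.σ × Option Bool
    initialState := (M.initialState, none)
    Γk₀Fin := this
    m := composedCode M out p ri ro ((Finset.univ : Finset (Stack M.K R (Lab p))).toList.filter
      fun i => i ≠ .reg ro ∧ i ≠ .fin) }

variable {M : Turing.FinTM2} {out : M.Γ M.k₁ ≃ Bool} {p : Prog R} {ri ro : R}
  {ks : List (Stack M.K R (Lab p))}

/-- The word is reversed on the auxiliary stack, and reversed back when it is loaded into the
register. -/
theorem runs_feed (l : List Bool) (S : ∀ k, List (M.Γ k)) (hS : S M.k₁ = l.map out.symm)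
    (v : M.σ × Option Bool) (s : R → List Bool) (c : Lab p × Bool → List Bool) (t f : List Bool) :
    Runs (composedCode M out p ri ro ks) (l.length + 1) ⟨some .feed, v, Stack.mk S s c t f⟩
      ⟨some .load, (v.1, none), Stack.mk (Function.update S M.k₁ []) s c (l.reverse ++ t) f⟩ := by
  have hstep : ∀ (k : MStmt M.Γ R (Lab p) M.Λ M.σ) (S : ∀ k, List (M.Γ k))
      (v : M.σ × Option Bool) (t : List Bool),
      stepAux (pop (.old M.k₁) (fun v o => (v.1, o.map out)) k) v (Stack.mk S s c t f) =
      stepAux k (v.1, (S M.k₁).head?.map out)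
        (Stack.mk (Function.update S M.k₁ (S M.k₁).tail) s c t f) := by
    intro k S v t
    rw [← Stack.update_old]; rfl
  induction l generalizing S v t with
  | nil =>
    refine Runs.head ?_
    rw [composedCode, hstep, hS]
    simp [Runs]
  | cons b l ih =>
    refine Runs.head ?_
    rw [composedCode, hstep, hS]
    have := ih (Function.update S M.k₁ (l.map out.symm)) (by simp) (v.1, some b) (b :: t)
    rw [Function.update_idem] at this
    simp only [List.map_cons, List.head?_cons, Option.map_some, Equiv.apply_symm_apply,
      List.tail_cons, stepAux_branch, Option.isSome_some, cond_true, stepAux_pushTmp,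
      Option.getD_some, stepAux_jump]
    simpa using this

/-- Every loaded bit also advances all clocks, so the program starts with its loop bound equal to
the length of its own input. -/
theorem runs_load (l : List Bool) (v : M.σ × Option Bool) (S : ∀ k, List (M.Γ k))
    (s : R → List Bool) (n : ℕ) (f : List Bool) :
    ∃ o, Runs (composedCode M out p ri ro ks) (l.length + 1)
      ⟨some .load, v, Stack.mk S s (clocks n) l f⟩
      (stepAux (entry p id (jump .clean)) (v.1, o)
        (Stack.mk S (Function.update s ri (l.reverse ++ s ri)) (clocks (n + l.length)) [] f)) := by
  induction l generalizing v s n with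
  | nil =>
    refine ⟨none, Runs.head ?_⟩
    rw [composedCode]
    simp [Runs]
  | cons b l ih =>
    obtain ⟨o, h⟩ := ih (v.1, some b) (Function.update s ri (b :: s ri)) (n + 1)
    refine ⟨o, Runs.head ?_⟩
    have hclk : (fun i : Lab p × Bool => if i.2 = true then true :: clocks n i else clocks n i) =
        clocks (n + 1) := by
      funext ⟨i, b⟩
      cases b <;> simp [clocks, List.replicate_succ]
    rw [composedCode]
    simp only [stepAux_popTmp, List.head?_cons, stepAux_branch, Option.isSome_some, cond_true,
      List.tail_cons, stepAux_pushReg, Option.getD_some]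
    rw [stepAux_pushClocks _ (Finset.nodup_toList _)]
    simp only [Finset.mem_toList, Finset.mem_univ, true_and, hclk, stepAux_jump]
    rw [Function.update_idem, Function.update_self, Nat.add_right_comm] at h
    simpa [Nat.add_assoc, Nat.add_comm, Nat.add_left_comm] using h

/-- A round shortens each nonempty stack by one, and one more round notices that all are empty.
Cleaning is necessary because a halting configuration may have only its output stack nonempty. -/
theorem runs_clean (B : ℕ) (v : M.σ × Option Bool)
    (T : ∀ k, List (Stack.Alph M.Γ R (Lab p) k)) (hT : ∀ i ∈ ks, (T i).length ≤ B) :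
    ∃ n o T', n ≤ B + 1 ∧ Runs (composedCode M out p ri ro ks) n ⟨some .clean, v, T⟩
      ⟨some .finish, (v.1, o), T'⟩ ∧ (∀ i ∈ ks, T' i = []) ∧ ∀ i ∉ ks, T' i = T i := by
  have hstep : ∀ (v : M.σ × Option Bool) (T : ∀ k, List (Stack.Alph M.Γ R (Lab p) k)),
      stepAux (composedCode M out p ri ro ks .clean) v T =
        stepAux (popAll ks (branch (fun v => v.2.isSome) (jump .clean) (jump .finish)))
          (v.1, none) T := fun _ _ => rfl
  induction B generalizing v T with
  | zero =>
    obtain ⟨o, T', h0, h1, h2, h3, h4, h5⟩ := stepAux_popAll ks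
      (branch (fun v => v.2.isSome) (jump .clean) (jump .finish)) (v.1, none) T
    have hT0 : ∀ i ∈ ks, T i = [] := fun i hi => by simpa using hT i hi
    have ho := h5 rfl hT0
    refine ⟨1, o, T, le_rfl, Runs.head ?_, hT0, fun _ _ => rfl⟩
    rw [hstep, h0, ho, (h4 ho).2.1]
    rfl
  | succ B ih =>
    obtain ⟨o, T', h0, h1, h2, h3, h4, h5⟩ := stepAux_popAll ks
      (branch (fun v => v.2.isSome) (jump .clean) (jump .finish)) (v.1, none) T
    cases ho : o with
    | none =>
      refine ⟨1, o, T, by omega, Runs.head ?_, (h4 ho).2.2, fun _ _ => rfl⟩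
      rw [hstep, h0, ho, (h4 ho).2.1]
      rfl
    | some b =>
      obtain ⟨n, o', T'', hn, hr, he, hk⟩ := ih (v.1, o) T'
        (fun i hi => (h3 i hi).trans (by have := hT i hi; omega))
      refine ⟨n + 1, o', T'', by omega, Runs.head ?_, he, fun i hi => (hk i hi).trans (h1 i hi)⟩
      rw [hstep, h0, ho]
      rw [ho] at hr
      exact hr

/-- Moving the result to the output stack reverses it. Programs push their output bit by bit onto a
register, and this reversal restores the order of writing. -/
theorem runs_finish (l f : List Bool) (v : M.σ × Option Bool) (S : ∀ k, List (M.Γ k))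
    (s : R → List Bool) (hs : s ro = l) (c : Lab p × Bool → List Bool) (t : List Bool) :
    Runs (composedCode M out p ri ro ks) (l.length + 1) ⟨some .finish, v, Stack.mk S s c t f⟩
      ⟨none, (M.initialState, none),
        Stack.mk S (Function.update s ro []) c t (l.reverse ++ f)⟩ := by
  induction l generalizing v s f with
  | nil =>
    refine Runs.head ?_
    rw [composedCode]
    simp [hs, Runs]
  | cons b l ih =>
    refine Runs.head ?_
    have := ih (b :: f) (v.1, some b) (Function.update s ro l) (by simp)
    rw [Function.update_idem] at this
    rw [composedCode]
    simp only [stepAux_popReg, hs, List.head?_cons, List.tail_cons, stepAux_branch,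
      Option.isSome_some, cond_true, stepAux_pushFin, Option.getD_some, stepAux_jump]
    simpa using this

end Compose

theorem initList_stk_self (M : Turing.FinTM2) (l : List (M.Γ M.k₀)) :
    (Turing.initList M l).stk M.k₀ = l := by
  simp [Turing.initList]

theorem haltList_stk_self (M : Turing.FinTM2) (l : List (M.Γ M.k₁)) :
    (Turing.haltList M l).stk M.k₁ = l := by
  simp [Turing.haltList]

open Prog in
/-- Polynomial-time functions may be followed by programs. -/
theorem PolyTime.program {f : List Bool → List Bool} (hf : PolyTime f) {R : Type} [DecidableEq R]
    [Fintype R] (p : Prog R) (ri ro : R) :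
    PolyTime fun x => (eval (f x).length p (Function.update (fun _ => []) ri (f x)) ro).reverse := by
  obtain ⟨⟨⟨M, ina, outa⟩, time, hM⟩⟩ := hf
  let := M.kFin
  let := M.ΛFin
  simp only [id_eq] at hM
  set ks : List (Stack M.K R (Lab p)) :=
    (Finset.univ : Finset (Stack M.K R (Lab p))).toList.filter
      fun i => i ≠ .reg ro ∧ i ≠ .fin with hks
  have hmem : ∀ i, i ∈ ks ↔ i ≠ .reg ro ∧ i ≠ .fin := by
    intro i
    simp [hks]
  let B : ℕ := ∑ l, pushes (M.m l)
  -- bound on the length of the output of the first machine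
  let Q : Polynomial ℕ := Polynomial.X + time * Polynomial.C B
  -- The summands bound, in turn, the first machine, feeding, loading, the program, cleaning and the
  -- transfer of the result.
  let T : Polynomial ℕ := time + (Q + 1) + (Q + 1) + (cost p).comp Q + (Q + (growth p).comp Q + 1) +
    (Q + (growth p).comp Q + 1)
  suffices h : ∀ x : List Bool, ∃ n, n ≤ T.eval x.length ∧
      (flip bind (composed M outa p ri ro).step)^[n]
        (some (Turing.initList (composed M outa p ri ro) (x.map ina.invFun))) =
      some (Turing.haltList (composed M outa p ri ro)
        (eval (f x).length p (Function.update (fun _ => []) ri (f x)) ro).reverse) by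
    choose n hn h using h
    exact ⟨⟨⟨composed M outa p ri ro, ina, Equiv.refl Bool⟩, T,
      fun x => ⟨⟨n x, (h x).trans (congrArg
        (fun l : List Bool => some (Turing.haltList (composed M outa p ri ro) l))
        (List.map_id _).symm)⟩, hn x⟩⟩⟩
  intro x
  obtain ⟨⟨n₀, h₀⟩, hn₀⟩ := hM x
  simp only [Option.map_some] at h₀
  have hlen : (f x).length ≤ Q.eval x.length := by
    have h1 := length_iterate_le M.m n₀ _ _ h₀ M.k₁
    have h2 : ((Turing.haltList M (List.map outa.invFun (f x))).stk M.k₁).length =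
        (f x).length := by
      simp [Turing.haltList]
    have h3 : ((Turing.initList M (List.map ina.invFun x)).stk M.k₁).length ≤ x.length := by
      -- The output stack may coincide with the input stack, in which case it initially holds the
      -- input.
      by_cases h : M.k₁ = M.k₀
      · have : ∀ (k : M.K) (h : k = M.k₀),
            ((Turing.initList M (List.map ina.invFun x)).stk k).length ≤ x.length := by
          rintro k rfl
          simp [Turing.initList]
        exact this _ h
      · simp [Turing.initList, h]
    rw [h2] at h1
    simp only [Q, Polynomial.eval_add, Polynomial.eval_X, Polynomial.eval_mul, Polynomial.eval_C]
    have h4 : n₀ * B ≤ Polynomial.eval x.length time * B := Nat.mul_le_mul_right _ hn₀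
    exact h1.trans (add_le_add h3 h4)
  let m := composedCode M outa p ri ro ks
  let s₀ : R → List Bool := fun _ => []
  let s₁ : R → List Bool := Function.update s₀ ri (f x)
  let s₂ : R → List Bool := eval (f x).length p s₁
  -- the first machine
  have hr₀ : Runs m n₀ (liftCfg none s₀ (clocks 0) [] [] (Turing.initList M (x.map ina.invFun)))
      (liftCfg none s₀ (clocks 0) [] [] (Turing.haltList M ((f x).map outa.invFun))) :=
    runs_liftCfg (fun l => rfl) none s₀ (clocks 0) [] [] n₀ _ _ h₀
  -- transfer of the output
  have hr₁ := runs_feed (out := outa) (p := p) (ri := ri) (ro := ro) (ks := ks) (f x)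
    (Turing.haltList M ((f x).map outa.invFun)).stk (by simp [Turing.haltList])
    (M.initialState, none) s₀ (clocks 0) [] []
  have hS : Function.update (Turing.haltList M ((f x).map outa.invFun)).stk M.k₁ [] =
      fun _ => [] := by
    funext k
    by_cases h : k = M.k₁
    · subst h; simp
    · simp [h, Turing.haltList]
  rw [hS] at hr₁
  obtain ⟨o₂, hr₂⟩ := runs_load (M := M) (out := outa) (p := p) (ri := ri) (ro := ro) (ks := ks)
    (f x).reverse (M.initialState, none) (fun _ => []) s₀ 0 []
  simp only [List.reverse_reverse, List.length_reverse, Nat.zero_add] at hr₂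
  rw [List.append_nil] at hr₁
  have hs₁ : Function.update s₀ ri (f x ++ s₀ ri) = s₁ := by simp [s₁, s₀]
  rw [hs₁] at hr₂
  -- the program
  obtain ⟨n₃, o₃, hn₃, hr₃⟩ := runs_entry (m := m) (fun _ => []) [] [] (f x).length p id
    Function.injective_id (jump .clean) (fun l b => rfl) (clocks (f x).length)
    (fun l => ⟨rfl, rfl⟩) s₁ (M.initialState, o₂)
  have hlen₂ : ∀ r, (s₂ r).length ≤ (f x).length + (growth p).eval (f x).length := by
    intro r
    refine (length_eval_le _ _ _ _).trans (Nat.add_le_add_right ?_ _)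
    by_cases h : r = ri
    · subst h; simp [s₁]
    · simp [s₁, h, s₀]
  -- the end
  obtain ⟨n₄, o₄, T₄, hn₄, hr₄, he₄, hk₄⟩ := runs_clean (M := M) (out := outa) (p := p) (ri := ri)
    (ro := ro) (ks := ks) ((f x).length + (growth p).eval (f x).length) (M.initialState, o₃)
    (Stack.mk (fun _ => []) s₂ (clocks (f x).length) [] []) (by
      intro i hi
      cases i with
      | old k => simp [Stack.mk]
      | reg r => exact hlen₂ r
      | clk i =>
        obtain ⟨i, b⟩ := i
        cases b <;> simp [Stack.mk, clocks]
      | tmp => simp [Stack.mk]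
      | fin => simp [Stack.mk])
  have hT₄ : T₄ = Stack.mk (fun _ => []) (Function.update (fun _ => []) ro (s₂ ro)) (clocks 0)
      [] [] := by
    funext i
    cases i with
    | old k => exact he₄ _ ((hmem _).2 (by simp))
    | reg r =>
      by_cases h : r = ro
      · subst h
        rw [hk₄ _ (by rw [hmem]; simp)]
        simp [Stack.mk]
      · rw [he₄ _ ((hmem _).2 (by simp [h]))]
        simp [Stack.mk, h]
    | clk i =>
      rw [he₄ _ ((hmem _).2 (by simp))]
      obtain ⟨i, b⟩ := i
      cases b <;> simp [Stack.mk, clocks]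
    | tmp => exact he₄ _ ((hmem _).2 (by simp))
    | fin =>
      rw [hk₄ _ (by rw [hmem]; simp)]
      simp [Stack.mk]
  have hr₅ := runs_finish (M := M) (out := outa) (p := p) (ri := ri) (ro := ro) (ks := ks)
    (s₂ ro) [] (M.initialState, o₄) (fun _ => []) (Function.update (fun _ => []) ro (s₂ ro))
    (by simp) (clocks 0) []
  rw [hT₄] at hr₄
  have hall := hr₀.trans (hr₁.trans (hr₂.trans (hr₃.trans (hr₄.trans hr₅))))
  have hinit : Turing.initList (composed M outa p ri ro) (x.map ina.invFun) =
      liftCfg none s₀ (clocks 0) [] [] (Turing.initList M (x.map ina.invFun)) := by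
    change Turing.TM2.Cfg.mk _ _ _ = Turing.TM2.Cfg.mk _ _ _
    congr 1
    funext i
    cases i with
    | old k =>
      by_cases h : k = M.k₀
      · subst h
        exact (initList_stk_self (composed M outa p ri ro) _).trans (initList_stk_self M _).symm
      · simp [Stack.mk, composed, Turing.initList, h]
    | clk i =>
      obtain ⟨i, b⟩ := i
      cases b <;> simp [Stack.mk, clocks, composed]
    | _ => simp [Stack.mk, composed, s₀]
  have hfin : Turing.haltList (composed M outa p ri ro)
        (eval (f x).length p (Function.update (fun _ => []) ri (f x)) ro).reverse =
      (⟨none, (M.initialState, none), Stack.mk (fun _ => [])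
        (Function.update (Function.update (fun _ => []) ro (s₂ ro)) ro []) (clocks 0) []
        ((s₂ ro).reverse ++ [])⟩ : MCfg M.Γ R (Lab p) M.Λ M.σ) := by
    rw [Function.update_idem]
    change Turing.TM2.Cfg.mk _ _ _ = Turing.TM2.Cfg.mk _ _ _
    congr 1
    funext i
    cases i with
    | reg r =>
      have : Function.update (fun _ => []) ro [] r = ([] : List Bool) := by
        by_cases h : r = ro
        · subst h; simp
        · simp [h]
      simp [Stack.mk, composed, this]
    | clk i =>
      obtain ⟨i, b⟩ := i
      cases b <;> simp [Stack.mk, clocks, composed]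
    | fin =>
      exact (haltList_stk_self (composed M outa p ri ro) _).trans (List.append_nil _).symm
    | _ => simp [Stack.mk, composed]
  refine ⟨n₀ + ((f x).length + 1 + ((f x).length + 1 + (n₃ + (n₄ + ((s₂ ro).length + 1))))), ?_,
    ?_⟩
  · have hmono : ∀ P : Polynomial ℕ, P.eval (f x).length ≤ P.eval (Q.eval x.length) :=
      fun P => natPolynomial_eval_mono P hlen
    have h1 := hmono (cost p)
    have h2 := hmono (growth p)
    have h3 := hlen₂ ro
    have h4 : n₀ ≤ time.eval x.length := hn₀
    simp only [T, Polynomial.eval_add, Polynomial.eval_comp, Polynomial.eval_one]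
    omega
  · rw [hinit, hfin]
    exact hall

end QOver

end

/-! ### Quantum circuits on named qubits, and exact gadgets. -/

noncomputable section

namespace QOver

/-! ### Circuits on qubits with arbitrary labels -/

/-- A gate on qubits labelled by `ι`. -/
inductive LGate (ι : Type) : Type
  | one (i : ι) (U : OneQubitGate) : LGate ι
  | two (i j : ι) (h : i ≠ j) (U : TwoQubitGate) : LGate ι

/-- State vectors of qubits labelled by `ι`. -/
abbrev LState (ι : Type) : Type := (ι → Fin 2) → ℂ

section Labelled

variable {ι κ : Type} [DecidableEq ι] [DecidableEq κ]

/-- The action of a gate. -/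
def LGate.apply : LGate ι → LState ι → LState ι
  | .one i U, ψ => fun x =>
      ∑ s : Fin 2, (U.1 (x i) s).toComplex * ψ (Function.update x i s)
  | .two i j _ U, ψ => fun x =>
      ∑ s : Fin 2, ∑ t : Fin 2,
        (U.1 (x i, x j) (s, t)).toComplex * ψ (Function.update (Function.update x i s) j t)

omit [DecidableEq ι] [DecidableEq κ] in
/-- Relabelling the qubits. -/
def LGate.map (e : κ → ι) (he : Function.Injective e) : LGate κ → LGate ι
  | .one i U => .one (e i) U
  | .two i j h U => .two (e i) (e j) (fun h' => h (he h')) U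

/-- The action of a list of gates. -/
def run (C : List (LGate ι)) (ψ : LState ι) : LState ι := C.foldl (fun ψ g => g.apply ψ) ψ

@[simp] theorem run_nil (ψ : LState ι) : run [] ψ = ψ := rfl

@[simp] theorem run_cons (g : LGate ι) (C : List (LGate ι)) (ψ : LState ι) :
    run (g :: C) ψ = run C (g.apply ψ) := rfl

theorem run_append (C D : List (LGate ι)) (ψ : LState ι) :
    run (C ++ D) ψ = run D (run C ψ) := List.foldl_append

open scoped Classical in
/-- The state in which all qubits are zero. -/
def vac : LState ι := fun x => if x = 0 then 1 else 0

theorem LGate.apply_smul (g : LGate ι) (c : ℂ) (ψ : LState ι) :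
    g.apply (c • ψ) = c • g.apply ψ := by
  funext x
  cases g with
  | one i U =>
    simp only [LGate.apply, Pi.smul_apply, smul_eq_mul, Finset.mul_sum]
    exact Finset.sum_congr rfl fun s _ => by ring
  | two i j h U =>
    simp only [LGate.apply, Pi.smul_apply, smul_eq_mul, Finset.mul_sum]
    exact Finset.sum_congr rfl fun s _ => Finset.sum_congr rfl fun t _ => by ring

theorem run_smul (C : List (LGate ι)) (c : ℂ) (ψ : LState ι) : run C (c • ψ) = c • run C ψ := by
  induction C generalizing ψ with
  | nil => rfl
  | cons g C ih => rw [run_cons, LGate.apply_smul, ih, run_cons]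

theorem extend_update {e : κ → ι} (he : Function.Injective e) (x : κ → Fin 2) (z : ι → Fin 2)
    (i : κ) (s : Fin 2) :
    Function.extend e (Function.update x i s) z =
      Function.update (Function.extend e x z) (e i) s := by
  funext j
  by_cases h : ∃ a, e a = j
  · obtain ⟨a, rfl⟩ := h
    rw [he.extend_apply]
    by_cases hai : a = i
    · subst hai; simp
    · rw [Function.update_of_ne hai, Function.update_of_ne (fun h => hai (he h)), he.extend_apply]
  · rw [Function.extend_apply' _ _ _ h, Function.update_of_ne (fun h' => h ⟨i, h'.symm⟩),
      Function.extend_apply' _ _ _ h]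

/-- The values `z` of the qubits outside the block are mere spectators of a gate inside it. -/
theorem LGate.apply_map {e : κ → ι} (he : Function.Injective e) (g : LGate κ) (ψ : LState ι)
    (x : κ → Fin 2) (z : ι → Fin 2) :
    (g.map e he).apply ψ (Function.extend e x z) =
      g.apply (fun y => ψ (Function.extend e y z)) x := by
  cases g with
  | one i U => simp [LGate.apply, LGate.map, he.extend_apply, extend_update he]
  | two i j h U => simp [LGate.apply, LGate.map, he.extend_apply, extend_update he]

theorem run_map {e : κ → ι} (he : Function.Injective e) (C : List (LGate κ)) (ψ : LState ι)
    (x : κ → Fin 2) (z : ι → Fin 2) :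
    run (C.map (LGate.map e he)) ψ (Function.extend e x z) =
      run C (fun y => ψ (Function.extend e y z)) x := by
  induction C generalizing ψ with
  | nil => rfl
  | cons g C ih =>
    rw [List.map_cons, run_cons, ih, run_cons]
    congr 1
    funext y
    exact LGate.apply_map he g ψ y z

omit [DecidableEq ι] [DecidableEq κ] in
theorem extend_comp_self {e : κ → ι} (he : Function.Injective e) (z : ι → Fin 2) :
    Function.extend e (z ∘ e) z = z := by
  funext j
  by_cases h : ∃ a, e a = j
  · obtain ⟨a, rfl⟩ := h
    rw [he.extend_apply]; rfl
  · rw [Function.extend_apply' _ _ _ h]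

omit [DecidableEq ι] [DecidableEq κ] in
theorem extend_comp {e : κ → ι} (he : Function.Injective e) (y : κ → Fin 2) (z : ι → Fin 2) :
    Function.extend e y z ∘ e = y := by
  funext j
  exact he.extend_apply _ _ _

/-- A circuit on a block of qubits that are all zero. -/
theorem run_map_block {e : κ → ι} (he : Function.Injective e) (C : List (LGate κ)) (ψ : LState ι)
    (hψ : ∀ z, z ∘ e ≠ 0 → ψ z = 0) (z : ι → Fin 2) :
    run (C.map (LGate.map e he)) ψ z =
      ψ (Function.extend e 0 z) * run C vac (z ∘ e) := by
  conv_lhs => rw [← extend_comp_self he z]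
  rw [run_map he]
  have h : (fun y => ψ (Function.extend e y z)) = ψ (Function.extend e 0 z) • (vac : LState κ) := by
    funext y
    by_cases hy : y = 0
    · simp [hy, vac]
    · rw [hψ _ (by rwa [extend_comp he])]
      simp [hy, vac]
  rw [h, run_smul]
  rfl

theorem run_map_vac_eq_zero {e : κ → ι} (he : Function.Injective e) (C : List (LGate κ))
    (z : ι → Fin 2) (h : ∃ j, (∀ i, e i ≠ j) ∧ z j ≠ 0) :
    run (C.map (LGate.map e he)) vac z = 0 := by
  obtain ⟨j, hj, hz⟩ := h
  rw [run_map_block he _ _ (fun z hz => ?_)]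
  · have : Function.extend e 0 z ≠ 0 := by
      intro h0
      have := congrFun h0 j
      rw [Function.extend_apply' _ _ _ (by rintro ⟨i, hi⟩; exact hj i hi)] at this
      exact hz this
    simp [vac, this]
  · have : z ≠ 0 := by
      rintro rfl
      exact hz rfl
    simp [vac, this]

theorem run_map_vac {e : κ → ι} (he : Function.Injective e) (C : List (LGate κ))
    (x : κ → Fin 2) :
    run (C.map (LGate.map e he)) vac (Function.extend e x 0) = run C vac x := by
  rw [run_map he]
  congr 1
  funext y
  have : Function.extend e y 0 = 0 ↔ y = 0 := by
    constructor
    · intro h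
      rw [← extend_comp he y 0, h]; rfl
    · rintro rfl
      funext j
      by_cases h : ∃ a, e a = j
      · obtain ⟨a, rfl⟩ := h
        rw [he.extend_apply]; rfl
      · rw [Function.extend_apply' _ _ _ h]
  by_cases hy : y = 0
  · rw [vac, vac, if_pos (this.2 hy), if_pos hy]
  · rw [vac, vac, if_neg (mt this.1 hy), if_neg hy]

/-! ### Unitarity -/

section Unitarity

variable [Fintype ι]

/-- Double counting: a label `y` arises by setting the qubit `i` to `y i` in exactly two labels. -/
theorem sum_update (F : (ι → Fin 2) → ℝ) (i : ι) :
    ∑ x, ∑ s, F (Function.update x i s) = 2 * ∑ x, F x := by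
  have h : ∀ s, ∑ x : ι → Fin 2, F (Function.update x i s) =
      2 * ∑ x : ι → Fin 2 with x i = s, F x := by
    intro s
    have h1 : ∑ x : ι → Fin 2, F (Function.update x i s) =
        ∑ y : ι → Fin 2 with y i = s, ∑ x : ι → Fin 2 with Function.update x i s = y,
          F (Function.update x i s) := by
      rw [Finset.sum_fiberwise_of_maps_to]
      simp
    rw [h1, Finset.mul_sum]
    refine Finset.sum_congr rfl fun y hy => ?_
    rw [Finset.mem_filter] at hy
    have h2 : (Finset.univ.filter fun x : ι → Fin 2 => Function.update x i s = y) =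
        Finset.univ.image fun t => Function.update y i t := by
      ext x
      simp only [Finset.mem_filter, Finset.mem_univ, true_and, Finset.mem_image]
      constructor
      · rintro rfl
        exact ⟨x i, by simp⟩
      · rintro ⟨t, rfl⟩
        rw [Function.update_idem, ← hy.2, Function.update_eq_self]
    rw [h2, Finset.sum_image]
    · simp only [Function.update_idem, ← hy.2, Function.update_eq_self]
      simp
    · intro a _ b _ hab
      exact Function.update_injective y i hab
  rw [Finset.sum_comm]
  simp only [h]
  rw [← Finset.mul_sum, Finset.sum_fiberwise]

theorem sum_norm_sq_mulVec {m : Type} [Fintype m] [DecidableEq m] {U : Matrix m m ℂ}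
    (hU : U ∈ Matrix.unitaryGroup m ℂ) (v : m → ℂ) :
    ∑ s, ‖∑ t, U s t * v t‖ ^ 2 = ∑ t, ‖v t‖ ^ 2 := by
  have h : ∀ w : m → ℂ, ((∑ s, ‖w s‖ ^ 2 : ℝ) : ℂ) = star w ⬝ᵥ w := by
    intro w
    simp only [dotProduct, Pi.star_apply, RCLike.star_def, Complex.ofReal_sum, Complex.ofReal_pow,
      Complex.conj_mul']
  have h2 : ((∑ s, ‖(U.mulVec v) s‖ ^ 2 : ℝ) : ℂ) = ((∑ t, ‖v t‖ ^ 2 : ℝ) : ℂ) := by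
    rw [h, h, Matrix.star_mulVec, Matrix.dotProduct_mulVec, Matrix.vecMul_vecMul]
    have : U.conjTranspose * U = 1 := (Matrix.mem_unitaryGroup_iff').1 hU
    rw [this, Matrix.vecMul_one]
  exact_mod_cast h2

/-- On each fibre of labels that agree off the qubits of the gate, the gate is a unitary matrix.
Summing the equality of norms over all labels counts every fibre equally often on both sides. -/
theorem LGate.norm_apply (g : LGate ι) (ψ : LState ι) :
    ∑ x, ‖g.apply ψ x‖ ^ 2 = ∑ x, ‖ψ x‖ ^ 2 := by
  cases g with
  | one i U =>
    have h : ∀ x : ι → Fin 2, ∑ s, ‖(LGate.one i U).apply ψ (Function.update x i s)‖ ^ 2 =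
        ∑ s, ‖ψ (Function.update x i s)‖ ^ 2 := by
      intro x
      rw [← sum_norm_sq_mulVec U.2 fun s => ψ (Function.update x i s)]
      simp [LGate.apply]
    have h1 := sum_update (fun x => ‖(LGate.one i U).apply ψ x‖ ^ 2) i
    have h2 := sum_update (fun x => ‖ψ x‖ ^ 2) i
    simp only [h] at h1
    linarith
  | two i j hij U =>
    have h : ∀ x : ι → Fin 2, ∑ s, ∑ t,
        ‖(LGate.two i j hij U).apply ψ (Function.update (Function.update x i s) j t)‖ ^ 2 =
        ∑ s, ∑ t, ‖ψ (Function.update (Function.update x i s) j t)‖ ^ 2 := by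
      intro x
      have := sum_norm_sq_mulVec U.2
        fun p : Fin 2 × Fin 2 => ψ (Function.update (Function.update x i p.1) j p.2)
      rw [Fintype.sum_prod_type, Fintype.sum_prod_type] at this
      rw [← this]
      refine Finset.sum_congr rfl fun s _ => Finset.sum_congr rfl fun t _ => ?_
      rw [Fintype.sum_prod_type]
      have hc : ∀ s t s' t' : Fin 2, Function.update (Function.update (Function.update
          (Function.update x i s) j t) i s') j t' =
          Function.update (Function.update x i s') j t' := by
        intro s t s' t'
        rw [Function.update_comm hij.symm, Function.update_idem, Function.update_idem]
      simp [LGate.apply, hc, hij]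
    have key : ∀ F : (ι → Fin 2) → ℝ,
        ∑ x, ∑ s, ∑ t, F (Function.update (Function.update x i s) j t) = 4 * ∑ x, F x := by
      intro F
      have h1 := sum_update (fun x => ∑ t, F (Function.update x j t)) i
      have h2 := sum_update F j
      linarith
    have h1 := key (fun x => ‖(LGate.two i j hij U).apply ψ x‖ ^ 2)
    have h2 := key (fun x => ‖ψ x‖ ^ 2)
    simp only [h] at h1
    linarith

theorem norm_run (C : List (LGate ι)) (ψ : LState ι) :
    ∑ x, ‖run C ψ x‖ ^ 2 = ∑ x, ‖ψ x‖ ^ 2 := by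
  induction C generalizing ψ with
  | nil => rfl
  | cons g C ih => rw [run_cons, ih, LGate.norm_apply]

theorem norm_vac : ∑ x, ‖(vac : LState ι) x‖ ^ 2 = 1 := by
  classical
  rw [Finset.sum_eq_single 0]
  · simp [vac]
  · intro x _ hx
    simp [vac, hx]
  · simp

end Unitarity

end Labelled

/-! ### Numbered qubits -/

/-- A gate of a circuit on `n` qubits as a gate on qubits labelled by `Fin n`. -/
def Gate.toL {n : ℕ} : Gate n → LGate (Fin n)
  | .one i U => .one i U
  | .two i j h U => .two i j h U

/-- A gate on qubits labelled by `Fin n` as a gate of a circuit on `n` qubits. -/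
def LGate.toGate {n : ℕ} : LGate (Fin n) → Gate n
  | .one i U => .one i U
  | .two i j h U => .two i j h U

theorem LGate.apply_toGate {n : ℕ} (g : LGate (Fin n)) : g.toGate.apply = g.apply := by
  cases g <;> rfl

theorem Gate.apply_toL {n : ℕ} (g : Gate n) : g.toL.apply = g.apply := by
  cases g <;> rfl

theorem vac_eq_zeroState (n : ℕ) : (vac : LState (Fin n)) = zeroState n := by
  funext x
  by_cases h : x = 0
  · subst h
    simp only [vac, if_true, zeroState]
    exact (Pi.single_eq_same (M := fun _ : Basis n => ℂ) (0 : Basis n) 1).symm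
  · simp only [vac, h, if_false, zeroState]
    exact (Pi.single_eq_of_ne (M := fun _ : Basis n => ℂ) h 1).symm

theorem output_map_toGate {n : ℕ} (C : List (LGate (Fin n))) :
    Circuit.output (C.map LGate.toGate) = run C vac := by
  rw [Circuit.output, List.foldl_map, run, vac_eq_zeroState]
  simp only [LGate.apply_toGate]

theorem run_map_toL {n : ℕ} (C : Circuit n) : run (C.map Gate.toL) vac = C.output := by
  rw [Circuit.output, run, List.foldl_map, vac_eq_zeroState]
  simp only [Gate.apply_toL]

theorem norm_output {n : ℕ} (C : Circuit n) : ∑ x, ‖C.output x‖ ^ 2 = 1 := by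
  rw [← run_map_toL, norm_run, norm_vac]

/-- The acceptance probability of a circuit with named qubits, after numbering them. -/
theorem acceptProb_map {ι : Type} [DecidableEq ι] [Fintype ι] {q : ℕ} (e : ι → Fin q)
    (he : Function.Injective e) (o : ι) (ho : (e o : ℕ) = 0) (C : List (LGate ι)) :
    QCircuit.acceptProb ⟨q, (C.map (LGate.map e he)).map LGate.toGate⟩ =
      ∑ x : ι → Fin 2 with x o = 1, ‖run C vac x‖ ^ 2 := by
  classical
  rw [QCircuit.acceptProb]
  simp only [output_map_toGate]
  have hq : 0 < q := lt_of_le_of_lt (Nat.zero_le _) (e o).2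
  have ho' : e o = ⟨0, hq⟩ := Fin.ext ho
  have hinj : Function.Injective fun x : ι → Fin 2 => Function.extend e x (0 : Fin q → Fin 2) := by
    intro x y h
    rw [← extend_comp he x 0, ← extend_comp he y 0]
    exact congrArg (· ∘ e) h
  have h1 : ∀ x : ι → Fin 2, ‖run C vac x‖ ^ 2 =
      ‖run (C.map (LGate.map e he)) vac (Function.extend e x 0)‖ ^ 2 := by
    intro x
    rw [run_map_vac he]
  simp only [h1]
  rw [← Finset.sum_image (f := fun z => ‖run (C.map (LGate.map e he)) vac z‖ ^ 2)
    (g := fun x => Function.extend e x 0) (fun x _ y _ h => hinj h)]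
  symm
  -- The remaining labels are nonzero at some unused qubit, where the amplitude vanishes.
  apply Finset.sum_subset
  · intro z hz
    simp only [Finset.mem_image, Finset.mem_filter, Finset.mem_univ, true_and] at hz ⊢
    obtain ⟨x, hx, rfl⟩ := hz
    exact ⟨hq, by rw [← ho', he.extend_apply, hx]⟩
  · intro z hz hz'
    simp only [Finset.mem_image, Finset.mem_filter, Finset.mem_univ, true_and] at hz hz'
    rw [run_map_vac_eq_zero he]
    · simp
    · by_contra hcon
      push Not at hcon
      refine hz' ⟨z ∘ e, ?_, ?_⟩
      · obtain ⟨h, hz⟩ := hz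
        simp only [Function.comp_apply, ho', hz]
      · funext j
        by_cases h : ∃ a, e a = j
        · obtain ⟨a, rfl⟩ := h
          rw [he.extend_apply]; rfl
        · rw [Function.extend_apply' _ _ _ h]
          exact (hcon j (fun i hi => h ⟨i, hi⟩)).symm

end QOver

end

noncomputable section

namespace QOver

/-! ### Gadgets over the standard gates -/

/-- The standard gates. -/
inductive Std (ι : Type) : Type
  | h (i : ι) : Std ι
  | t (i : ι) : Std ι
  | cx (i j : ι) : Std ι

section Gadgets

variable {ι κ : Type} [DecidableEq ι] [DecidableEq κ]

/-- Relabelling the qubits. -/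
def Std.map (e : κ → ι) : Std κ → Std ι
  | .h i => .h (e i)
  | .t i => .t (e i)
  | .cx i j => .cx (e i) (e j)

/-- A standard gate as a list of at most one gate. -/
def Std.gates : Std ι → List (LGate ι)
  | .h i => [.one i hadamard]
  | .t i => [.one i tGate]
  | .cx i j => if h : i ≠ j then [.two i j h cnot] else []

/-- The action of a list of standard gates. -/
def runStd (C : List (Std ι)) (ψ : LState ι) : LState ι := run (C.flatMap Std.gates) ψ

theorem runStd_append (C D : List (Std ι)) (ψ : LState ι) :
    runStd (C ++ D) ψ = runStd D (runStd C ψ) := by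
  rw [runStd, List.flatMap_append, run_append]; rfl

theorem runStd_cons (g : Std ι) (C : List (Std ι)) (ψ : LState ι) :
    runStd (g :: C) ψ = runStd C (runStd [g] ψ) := runStd_append [g] C ψ

@[simp] theorem runStd_nil (ψ : LState ι) : runStd [] ψ = ψ := rfl

theorem map_gates {e : κ → ι} (he : Function.Injective e) (g : Std κ) :
    g.gates.map (LGate.map e he) = (g.map e).gates := by
  cases g with
  | h i => rfl
  | t i => rfl
  | cx i j =>
    by_cases h : i = j
    · simp [Std.gates, Std.map, h]
    · simp [Std.gates, Std.map, h, LGate.map, he.eq_iff]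

theorem map_flatMap_gates {e : κ → ι} (he : Function.Injective e) (C : List (Std κ)) :
    (C.flatMap Std.gates).map (LGate.map e he) = (C.map (Std.map e)).flatMap Std.gates := by
  rw [List.map_flatMap, List.flatMap_map]
  simp only [map_gates]

/-- The number `1/√2`. -/
def rt : ℂ := Amp.invSqrtTwo.toComplex

/-- The number `e^{iπ/4}`. -/
def zt : ℂ := Amp.zeta.toComplex

theorem rt_mul_rt : rt * rt = 1 / 2 := by
  have h2 : Real.sqrt 2 * Real.sqrt 2 = 2 := Real.mul_self_sqrt (by norm_num)
  apply Complex.ext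
  · simp [rt, Amp.toComplex, Amp.invSqrtTwo]
    nlinarith
  · simp [rt, Amp.toComplex, Amp.invSqrtTwo]

theorem zt_pow_four : zt ^ 4 = -1 := by
  have h2 : Real.sqrt 2 * Real.sqrt 2 = 2 := Real.mul_self_sqrt (by norm_num)
  have h : zt ^ 2 = Complex.I := by
    rw [sq]
    apply Complex.ext
    · simp [zt, Amp.toComplex, Amp.zeta]
    · simp [zt, Amp.toComplex, Amp.zeta]
      nlinarith
  calc zt ^ 4 = (zt ^ 2) ^ 2 := by ring
    _ = -1 := by rw [h, Complex.I_sq]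

theorem toComplex_one : Amp.one.toComplex = 1 := by
  apply Complex.ext <;> simp [Amp.toComplex, Amp.one]

theorem toComplex_zero : Amp.zero.toComplex = 0 := by
  apply Complex.ext <;> simp [Amp.toComplex, Amp.zero]

theorem toComplex_negInvSqrtTwo : Amp.negInvSqrtTwo.toComplex = -rt := by
  apply Complex.ext
  · simp [rt, Amp.toComplex, Amp.negInvSqrtTwo, Amp.invSqrtTwo]; ring
  · simp [rt, Amp.toComplex, Amp.negInvSqrtTwo, Amp.invSqrtTwo]

theorem runStd_h (i : ι) (ψ : LState ι) (x : ι → Fin 2) :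
    runStd [.h i] ψ x = rt * (ψ (Function.update x i 0) +
      (if x i = 1 then -1 else 1) * ψ (Function.update x i 1)) := by
  have h : x i = 0 ∨ x i = 1 := by omega
  simp only [runStd, List.flatMap_singleton, Std.gates, run_cons, run_nil, LGate.apply,
    Fin.sum_univ_two]
  rcases h with h | h
  · rw [h]
    change rt * _ + rt * _ = _
    simp; ring
  · rw [h]
    change rt * _ + Amp.negInvSqrtTwo.toComplex * _ = _
    rw [toComplex_negInvSqrtTwo]
    simp; ring

theorem runStd_t (i : ι) (ψ : LState ι) (x : ι → Fin 2) :
    runStd [.t i] ψ x = zt ^ (x i : ℕ) * ψ x := by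
  have h : x i = 0 ∨ x i = 1 := by omega
  simp only [runStd, List.flatMap_singleton, Std.gates, run_cons, run_nil, LGate.apply,
    Fin.sum_univ_two]
  rcases h with h | h
  · rw [h]
    change Amp.one.toComplex * _ + Amp.zero.toComplex * _ = _
    rw [toComplex_one, toComplex_zero, ← h, Function.update_eq_self, h]
    simp
  · rw [h]
    change Amp.zero.toComplex * _ + zt * _ = _
    rw [toComplex_zero, ← h, Function.update_eq_self, h]
    simp

/-- A permutation of labels acts on amplitudes by pulling back along its inverse; this one is an
involution. All classical gates below are treated as pullbacks in the same way. -/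
theorem runStd_cx {i j : ι} (hij : i ≠ j) (ψ : LState ι) (x : ι → Fin 2) :
    runStd [.cx i j] ψ x = ψ (Function.update x j (x i + x j)) := by
  have hcx : ∀ s t s' t' : Fin 2, (cnot.1 (s, t) (s', t')).toComplex =
      if s' = s ∧ t' = s + t then 1 else 0 := by
    intro s t s' t'
    change (if (s, t) = (s', s' + t') then Amp.one else Amp.zero).toComplex = _
    have : ((s, t) = (s', s' + t')) ↔ (s' = s ∧ t' = s + t) := by
      rw [Prod.mk.injEq]
      omega
    simp only [this]
    split_ifs
    · exact toComplex_one
    · exact toComplex_zero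
  have hg : (Std.cx i j).gates = [.two i j hij cnot] := by simp [Std.gates, hij]
  rw [runStd, List.flatMap_singleton, hg]
  simp only [run_cons, run_nil, LGate.apply]
  rw [Finset.sum_eq_single (x i), Finset.sum_eq_single (x i + x j)]
  · rw [hcx]
    simp
  · intro t _ ht
    rw [hcx]
    simp [ht]
  · simp
  · intro s _ hs
    refine Finset.sum_eq_zero fun t _ => ?_
    rw [hcx]
    simp [hs]
  · simp

/-- A power of the gate `T`. -/
def tPow (i : ι) (k : ℕ) : List (Std ι) := List.replicate k (.t i)

theorem runStd_tPow (i : ι) (k : ℕ) (ψ : LState ι) (x : ι → Fin 2) :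
    runStd (tPow i k) ψ x = zt ^ (k * (x i : ℕ)) * ψ x := by
  induction k generalizing ψ with
  | zero => simp [tPow]
  | succ k ih =>
    rw [tPow, List.replicate_succ, runStd_cons, ← tPow, ih, runStd_t, ← mul_assoc, ← pow_add]
    congr 2
    ring

/-- A power of the gate `T`, controlled by the parity of two qubits. -/
def tPow₂ (i j : ι) (k : ℕ) : List (Std ι) := [.cx i j] ++ tPow j k ++ [.cx i j]

theorem runStd_tPow₂ {i j : ι} (hij : i ≠ j) (k : ℕ) (ψ : LState ι) (x : ι → Fin 2) :
    runStd (tPow₂ i j k) ψ x = zt ^ (k * ((x i + x j : Fin 2) : ℕ)) * ψ x := by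
  rw [tPow₂, runStd_append, runStd_append, runStd_cx hij, runStd_tPow, runStd_cx hij]
  simp only [Function.update_self, Function.update_idem, Function.update_of_ne hij]
  have : x i + (x i + x j) = x j := by omega
  rw [this, Function.update_eq_self]

/-- A power of the gate `T`, controlled by the parity of three qubits. -/
def tPow₃ (i j l : ι) (k : ℕ) : List (Std ι) := [.cx i j] ++ tPow₂ j l k ++ [.cx i j]

theorem runStd_tPow₃ {i j l : ι} (hij : i ≠ j) (hjl : j ≠ l) (k : ℕ) (ψ : LState ι)
    (x : ι → Fin 2) :
    runStd (tPow₃ i j l k) ψ x = zt ^ (k * ((x i + x j + x l : Fin 2) : ℕ)) * ψ x := by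
  rw [tPow₃, runStd_append, runStd_append, runStd_cx hij, runStd_tPow₂ hjl, runStd_cx hij]
  simp only [Function.update_self, Function.update_idem, Function.update_of_ne hij,
    Function.update_of_ne hjl.symm]
  have : x i + (x i + x j) = x j := by omega
  rw [this, Function.update_eq_self]

/-- The doubly controlled `Z` gate. -/
def ccz (i j l : ι) : List (Std ι) :=
  tPow i 1 ++ tPow j 1 ++ tPow l 1 ++ tPow₂ i j 7 ++ tPow₂ j l 7 ++ tPow₂ i l 7 ++ tPow₃ i j l 1

/-- For bits, 4abc = a + b + c - (a⊕b) - (b⊕c) - (a⊕c) + (a⊕b⊕c). The fourth power of e^{iπ/4} is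
-1, and the coefficient -1 is realised by the power 7 = 8 - 1 of T. -/
theorem runStd_ccz {i j l : ι} (hij : i ≠ j) (hjl : j ≠ l) (hil : i ≠ l) (ψ : LState ι)
    (x : ι → Fin 2) :
    runStd (ccz i j l) ψ x = (if x i = 1 ∧ x j = 1 ∧ x l = 1 then -1 else 1) * ψ x := by
  simp only [ccz, runStd_append, runStd_tPow, runStd_tPow₂ hij, runStd_tPow₂ hjl,
    runStd_tPow₂ hil, runStd_tPow₃ hij hjl, ← mul_assoc, ← pow_add]
  congr 1
  -- The total exponents that occur are 0, 4 and 16.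
  have h8 : zt ^ 16 = 1 := by
    calc zt ^ 16 = (zt ^ 4) ^ 4 := by ring
      _ = 1 := by rw [zt_pow_four]; norm_num
  generalize x i = a
  generalize x j = b
  generalize x l = c
  fin_cases a <;> fin_cases b <;> fin_cases c <;> simp [zt_pow_four, h8]

/-- The Toffoli gate with target `l`. -/
def toffoli (i j l : ι) : List (Std ι) := [.h l] ++ ccz i j l ++ [.h l]

/-- Conjugation by H turns the Z on the target into X. -/
theorem runStd_toffoli {i j l : ι} (hij : i ≠ j) (hjl : j ≠ l) (hil : i ≠ l) (ψ : LState ι)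
    (x : ι → Fin 2) :
    runStd (toffoli i j l) ψ x = ψ (Function.update x l (x i * x j + x l)) := by
  have h11 : (1 + 1 : Fin 2) = 0 := by decide
  simp only [toffoli, runStd_append, runStd_h, runStd_ccz hij hjl hil, Function.update_self,
    Function.update_idem, Function.update_of_ne hil, Function.update_of_ne hjl]
  have hi : x i = 0 ∨ x i = 1 := by omega
  have hj : x j = 0 ∨ x j = 1 := by omega
  have hl : x l = 0 ∨ x l = 1 := by omega
  have hrt := rt_mul_rt
  rcases hi with hi | hi <;> rcases hj with hj | hj <;> rcases hl with hl | hl <;>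
    simp only [hi, hj, hl] <;> norm_num [h11] <;>
    first
      | linear_combination (2 * ψ (Function.update x l 0)) * hrt
      | linear_combination (2 * ψ (Function.update x l 1)) * hrt

/-- The controlled swap of two qubits. -/
def cswap (c i j : ι) : List (Std ι) := [.cx j i] ++ toffoli c i j ++ [.cx j i]

/-- A swap is a product of three CNOT gates. Only the middle one needs the control, since without it
the outer two cancel. -/
theorem runStd_cswap {c i j : ι} (hci : c ≠ i) (hcj : c ≠ j) (hij : i ≠ j) (ψ : LState ι)
    (x : ι → Fin 2) :
    runStd (cswap c i j) ψ x = ψ (if x c = 1 then x ∘ Equiv.swap i j else x) := by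
  rw [cswap, runStd_append, runStd_append, runStd_cx hij.symm, runStd_toffoli hci hij hcj,
    runStd_cx hij.symm]
  congr 1
  have hc : x c = 0 ∨ x c = 1 := by omega
  funext a
  simp only [Function.update_self, Function.update_of_ne hij, Function.update_of_ne hij.symm,
    Function.update_of_ne hci]
  rcases hc with hc | hc
  · by_cases hai : a = i
    · subst hai
      simp only [hc, Function.update_self]
      rw [if_neg (by decide)]
      omega
    · by_cases haj : a = j
      · subst haj
        simp [hc, hai]
      · simp [hc, hai, haj]
  · simp only [hc, if_true, Function.comp_apply]
    by_cases hai : a = i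
    · subst hai
      rw [Function.update_self, Equiv.swap_apply_left]
      omega
    · by_cases haj : a = j
      · subst haj
        rw [Function.update_of_ne hai, Function.update_self, Equiv.swap_apply_right]
        omega
      · rw [Function.update_of_ne hai, Function.update_of_ne haj, Function.update_of_ne hai,
          Equiv.swap_apply_of_ne_of_ne hai haj]

/-- The `X` gate. -/
def xGate (i : ι) : List (Std ι) := [.h i] ++ tPow i 4 ++ [.h i]

theorem runStd_xGate (i : ι) (ψ : LState ι) (x : ι → Fin 2) :
    runStd (xGate i) ψ x = ψ (Function.update x i (1 + x i)) := by
  have hi : x i = 0 ∨ x i = 1 := by omega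
  have hrt := rt_mul_rt
  simp only [xGate, runStd_append, runStd_h, runStd_tPow, Function.update_self,
    Function.update_idem]
  have h11 : (1 + 1 : Fin 2) = 0 := by decide
  rcases hi with hi | hi <;> simp only [hi] <;> norm_num [zt_pow_four, h11]
  · linear_combination (2 * ψ (Function.update x i 1)) * hrt
  · linear_combination (2 * ψ (Function.update x i 0)) * hrt

end Gadgets

end QOver

end

/-! ### The swap test, its repetition, and the distribution of the counter. -/

noncomputable section

namespace QOver

/-! ### The swap test -/

/-- The labels of the qubits of a swap test. -/
abbrev SwapWire (n k : ℕ) : Type := Fin n ⊕ (Fin k ⊕ Unit)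

/-- The control qubit of a swap test. -/
abbrev ctrl {n k : ℕ} : SwapWire n k := .inr (.inr ())

section SwapTest

variable {n k : ℕ} (hle : n ≤ k)

/-- The standard gates of the swap test. -/
def swapGates : List (Std (SwapWire n k)) :=
  [.h ctrl] ++ (List.finRange n).flatMap
    (fun i => cswap ctrl (.inl i) (.inr (.inl (Fin.castLE hle i)))) ++ (tPow ctrl 4 ++ [.h ctrl])

/-- The swap test of two circuits. -/
def swapTest (C : Circuit n) (D : Circuit k) : List (LGate (SwapWire n k)) :=
  (C.map Gate.toL).map (LGate.map .inl Sum.inl_injective) ++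
    (D.map Gate.toL).map (LGate.map (fun j => .inr (.inl j))
      (Sum.inr_injective.comp Sum.inl_injective)) ++ (swapGates hle).flatMap Std.gates

/-- A basis label of the qubits of a swap test. -/
def joinLabel (u : Basis n) (v : Basis k) (s : Fin 2) : SwapWire n k → Fin 2 :=
  Sum.elim u (Sum.elim v fun _ => s)

theorem exists_joinLabel (x : SwapWire n k → Fin 2) : ∃ u v s, x = joinLabel u v s :=
  ⟨fun i => x (.inl i), fun j => x (.inr (.inl j)), x ctrl, by
    funext a
    rcases a with i | j | _ <;> rfl⟩

/-- The circuits act on disjoint blocks that start at zero, so the amplitude factorises; the control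
has not been touched yet. -/
theorem run_circuits (C : Circuit n) (D : Circuit k) (u : Basis n) (v : Basis k) (s : Fin 2) :
    run ((C.map Gate.toL).map (LGate.map .inl Sum.inl_injective) ++
      (D.map Gate.toL).map (LGate.map (fun j => .inr (.inl j))
        (Sum.inr_injective.comp Sum.inl_injective))) vac (joinLabel u v s) =
      if s = 0 then C.output u * D.output v else 0 := by
  have hC : ∀ z : SwapWire n k → Fin 2,
      run ((C.map Gate.toL).map (LGate.map .inl Sum.inl_injective)) vac z =
        if (∀ j, z (.inr j) = 0) then C.output (fun i => z (.inl i)) else 0 := by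
    intro z
    rw [run_map_block Sum.inl_injective, run_map_toL]
    · have : Function.extend (Sum.inl : Fin n → SwapWire n k) 0 z = 0 ↔
          ∀ j, z (.inr j) = 0 := by
        constructor
        · intro h j
          have := congrFun h (.inr j)
          rwa [Function.extend_apply' _ _ _ (by simp)] at this
        · intro h
          funext a
          rcases a with i | j
          · rw [Sum.inl_injective.extend_apply]; rfl
          · rw [Function.extend_apply' _ _ _ (by simp), h j]; rfl
      rw [vac]
      by_cases h : ∀ j, z (.inr j) = 0
      · rw [if_pos (this.2 h), if_pos h, one_mul]; rfl
      · rw [if_neg (mt this.1 h), if_neg h, zero_mul]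
    · intro z hz
      have : z ≠ 0 := by
        rintro rfl
        exact hz rfl
      simp [vac, this]
  have hinj : Function.Injective fun j : Fin k => (.inr (.inl j) : SwapWire n k) :=
    Sum.inr_injective.comp Sum.inl_injective
  rw [run_append, run_map_block hinj, run_map_toL, hC]
  · have h1 : (∀ j, Function.extend (fun j : Fin k => (.inr (.inl j) : SwapWire n k)) 0
        (joinLabel u v s) (.inr j) = 0) ↔ s = 0 := by
      constructor
      · intro h
        have := h (.inr ())
        rwa [Function.extend_apply' _ _ _ (by simp)] at this
      · rintro rfl j
        rcases j with j | _
        · exact hinj.extend_apply 0 _ j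
        · rw [Function.extend_apply' _ _ _ (by simp)]; rfl
    have h2 : (fun i => Function.extend (fun j : Fin k => (.inr (.inl j) : SwapWire n k)) 0
        (joinLabel u v s) (.inl i)) = u := by
      funext i
      rw [Function.extend_apply' _ _ _ (by simp)]; rfl
    rw [h2]
    simp only [h1]
    by_cases h : s = 0
    · rw [if_pos h, if_pos h]; rfl
    · rw [if_neg h, if_neg h, zero_mul]
  · intro z hz
    rw [hC, if_neg]
    intro h
    exact hz (funext fun j => h (.inl j))

/-- Replacing the first qubits. -/
def replaceFirst (u : Basis n) (v : Basis k) : Basis k :=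
  fun j => if h : j.1 < n then u ⟨j.1, h⟩ else v j

/-- The first qubits. -/
def firstPart (v : Basis k) : Basis n := fun i => v (Fin.castLE hle i)

theorem firstPart_replaceFirst (u : Basis n) (v : Basis k) :
    firstPart hle (replaceFirst u v) = u := by
  funext i
  simp [firstPart, replaceFirst]

/-- With `firstPart_replaceFirst`, this makes exchanging `u` with the first part of `v` an
involution on pairs of labels. -/
theorem replaceFirst_firstPart (u : Basis n) (v : Basis k) :
    replaceFirst (firstPart hle v) (replaceFirst u v) = v := by
  funext j
  by_cases h : j.1 < n <;> simp [firstPart, replaceFirst, h]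

/-- Swapping some of the pairs of qubits. -/
def swapOn (l : List (Fin n)) (x : SwapWire n k → Fin 2) : SwapWire n k → Fin 2
  | .inl i => if i ∈ l then x (.inr (.inl (Fin.castLE hle i))) else x (.inl i)
  | .inr (.inl j) => if h : ∃ i ∈ l, Fin.castLE hle i = j then x (.inl h.choose)
      else x (.inr (.inl j))
  | .inr (.inr _) => x ctrl

/-- The exchanged pairs are disjoint, so one more transposition does not interfere with those
already made. Injectivity of `Fin.castLE` makes the chosen partner of a qubit unique. -/
theorem swapOn_cons {i : Fin n} {l : List (Fin n)} (hi : i ∉ l) (x : SwapWire n k → Fin 2) :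
    swapOn hle l x ∘ Equiv.swap (.inl i) (.inr (.inl (Fin.castLE hle i))) =
      swapOn hle (i :: l) x := by
  have hinj : Function.Injective (Fin.castLE hle) := Fin.castLE_injective hle
  funext a
  rcases a with i' | j | ⟨⟩
  · by_cases h : i' = i
    · subst h
      have hn : ¬ ∃ a ∈ l, Fin.castLE hle a = Fin.castLE hle i' := by
        rintro ⟨a, ha, hai⟩
        exact hi (hinj hai ▸ ha)
      simp only [Function.comp_apply, Equiv.swap_apply_left, swapOn, dif_neg hn]
      simp
    · rw [Function.comp_apply, Equiv.swap_apply_of_ne_of_ne (by simpa using h) (by simp)]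
      simp [swapOn, h]
  · by_cases h : j = Fin.castLE hle i
    · subst h
      have hp : ∃ a ∈ i :: l, Fin.castLE hle a = Fin.castLE hle i := ⟨i, by simp, rfl⟩
      have hp' : hp.choose = i := hinj hp.choose_spec.2
      simp only [Function.comp_apply, Equiv.swap_apply_right, swapOn, dif_pos hp, hp', if_neg hi]
    · rw [Function.comp_apply, Equiv.swap_apply_of_ne_of_ne (by simp) (by simpa using h)]
      by_cases hp : ∃ a ∈ l, Fin.castLE hle a = j
      · have hp' : ∃ a ∈ i :: l, Fin.castLE hle a = j := by
          obtain ⟨a, ha, haj⟩ := hp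
          exact ⟨a, by simp [ha], haj⟩
        have he : hp.choose = hp'.choose :=
          hinj (hp.choose_spec.2.trans hp'.choose_spec.2.symm)
        simp only [swapOn, dif_pos hp, dif_pos hp', he]
      · have hp' : ¬ ∃ a ∈ i :: l, Fin.castLE hle a = j := by
          rintro ⟨a, ha, haj⟩
          rcases List.mem_cons.1 ha with rfl | ha
          · exact h haj.symm
          · exact hp ⟨a, ha, haj⟩
        simp only [swapOn, dif_neg hp, dif_neg hp']
  · rw [Function.comp_apply, Equiv.swap_apply_of_ne_of_ne (by simp) (by simp)]
    rfl

theorem runStd_swaps (l : List (Fin n)) (hl : l.Nodup) (ψ : LState (SwapWire n k))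
    (x : SwapWire n k → Fin 2) :
    runStd (l.flatMap fun i => cswap ctrl (.inl i) (.inr (.inl (Fin.castLE hle i)))) ψ x =
      ψ (if x ctrl = 1 then swapOn hle l x else x) := by
  induction l generalizing ψ with
  | nil =>
    have : swapOn hle [] x = x := by
      funext a
      rcases a with i' | j | ⟨⟩ <;> simp [swapOn]
    simp [this]
  | cons i l ih =>
    rw [List.flatMap_cons, runStd_append, ih hl.of_cons, runStd_cswap (by simp) (by simp) (by simp)]
    congr 1
    by_cases hx : x ctrl = 1
    · have : swapOn hle l x ctrl = 1 := hx
      rw [if_pos hx, if_pos hx, if_pos this, swapOn_cons hle (List.nodup_cons.1 hl).1]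
    · simp [hx]

theorem swapOn_joinLabel (u : Basis n) (v : Basis k) (s : Fin 2) :
    swapOn hle (List.finRange n) (joinLabel u v s) =
      joinLabel (firstPart hle v) (replaceFirst u v) s := by
  funext a
  rcases a with i' | j | ⟨⟩
  · simp [swapOn, joinLabel, firstPart]
  · by_cases h : j.1 < n
    · have hp : ∃ a ∈ List.finRange n, Fin.castLE hle a = j := ⟨⟨j, h⟩, by simp, rfl⟩
      have he : hp.choose = ⟨j, h⟩ := Fin.castLE_injective hle hp.choose_spec.2
      simp only [swapOn, dif_pos hp, he]
      simp [joinLabel, replaceFirst, h]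
    · have hp : ¬ ∃ a ∈ List.finRange n, Fin.castLE hle a = j := by
        rintro ⟨a, -, rfl⟩
        exact h a.2
      simp only [swapOn, dif_neg hp]
      simp [joinLabel, replaceFirst, h]
  · rfl

theorem update_ctrl (u : Basis n) (v : Basis k) (s t : Fin 2) :
    Function.update (joinLabel u v s) ctrl t = joinLabel u v t := by
  funext a
  rcases a with i | j | ⟨⟩
  · simp [joinLabel]
  · simp [joinLabel]
  · simp [joinLabel]

/-- The fourth power of T on the control is a Z gate that interchanges the outcomes of the usual
test, so that the outcome 1 carries the plus sign. -/
theorem run_swapTest (C : Circuit n) (D : Circuit k) (u : Basis n) (v : Basis k) (s : Fin 2) :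
    run (swapTest hle C D) vac (joinLabel u v s) =
      1 / 2 * (C.output u * D.output v + (if s = 1 then 1 else -1) *
        (C.output (firstPart hle v) * D.output (replaceFirst u v))) := by
  have h01 : (0 : Fin 2) ≠ 1 := by decide
  have hj : ∀ (u : Basis n) (v : Basis k) (s : Fin 2), joinLabel u v s ctrl = s :=
    fun _ _ _ => rfl
  rw [swapTest, run_append]
  change runStd (swapGates hle) _ _ = _
  rw [swapGates, runStd_append, runStd_append, runStd_append, runStd_h]
  simp only [runStd_tPow, runStd_swaps hle _ (List.nodup_finRange n), update_ctrl, hj,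
    if_neg h01, if_true, swapOn_joinLabel, runStd_h, run_circuits]
  have hs : s = 0 ∨ s = 1 := by omega
  have hrt := rt_mul_rt
  rcases hs with rfl | rfl
  · simp [zt_pow_four]
    linear_combination (C.output u * D.output v -
      C.output (firstPart hle v) * D.output (replaceFirst u v)) * hrt
  · simp [zt_pow_four]
    linear_combination (C.output u * D.output v +
      C.output (firstPart hle v) * D.output (replaceFirst u v)) * hrt

/-- This is the expectation, in the product state, of the operator that exchanges the `n` qubits of
`φ` with the first `n` qubits of `χ`: the interference term of the swap test. -/
theorem overlap_eq (φ : State n) (χ : State k) :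
    overlap hle φ χ = (∑ u, ∑ v, φ u * χ v * star (φ (firstPart hle v) *
      χ (replaceFirst u v))).re := by
  -- The identity factor only leaves labels `z` that agree with `v` beyond the first `n` qubits, and
  -- these are parametrised by their first part.
  have hfib : ∀ (v : Basis k) (G : Basis k → ℂ),
      ∑ z, (if (splitBasis hle z).2 = (splitBasis hle v).2 then G z else 0) =
        ∑ u : Basis n, G (replaceFirst u v) := by
    intro v G
    rw [← Finset.sum_filter, ← Finset.sum_image (f := G) (g := fun u : Basis n => replaceFirst u v)]
    · apply Finset.sum_congr _ fun _ _ => rfl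
      ext z
      simp only [Finset.mem_filter, Finset.mem_univ, true_and, Finset.mem_image]
      constructor
      · intro h
        refine ⟨firstPart hle z, ?_⟩
        funext j
        by_cases hj : j.1 < n
        · simp [replaceFirst, hj, firstPart]
        · have := congrFun h ⟨j.1 - n, by omega⟩
          simp only [splitBasis] at this
          simp only [replaceFirst, hj, dite_false]
          have hjj : (⟨n + (j.1 - n), by omega⟩ : Fin k) = j := Fin.ext (by simp; omega)
          rw [hjj] at this
          exact this.symm
      · rintro ⟨u, rfl⟩
        funext j
        simp [splitBasis, replaceFirst]
    · intro u _ u' _ h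
      rw [← firstPart_replaceFirst hle u v, ← firstPart_replaceFirst hle u' v]
      exact congrArg (firstPart hle) h
  rw [overlap]
  congr 1
  rw [Matrix.trace]
  simp only [Matrix.diag_apply, Matrix.mul_apply, Matrix.submatrix_apply, Matrix.kroneckerMap_apply,
    ketBra, Matrix.vecMulVec_apply, Pi.star_apply, Matrix.one_apply]
  rw [Finset.sum_comm, Finset.sum_comm (γ := Basis n)]
  refine Finset.sum_congr rfl fun v _ => ?_
  have := hfib v fun z => φ (splitBasis hle z).1 * star (φ (splitBasis hle v).1) *
    (χ v * star (χ z))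
  refine Eq.trans ?_ (this.trans ?_)
  · refine Finset.sum_congr rfl fun z _ => ?_
    split_ifs <;> ring
  · refine Finset.sum_congr rfl fun u _ => ?_
    have h1 : (splitBasis hle (replaceFirst u v)).1 = u := firstPart_replaceFirst hle u v
    have h2 : (splitBasis hle v).1 = firstPart hle v := rfl
    rw [h1, h2, star_mul']
    ring

theorem sum_joinLabel (F : (SwapWire n k → Fin 2) → ℝ) (s : Fin 2) :
    ∑ x with x ctrl = s, F x = ∑ u, ∑ v, F (joinLabel u v s) := by
  rw [← Fintype.sum_prod_type' (f := fun u v => F (joinLabel u v s)),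
    ← Finset.sum_image (f := F) (g := fun p : Basis n × Basis k => joinLabel p.1 p.2 s)]
  · apply Finset.sum_congr _ fun _ _ => rfl
    ext x
    simp only [Finset.mem_filter, Finset.mem_univ, true_and, Finset.mem_image, Prod.exists]
    constructor
    · rintro rfl
      obtain ⟨u, v, s, rfl⟩ := exists_joinLabel x
      exact ⟨u, v, rfl⟩
    · rintro ⟨u, v, rfl⟩
      rfl
  · rintro ⟨u, v⟩ _ ⟨u', v'⟩ _ h
    simp only at h
    refine Prod.ext (funext fun i => congrFun h (.inl i)) (funext fun j => congrFun h (.inr (.inl j)))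

/-- The outcome probabilities of the swap test. -/
theorem prob_swapTest (C : Circuit n) (D : Circuit k) (s : Fin 2) :
    ∑ x with x ctrl = s, ‖run (swapTest hle C D) vac x‖ ^ 2 =
      (1 + (if s = 1 then 1 else -1) * overlap hle C.output D.output) / 2 := by
  rw [sum_joinLabel, overlap_eq]
  simp only [run_swapTest]
  have hnorm : ∀ (a b : ℂ), ‖1 / 2 * (a + (if s = 1 then 1 else -1) * b)‖ ^ 2 =
      1 / 4 * (‖a‖ ^ 2 + ‖b‖ ^ 2) + (if s = 1 then 1 else -1) / 2 * (a * star b).re := by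
    intro a b
    have : ∀ z : ℂ, ‖z‖ ^ 2 = z.re ^ 2 + z.im ^ 2 := by
      intro z
      rw [Complex.sq_norm, Complex.normSq_apply]; ring
    rw [this, this, this]
    split_ifs <;> simp <;> ring
  simp only [hnorm]
  simp only [Finset.sum_add_distrib, ← Finset.mul_sum]
  have h1 : ∑ u, ∑ v, ‖C.output u * D.output v‖ ^ 2 = 1 := by
    simp only [norm_mul, mul_pow, ← Finset.mul_sum, norm_output, mul_one]
  have h2 : ∑ u : Basis n, ∑ v : Basis k,
      ‖C.output (firstPart hle v) * D.output (replaceFirst u v)‖ ^ 2 = 1 := by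
    rw [← h1, ← Fintype.sum_prod_type' (f := fun (u : Basis n) (v : Basis k) =>
      ‖C.output (firstPart hle v) * D.output (replaceFirst u v)‖ ^ 2),
      ← Fintype.sum_prod_type' (f := fun (u : Basis n) (v : Basis k) =>
      ‖C.output u * D.output v‖ ^ 2)]
    -- The exchanged amplitude has the same norm, since the exchange only permutes the pairs of
    -- labels.
    have hinv : Function.Involutive fun p : Basis n × Basis k =>
        (firstPart hle p.2, replaceFirst p.1 p.2) := by
      rintro ⟨u, v⟩
      simp only [firstPart_replaceFirst, replaceFirst_firstPart]
    exact Equiv.sum_comp hinv.toPerm (fun p : Basis n × Basis k => ‖C.output p.1 * D.output p.2‖ ^ 2)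
  rw [h1, h2]
  simp only [Complex.re_sum]
  ring

end SwapTest

end QOver

end

noncomputable section

namespace QOver

/-! ### Repeating the swap test -/

section Block

variable {ι κ : Type} [DecidableEq ι] [DecidableEq κ] [Fintype ι] [Fintype κ]

/-- A label is the same as its values outside the block and its values on the block. The hypothesis
on `A` restricts its own sum to labels that are zero on the block, which represent the outside part.
-/
theorem sum_block {e : κ → ι} (he : Function.Injective e) (A : (ι → Fin 2) → ℝ)
    (hA : ∀ z, z ∘ e ≠ 0 → A z = 0) (B : (κ → Fin 2) → ℝ) :
    ∑ z, A (Function.extend e 0 z) * B (z ∘ e) = (∑ z, A z) * ∑ x, B x := by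
  have h1 : ∑ z, A z = ∑ z : ι → Fin 2 with z ∘ e = 0, A z := by
    symm
    apply Finset.sum_subset (Finset.subset_univ _)
    intro z _ hz
    exact hA z (by simpa using hz)
  rw [h1, Finset.sum_mul_sum, ← Finset.sum_product']
  refine Finset.sum_bij' (fun z _ => (Function.extend e 0 z, z ∘ e))
    (fun p _ => Function.extend e p.2 p.1) ?_ ?_ ?_ ?_ ?_
  · intro z _
    simp only [Finset.mem_product, Finset.mem_filter, Finset.mem_univ, true_and, and_true]
    exact extend_comp he 0 z
  · simp
  · intro z _
    funext j
    by_cases h : ∃ a, e a = j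
    · obtain ⟨a, rfl⟩ := h
      rw [he.extend_apply]; rfl
    · change Function.extend e (z ∘ e) (Function.extend e 0 z) j = z j
      rw [Function.extend_apply' _ _ _ h, Function.extend_apply' _ _ _ h]
  · rintro ⟨y, x⟩ h
    simp only [Finset.mem_product, Finset.mem_filter, Finset.mem_univ, true_and, and_true] at h
    refine Prod.ext ?_ (extend_comp he x y)
    funext j
    by_cases h' : ∃ a, e a = j
    · obtain ⟨a, rfl⟩ := h'
      simp only [he.extend_apply]
      exact (congrFun h a).symm
    · simp only [Function.extend_apply' _ _ _ h']
  · intro z _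
    rfl

/-- The outcome distribution of a circuit on a block of qubits that are all zero is independent of
the other qubits. -/
theorem weight_block {e : κ → ι} (he : Function.Injective e) (C : List (LGate κ)) (ψ : LState ι)
    (hψ : ∀ z, z ∘ e ≠ 0 → ψ z = 0) (g : (ι → Fin 2) → ℝ)
    (hg : ∀ z, g (Function.extend e 0 z) = g z) (h : (κ → Fin 2) → ℝ) :
    ∑ z, g z * h (z ∘ e) * ‖run (C.map (LGate.map e he)) ψ z‖ ^ 2 =
      (∑ z, g z * ‖ψ z‖ ^ 2) * ∑ x, h x * ‖run C vac x‖ ^ 2 := by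
  rw [← sum_block he (fun z => g z * ‖ψ z‖ ^ 2) (fun z hz => by simp [hψ z hz])
    (fun x => h x * ‖run C vac x‖ ^ 2)]
  refine Finset.sum_congr rfl fun z _ => ?_
  rw [run_map_block he C ψ hψ, norm_mul, hg]
  ring

end Block

/-- The labels of the qubits of a circuit with `R` swap tests: the output, a counter with `R + 1`
positions, and the qubits of the swap tests. -/
inductive Wire (n k R : ℕ) : Type
  | out
  | cnt (i : Fin (R + 1))
  | blk (r : Fin R) (w : SwapWire n k)
  deriving DecidableEq, Fintype

section Repetition

variable {n k R : ℕ}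

theorem Wire.blk_injective (r : Fin R) : Function.Injective (Wire.blk r : SwapWire n k → _) := by
  intro w w' h
  cases h
  rfl

/-- A position of the counter. -/
abbrev Wire.pos (i : ℕ) : Wire n k R := .cnt (Fin.ofNat (R + 1) i)

theorem Wire.pos_inj {i j : ℕ} (hi : i ≤ R) (hj : j ≤ R) :
    (Wire.pos i : Wire n k R) = Wire.pos j ↔ i = j := by
  simp only [Wire.cnt.injEq, Fin.ext_iff, Fin.val_ofNat]
  rw [Nat.mod_eq_of_lt (by omega), Nat.mod_eq_of_lt (by omega)]

theorem Wire.exists_pos (i : Fin (R + 1)) : ∃ j ≤ R, (Wire.cnt i : Wire n k R) = Wire.pos j :=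
  ⟨i, by omega, by simp⟩

/-- The gates that move the counter, controlled by the qubit `c`. -/
def countGates (c : Wire n k R) (m : ℕ) : List (Std (Wire n k R)) :=
  (List.range m).flatMap fun i => cswap c (.pos i) (.pos (i + 1))

/-- The action of these gates on labels. -/
def moveTo (m : ℕ) (z : Wire n k R → Fin 2) : Wire n k R → Fin 2
  | .out => z .out
  | .cnt j => if j.1 = 0 then z (.pos m) else if j.1 ≤ m then z (.pos (j.1 - 1)) else z (.cnt j)
  | .blk r w => z (.blk r w)

theorem moveTo_pos {m j : ℕ} (hj : j ≤ R) (z : Wire n k R → Fin 2) :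
    moveTo m z (.pos j) =
      if j = 0 then z (.pos m) else if j ≤ m then z (.pos (j - 1)) else z (.pos j) := by
  simp only [moveTo, Fin.val_ofNat, Nat.mod_eq_of_lt (show j < R + 1 by omega)]

/-- A cyclic shift is a product of adjacent transpositions, which is how controlled swaps realise
it. -/
theorem moveTo_succ {m : ℕ} (hm : m + 1 ≤ R) (z : Wire n k R → Fin 2) :
    moveTo m (z ∘ Equiv.swap (.pos m) (.pos (m + 1))) = moveTo (m + 1) z := by
  funext a
  cases a with
  | out => simp only [moveTo, Function.comp_apply]; rw [Equiv.swap_apply_of_ne_of_ne] <;> simp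
  | blk r w => simp only [moveTo, Function.comp_apply]; rw [Equiv.swap_apply_of_ne_of_ne] <;> simp
  | cnt j =>
    obtain ⟨j, hj, h⟩ := Wire.exists_pos (n := n) (k := k) j
    rw [h, moveTo_pos hj, moveTo_pos hj]
    simp only [Function.comp_apply]
    by_cases h0 : j = 0
    · rw [if_pos h0, if_pos h0, Equiv.swap_apply_left]
    · rw [if_neg h0, if_neg h0]
      by_cases h1 : j ≤ m
      · rw [if_pos h1, if_pos (by omega), Equiv.swap_apply_of_ne_of_ne]
        · rw [ne_eq, Wire.pos_inj (by omega) (by omega)]; omega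
        · rw [ne_eq, Wire.pos_inj (by omega) (by omega)]; omega
      · rw [if_neg h1]
        by_cases h2 : j ≤ m + 1
        · obtain rfl : j = m + 1 := by omega
          rw [if_pos h2, Equiv.swap_apply_right, Nat.add_sub_cancel]
        · rw [if_neg h2, Equiv.swap_apply_of_ne_of_ne]
          · rw [ne_eq, Wire.pos_inj (by omega) (by omega)]; omega
          · rw [ne_eq, Wire.pos_inj (by omega) (by omega)]; omega

theorem runStd_countGates (r : Fin R) (w : SwapWire n k) {m : ℕ} (hm : m ≤ R)
    (ψ : LState (Wire n k R)) (z : Wire n k R → Fin 2) :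
    runStd (countGates (.blk r w) m) ψ z = ψ (if z (.blk r w) = 1 then moveTo m z else z) := by
  induction m generalizing z with
  | zero =>
    have : moveTo 0 z = z := by
      funext a
      cases a with
      | cnt j =>
        obtain ⟨j, hj, h⟩ := Wire.exists_pos (n := n) (k := k) j
        rw [h, moveTo_pos hj]
        split_ifs with h0 h1
        · rw [h0]
        · omega
        · rfl
      | _ => rfl
    simp [countGates, this]
  | succ m ih =>
    rw [countGates, List.range_succ, List.flatMap_append, runStd_append, List.flatMap_singleton,
      runStd_cswap (by simp) (by simp) (by rw [ne_eq, Wire.pos_inj (by omega) hm]; omega),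
      ← countGates, ih (by omega)]
    congr 1
    by_cases h : z (.blk r w) = 1
    · rw [if_pos h, if_pos h, if_pos, moveTo_succ hm]
      rw [Function.comp_apply, Equiv.swap_apply_of_ne_of_ne (by simp) (by simp), h]
    · simp [h]

variable (hle : n ≤ k) (C : Circuit n) (D : Circuit k)

/-- One swap test, after which the counter is moved. -/
def round (r : Fin R) : List (LGate (Wire n k R)) :=
  (swapTest hle C D).map (LGate.map (.blk r) (Wire.blk_injective r)) ++
    (countGates (.blk r ctrl) R).flatMap Std.gates

/-- The first rounds. -/
def rounds (r : ℕ) : List (LGate (Wire n k R)) :=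
  (xGate (Wire.pos R)).flatMap Std.gates ++ ((List.finRange R).take r).flatMap (round hle C D)

/-- The final gates. -/
def finalGates (T : ℕ) : List (Std (Wire n k R)) :=
  (List.range T).map fun i => .cx (.pos i) .out

/-- The output is zero and the counter stands at `m`. -/
def HotAt (m : ℕ) (z : Wire n k R → Fin 2) : Prop :=
  z .out = 0 ∧ ∀ j ≤ R, z (.pos j) = if j = m then 1 else 0

open scoped Classical in
/-- The probability that the counter stands at `m` after `r` rounds. -/
def weight (r m : ℕ) : ℝ :=
  ∑ z : Wire n k R → Fin 2, (if HotAt m z then 1 else 0) * ‖run (rounds hle C D r) vac z‖ ^ 2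

/-- Since gates pull labels back, amplitude found at position `m` after the move was at `m + 1`
before. So an outcome 1 moves the counter down by one, cyclically. -/
theorem hotAt_moveTo {m : ℕ} (z : Wire n k R → Fin 2) :
    HotAt (if m = R then 0 else m + 1) (moveTo R z) ↔ HotAt m z := by
  have hif : ∀ a b : Prop, [Decidable a] → [Decidable b] →
      ((if a then (1 : Fin 2) else 0) = (if b then 1 else 0) ↔ (a ↔ b)) := by
    intro a b _ _
    split_ifs <;> simp_all
  have hz : (0 = if m = R then 0 else m + 1) ↔ R = m := by
    by_cases h : m = R
    · simp [h]
    · rw [if_neg h]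
      constructor <;> intro h' <;> omega
  have hs : ∀ j < R, (j + 1 = if m = R then 0 else m + 1) ↔ j = m := by
    intro j hj
    by_cases h : m = R
    · rw [if_pos h]
      constructor <;> intro h' <;> omega
    · rw [if_neg h]
      constructor <;> intro h' <;> omega
  constructor
  · rintro ⟨h0, h⟩
    refine ⟨h0, fun j hj => ?_⟩
    by_cases hjR : j = R
    · have := h 0 (Nat.zero_le _)
      rw [moveTo_pos (Nat.zero_le _), if_pos rfl] at this
      simp only [hjR, this, hz]
    · have := h (j + 1) (by omega)
      rw [moveTo_pos (by omega), if_neg (by omega), if_pos (by omega), Nat.add_sub_cancel] at this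
      rw [this, hif, hs j (by omega)]
  · rintro ⟨h0, h⟩
    refine ⟨h0, fun j hj => ?_⟩
    rw [moveTo_pos hj]
    by_cases hj0 : j = 0
    · rw [if_pos hj0, h R le_rfl, hif, hj0, hz]
    · obtain ⟨i, rfl⟩ := Nat.exists_eq_succ_of_ne_zero hj0
      rw [if_neg hj0, if_pos hj, h _ (by omega), hif, Nat.succ_eq_add_one, hs i (by omega),
        Nat.add_sub_cancel]

theorem moveTo_injective : Function.Injective (moveTo R : (Wire n k R → Fin 2) → _) := by
  intro z z' h
  funext a
  cases a with
  | out => exact congrFun h .out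
  | blk r w => exact congrFun h (.blk r w)
  | cnt j =>
    obtain ⟨j, hj, hj'⟩ := Wire.exists_pos (n := n) (k := k) j
    rw [hj']
    by_cases hjR : j = R
    · have := congrFun h (.pos 0)
      rw [moveTo_pos (Nat.zero_le _), moveTo_pos (Nat.zero_le _), if_pos rfl, if_pos rfl] at this
      simpa only [hjR] using this
    · have := congrFun h (.pos (j + 1))
      rw [moveTo_pos (by omega), moveTo_pos (by omega)] at this
      simpa only [if_neg (show ¬ j + 1 = 0 by omega), if_pos (show j + 1 ≤ R by omega),
        Nat.add_sub_cancel] using this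

theorem rounds_succ (r : Fin R) : rounds hle C D (r + 1) = rounds hle C D r ++ round hle C D r := by
  have : (List.finRange R).take (r + 1) = (List.finRange R).take r ++ [r] := by
    rw [List.take_add_one, List.getElem?_eq_getElem (by simp)]
    simp
  rw [rounds, this, List.flatMap_append, List.flatMap_singleton, ← List.append_assoc, ← rounds]

/-- The qubits of later rounds are zero. -/
theorem run_rounds_eq_zero {r : ℕ} (hr : r ≤ R) (r' : Fin R) (hr' : r ≤ r') (w : SwapWire n k)
    (z : Wire n k R → Fin 2) (hz : z (.blk r' w) ≠ 0) : run (rounds hle C D r) vac z = 0 := by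
  induction r generalizing z r' w with
  | zero =>
    rw [rounds, List.take_zero, List.flatMap_nil, List.append_nil]
    change runStd _ _ _ = 0
    rw [runStd_xGate, vac, if_neg]
    intro h
    have := congrFun h (.blk r' w)
    rw [Function.update_of_ne (by simp)] at this
    exact hz this
  | succ r ih =>
    have h1 := rounds_succ hle C D ⟨r, hr⟩
    simp only at h1
    rw [h1, run_append, round, run_append]
    change runStd _ _ _ = 0
    rw [runStd_countGates _ _ le_rfl, run_map_block (Wire.blk_injective _), ih (by omega) r'
      (by omega) w, zero_mul]
    · rw [Function.extend_apply']
      · split_ifs <;> exact hz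
      · rintro ⟨w', hw'⟩
        rw [Wire.blk.injEq] at hw'
        have := congrArg Fin.val hw'.1
        simp only at this
        omega
    · intro z hz
      obtain ⟨w', hw'⟩ := Function.ne_iff.1 hz
      exact ih (by omega) ⟨r, hr⟩ le_rfl w' z hw'

theorem weight_zero {m : ℕ} (hm : m ≤ R) :
    weight (R := R) hle C D 0 m = if m = R then 1 else 0 := by
  classical
  have h : ∀ z : Wire n k R → Fin 2, run (rounds hle C D 0) vac z =
      if z = Pi.single (.pos R) 1 then 1 else 0 := by
    intro z
    rw [rounds, List.take_zero, List.flatMap_nil, List.append_nil]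
    change runStd _ _ _ = _
    rw [runStd_xGate, vac]
    congr 1
    rw [eq_iff_iff]
    constructor
    · intro h
      funext a
      have := congrFun h a
      by_cases ha : a = .pos R
      · subst ha
        rw [Function.update_self, Pi.zero_apply] at this
        rw [Pi.single_eq_same]
        omega
      · rw [Function.update_of_ne ha] at this
        rw [Pi.single_eq_of_ne ha, this]
        rfl
    · rintro rfl
      funext a
      by_cases ha : a = .pos R
      · subst ha
        rw [Function.update_self, Pi.single_eq_same]
        rfl
      · rw [Function.update_of_ne ha, Pi.single_eq_of_ne ha]
        rfl
  rw [weight, Finset.sum_eq_single (Pi.single (.pos R) 1)]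
  · rw [h, if_pos rfl]
    have : HotAt m (Pi.single (.pos R) 1 : Wire n k R → Fin 2) ↔ m = R := by
      constructor
      · rintro ⟨-, h⟩
        have := h R le_rfl
        rw [Pi.single_eq_same] at this
        by_contra hne
        rw [if_neg (Ne.symm hne)] at this
        exact absurd this (by decide)
      · rintro rfl
        refine ⟨Pi.single_eq_of_ne (by simp) _, fun j hj => ?_⟩
        by_cases hjm : j = m
        · rw [hjm, Pi.single_eq_same, if_pos rfl]
        · rw [Pi.single_eq_of_ne, if_neg hjm]
          rw [ne_eq, Wire.pos_inj hj le_rfl]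
          exact hjm
    simp [this]
  · intro z _ hz
    rw [h, if_neg hz]
    simp
  · simp

/-- The counter is at `m` either because it was there and the test failed, or because it was one
position higher and the test succeeded. The two events before the round are independent of the
outcome of the fresh test. -/
theorem weight_succ (r : Fin R) (m : ℕ) :
    weight (R := R) hle C D (r + 1) m =
      (1 - overlap hle C.output D.output) / 2 * weight (R := R) hle C D r m +
      (1 + overlap hle C.output D.output) / 2 *
        weight (R := R) hle C D r (if m = R then 0 else m + 1) := by
  classical
  set ψ := run (rounds hle C D r) (vac : LState (Wire n k R)) with hψ
  set ψ' := run ((swapTest hle C D).map (LGate.map (.blk r) (Wire.blk_injective r))) ψ with hψ'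
  have hzero : ∀ z : Wire n k R → Fin 2, z ∘ Wire.blk r ≠ 0 → ψ z = 0 := by
    intro z hz
    obtain ⟨w', hw'⟩ := Function.ne_iff.1 hz
    exact run_rounds_eq_zero hle C D r.2.le r le_rfl w' z hw'
  have hrun : ∀ z : Wire n k R → Fin 2, run (rounds hle C D (r + 1)) vac z =
      ψ' (if z (.blk r ctrl) = 1 then moveTo R z else z) := by
    intro z
    rw [rounds_succ, run_append, round, run_append]
    change runStd _ _ _ = _
    rw [runStd_countGates _ _ le_rfl]
  -- the substitution of labels
  let τ : (Wire n k R → Fin 2) → (Wire n k R → Fin 2) :=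
    fun z => if z (.blk r ctrl) = 1 then moveTo R z else z
  have hτc : ∀ z, τ z (.blk r ctrl) = z (.blk r ctrl) := by
    intro z
    simp only [τ]
    split_ifs <;> rfl
  -- The move leaves its control qubit alone, so the control can be read off after the move and the
  -- move undone.
  have hτ : Function.Bijective τ := by
    rw [← Finite.injective_iff_bijective]
    intro z z' h
    have hc : z (.blk r ctrl) = z' (.blk r ctrl) := by
      rw [← hτc z, h, hτc z']
    by_cases h1 : z (.blk r ctrl) = 1
    · simp only [τ, if_pos h1, if_pos (hc.symm.trans h1)] at h
      exact moveTo_injective h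
    · simpa only [τ, if_neg h1, if_neg (fun h' => h1 (hc.trans h'))] using h
  let m' := if m = R then 0 else m + 1
  have hhot : ∀ z, HotAt m z ↔ if τ z (.blk r ctrl) = 1 then HotAt m' (τ z) else HotAt m (τ z) := by
    intro z
    rw [hτc]
    by_cases h1 : z (.blk r ctrl) = 1
    · simp only [τ, if_pos h1]
      exact (hotAt_moveTo z).symm
    · simp only [τ, if_neg h1]
  have hext : ∀ i (z : Wire n k R → Fin 2),
      HotAt i (Function.extend (Wire.blk r) (0 : SwapWire n k → Fin 2) z) ↔ HotAt i z := by
    intro i z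
    have h1 : Function.extend (Wire.blk r) (0 : SwapWire n k → Fin 2) z .out = z .out :=
      Function.extend_apply' _ _ _ (by rintro ⟨w, hw⟩; cases hw)
    have h2 : ∀ j, Function.extend (Wire.blk r) (0 : SwapWire n k → Fin 2) z (.pos j) =
        z (.pos j) :=
      fun j => Function.extend_apply' _ _ _ (by rintro ⟨w, hw⟩; cases hw)
    simp only [HotAt, h1, h2]
  have hprob : ∀ s : Fin 2, ∑ x : SwapWire n k → Fin 2, (if x ctrl = s then (1 : ℝ) else 0) *
      ‖run (swapTest hle C D) vac x‖ ^ 2 =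
        (1 + (if s = 1 then 1 else -1) * overlap hle C.output D.output) / 2 := by
    intro s
    rw [← prob_swapTest, Finset.sum_filter]
    refine Finset.sum_congr rfl fun x _ => ?_
    split_ifs <;> simp
  -- Independence: the block `r` is still zero, and the position of the counter does not depend on
  -- its qubits.
  have hw : ∀ i (s : Fin 2), ∑ z : Wire n k R → Fin 2, (if HotAt i z then (1 : ℝ) else 0) *
      (if z (.blk r ctrl) = s then 1 else 0) * ‖ψ' z‖ ^ 2 = weight (R := R) hle C D r i *
        ((1 + (if s = 1 then 1 else -1) * overlap hle C.output D.output) / 2) := by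
    intro i s
    rw [← hprob]
    exact weight_block (Wire.blk_injective r) (swapTest hle C D) ψ hzero
      (fun z => if HotAt i z then 1 else 0) (fun z => by simp only [hext])
      (fun x => if x ctrl = s then 1 else 0)
  have hF := hτ.sum_comp fun y => (if (if y (.blk r ctrl) = 1 then HotAt m' y else HotAt m y)
    then (1 : ℝ) else 0) * ‖ψ' y‖ ^ 2
  have h0 := hw m 0
  have h1 := hw m' 1
  rw [if_neg (by decide)] at h0
  rw [if_pos rfl] at h1
  have hsum : weight (R := R) hle C D (r + 1) m =
      ∑ z : Wire n k R → Fin 2, (if HotAt m z then (1 : ℝ) else 0) *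
        (if z (.blk r ctrl) = 0 then 1 else 0) * ‖ψ' z‖ ^ 2 +
      ∑ z : Wire n k R → Fin 2, (if HotAt m' z then (1 : ℝ) else 0) *
        (if z (.blk r ctrl) = 1 then 1 else 0) * ‖ψ' z‖ ^ 2 := by
    rw [weight, ← Finset.sum_add_distrib]
    refine (Finset.sum_congr rfl fun z _ => ?_).trans
      (hF.trans (Finset.sum_congr rfl fun z _ => ?_))
    · rw [hrun, if_congr (hhot z) rfl rfl]
    have hz : z (.blk r ctrl) = 0 ∨ z (.blk r ctrl) = 1 := by omega
    have h01 : ¬ ((0 : Fin 2) = 1) := by decide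
    have h10 : ¬ ((1 : Fin 2) = 0) := by decide
    rcases hz with hz | hz <;>
      simp only [hz, h01, h10, if_true, if_false, mul_one, mul_zero, zero_mul, add_zero, zero_add]
  rw [hsum, h0, h1]
  ring

/-- The position of the counter has a binomial distribution. -/
theorem weight_eq {r : ℕ} (hr : r ≤ R) {j : ℕ} (hj : j ≤ R) :
    weight (R := R) hle C D r (R - j) =
      (bernsteinPolynomial ℝ r j).eval ((1 + overlap hle C.output D.output) / 2) := by
  set μ := (1 + overlap hle C.output D.output) / 2 with hμ
  have hμ' : (1 - overlap hle C.output D.output) / 2 = 1 - μ := by rw [hμ]; ring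
  induction r generalizing j with
  | zero =>
    rw [weight_zero hle C D (Nat.sub_le _ _)]
    cases j with
    | zero => simp [bernsteinPolynomial]
    | succ j =>
      rw [if_neg (by omega)]
      simp [bernsteinPolynomial]
  | succ r ih =>
    have h1 := weight_succ hle C D ⟨r, hr⟩ (R - j)
    simp only at h1
    rw [h1, hμ', ← hμ, ih (by omega) hj]
    cases j with
    | zero =>
      -- The counter could reach position `R` by wrapping around from 0, but fewer than `R`
      -- successes have been possible so far, so this contribution is zero.
      have h2 := ih (by omega) (le_refl R)
      rw [Nat.sub_self] at h2
      rw [if_pos (by omega), h2]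
      simp only [bernsteinPolynomial, Polynomial.eval_mul, Polynomial.eval_pow, Polynomial.eval_sub,
        Polynomial.eval_one, Polynomial.eval_X, Polynomial.eval_natCast,
        Nat.choose_eq_zero_of_lt (show r < R by omega)]
      simp
      ring
    | succ j =>
      have h2 := ih (by omega) (show j ≤ R by omega)
      have h3 : R - (j + 1) + 1 = R - j := by omega
      rw [if_neg (by omega), h3, h2]
      simp only [bernsteinPolynomial, Polynomial.eval_mul, Polynomial.eval_pow, Polynomial.eval_sub,
        Polynomial.eval_one, Polynomial.eval_X, Polynomial.eval_natCast, Nat.choose_succ_succ,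
        Nat.cast_add, Polynomial.eval_add, Nat.succ_eq_add_one, Nat.add_sub_add_right]
      -- The cases keep the natural subtractions in the exponents honest; in the second one a
      -- binomial coefficient vanishes.
      rcases lt_or_ge j r with h | h
      · obtain ⟨d, rfl⟩ := Nat.exists_eq_add_of_lt h
        have e1 : j + d + 1 - j = d + 1 := by omega
        have e2 : j + d + 1 - (j + 1) = d := by omega
        rw [e1, e2]
        ring
      · rw [Nat.choose_eq_zero_of_lt (show r < j + 1 by omega)]
        have e1 : r - j = 0 := by omega
        rw [e1]
        simp
        ring

end Repetition

end QOver

end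

/-! ### Chebyshev's inequality for the counter, and the acceptance probability. -/

noncomputable section

namespace QOver

section Decision

variable {n k R : ℕ} (hle : n ≤ k) (C : Circuit n) (D : Circuit k)

/-- The circuit that decides, by `R` swap tests, whether the overlap is large. -/
def decisionCircuit (R T : ℕ) : List (LGate (Wire n k R)) :=
  rounds hle C D R ++ (finalGates T).flatMap Std.gates

/-- The action of the final gates on labels. -/
def flipOut (T : ℕ) (z : Wire n k R → Fin 2) : Wire n k R → Fin 2 :=
  Function.update z .out (z .out + ∑ i ∈ Finset.range T, z (.pos i))

theorem runStd_finalGates (T : ℕ) (ψ : LState (Wire n k R)) (z : Wire n k R → Fin 2) :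
    runStd (finalGates T) ψ z = ψ (flipOut T z) := by
  induction T generalizing z with
  | zero => simp [finalGates, flipOut]
  | succ T ih =>
    rw [finalGates, List.range_succ, List.map_append, runStd_append, List.map_singleton,
      runStd_cons, runStd_nil]
    rw [← runStd_nil (runStd [Std.cx (Wire.pos T) Wire.out] _), ← finalGates]
    change runStd [Std.cx _ _] _ z = _
    rw [runStd_cx (by simp), ih]
    congr 1
    simp only [flipOut, Function.update_self, Function.update_idem, Finset.sum_range_succ]
    congr 1
    have : ∀ i, Function.update z .out (z (.pos T) + z .out) (.pos i) = z (.pos i) :=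
      fun i => Function.update_of_ne (by simp) _ _
    rw [Finset.sum_congr rfl fun i _ => this i]
    abel

theorem flipOut_flipOut (T : ℕ) (z : Wire n k R → Fin 2) : flipOut T (flipOut T z) = z := by
  have : ∀ i, flipOut T z (.pos i) = z (.pos i) :=
    fun i => Function.update_of_ne (by simp) _ _
  rw [flipOut]
  simp only [this]
  rw [flipOut, Function.update_idem, Function.update_self, add_assoc]
  have h2 : ∀ a : Fin 2, a + a = 0 := by decide
  rw [h2, add_zero, Function.update_eq_self]

theorem flipOut_out {m : ℕ} {z : Wire n k R → Fin 2} (hz : HotAt m z) {T : ℕ}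
    (hT : T ≤ R) : flipOut T z .out = if m < T then 1 else 0 := by
  rw [flipOut, Function.update_self, hz.1, zero_add,
    Finset.sum_congr rfl fun i hi => hz.2 i (by have := Finset.mem_range.1 hi; omega)]
  simp

theorem HotAt.eq {m m' : ℕ} (hm : m ≤ R) {z : Wire n k R → Fin 2} (h : HotAt m z)
    (h' : HotAt m' z) : m = m' := by
  have h1 := h.2 m hm
  rw [if_pos rfl, h'.2 m hm] at h1
  by_contra hne
  rw [if_neg hne] at h1
  exact absurd h1 (by decide)

-- The counter stands at no more than one position, so the sum is an indicator.
open scoped Classical in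
theorem sum_hotAt_le {s : Finset ℕ} (hs : ∀ m ∈ s, m ≤ R) {z : Wire n k R → Fin 2} {b : ℝ}
    (hb : 0 ≤ b) (h : ∀ m ∈ s, HotAt m z → 1 ≤ b) :
    ∑ m ∈ s, (if HotAt m z then (1 : ℝ) else 0) ≤ b := by
  by_cases hex : ∃ m ∈ s, HotAt m z
  · obtain ⟨m, hm, hz⟩ := hex
    rw [Finset.sum_eq_single m, if_pos hz]
    · exact h m hm hz
    · intro m' _ hne
      rw [if_neg fun h' => hne ((hz.eq (hs m hm) h').symm)]
    · exact fun h' => absurd hm h'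
  · rw [Finset.sum_eq_zero]
    · exact hb
    · intro m hm
      rw [if_neg fun h' => hex ⟨m, hm, h'⟩]

theorem weight_nonneg (r m : ℕ) : 0 ≤ weight (R := R) hle C D r m :=
  Finset.sum_nonneg fun z _ => by split_ifs <;> positivity

theorem sum_weight (s : Finset ℕ) (r : ℕ) : ∑ m ∈ s, weight (R := R) hle C D r m =
    open scoped Classical in ∑ z : Wire n k R → Fin 2,
      (∑ m ∈ s, if HotAt m z then (1 : ℝ) else 0) * ‖run (rounds hle C D r) vac z‖ ^ 2 := by
  simp only [weight]
  rw [Finset.sum_comm]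
  simp only [Finset.sum_mul]

/-- The acceptance probability of the circuit. -/
def decisionProb (R T : ℕ) : ℝ :=
  ∑ z : Wire n k R → Fin 2 with z .out = 1, ‖run (decisionCircuit hle C D R T) vac z‖ ^ 2

/-- The final CNOT gates permute the labels by an involution, so they can be moved from the state to
the accepting event. -/
theorem decisionProb_eq (T : ℕ) : decisionProb hle C D R T =
    ∑ z : Wire n k R → Fin 2, (if flipOut T z .out = 1 then 1 else 0) *
      ‖run (rounds hle C D R) vac z‖ ^ 2 := by
  have h : ∀ z : Wire n k R → Fin 2, run (decisionCircuit hle C D R T) vac z =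
      run (rounds hle C D R) vac (flipOut T z) := by
    intro z
    rw [decisionCircuit, run_append]
    change runStd _ _ _ = _
    rw [runStd_finalGates]
  have hinv : Function.Involutive (flipOut T : (Wire n k R → Fin 2) → _) := flipOut_flipOut T
  rw [decisionProb, Finset.sum_filter, ← hinv.bijective.sum_comp]
  refine Finset.sum_congr rfl fun z _ => ?_
  rw [h, flipOut_flipOut]
  split_ifs <;> simp

/-- This and `decisionProb_le` are only inequalities, so labels in which the counter is not in a
legal state need no analysis; `sum_weight_eq_one` compensates for ignoring them. -/
theorem sum_weight_le_decisionProb {T : ℕ} (hT : T ≤ R) :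
    ∑ m ∈ Finset.range T, weight (R := R) hle C D R m ≤ decisionProb hle C D R T := by
  classical
  rw [sum_weight, decisionProb_eq]
  refine Finset.sum_le_sum fun z _ => mul_le_mul_of_nonneg_right ?_ (by positivity)
  refine sum_hotAt_le (fun m hm => by have := Finset.mem_range.1 hm; omega)
    (by split_ifs <;> norm_num) fun m hm hz => ?_
  have := Finset.mem_range.1 hm
  rw [flipOut_out hz hT, if_pos this, if_pos rfl]

theorem decisionProb_le {T : ℕ} (hT : T ≤ R) : decisionProb hle C D R T ≤
    1 - ∑ m ∈ Finset.Ico T (R + 1), weight (R := R) hle C D R m := by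
  classical
  have h1 : ∑ z : Wire n k R → Fin 2, ‖run (rounds hle C D R) vac z‖ ^ 2 = 1 := by
    rw [norm_run, norm_vac]
  rw [le_sub_iff_add_le, sum_weight, decisionProb_eq, ← Finset.sum_add_distrib]
  refine le_trans ?_ h1.le
  refine Finset.sum_le_sum fun z _ => ?_
  have : ∑ m ∈ Finset.Ico T (R + 1), (if HotAt m z then (1 : ℝ) else 0) ≤
      1 - if flipOut T z .out = 1 then 1 else 0 := by
    refine sum_hotAt_le (fun m hm => by have := Finset.mem_Ico.1 hm; omega)
      (by split_ifs <;> norm_num) fun m hm hz => ?_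
    have := Finset.mem_Ico.1 hm
    have h0 : flipOut T z .out = 0 := by rw [flipOut_out hz hT, if_neg (by omega)]
    rw [h0]
    norm_num
  rw [← add_mul]
  refine mul_le_of_le_one_left (by positivity) (by linarith)

theorem weight_eq' {m : ℕ} (hm : m ≤ R) : weight (R := R) hle C D R m =
    (bernsteinPolynomial ℝ R (R - m)).eval ((1 + overlap hle C.output D.output) / 2) := by
  rw [← weight_eq hle C D le_rfl (Nat.sub_le R m), Nat.sub_sub_self hm]

theorem sum_weight_eq_one : ∑ m ∈ Finset.range (R + 1), weight (R := R) hle C D R m = 1 := by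
  have h := congrArg (Polynomial.eval ((1 + overlap hle C.output D.output) / 2))
    (bernsteinPolynomial.sum ℝ R)
  rw [Polynomial.eval_finsetSum, Polynomial.eval_one, ← Finset.sum_range_reflect] at h
  rw [← h]
  refine Finset.sum_congr rfl fun m hm => ?_
  rw [weight_eq' hle C D (by have := Finset.mem_range.1 hm; omega)]
  simp

/-- The variance of the binomial distribution is Rμ(1 - μ), and μ(1 - μ) ≤ 1/4. -/
theorem variance_weight {μ : ℝ} (hμ : μ = (1 + overlap hle C.output D.output) / 2) :
    ∑ m ∈ Finset.range (R + 1), (R * μ - (R - m)) ^ 2 * weight (R := R) hle C D R m ≤ R / 4 := by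
  have h := congrArg (Polynomial.eval μ) (bernsteinPolynomial.variance ℝ R)
  rw [Polynomial.eval_finsetSum, ← Finset.sum_range_reflect] at h
  simp only [Polynomial.eval_mul, Polynomial.eval_pow, Polynomial.eval_sub, Polynomial.eval_one,
    Polynomial.eval_X, Polynomial.eval_natCast, nsmul_eq_mul] at h
  have h2 : ∑ m ∈ Finset.range (R + 1), (R * μ - (R - m)) ^ 2 * weight (R := R) hle C D R m =
      R * μ * (1 - μ) := by
    rw [← h]
    refine Finset.sum_congr rfl fun m hm => ?_
    have hm' : m ≤ R := by have := Finset.mem_range.1 hm; omega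
    rw [weight_eq' hle C D hm', ← hμ, Nat.add_sub_cancel, Nat.cast_sub hm']
  rw [h2]
  have : (0 : ℝ) ≤ R := Nat.cast_nonneg R
  nlinarith [sq_nonneg (μ - 1 / 2)]

/-- Chebyshev's inequality; position `m` stands for `R - m` successes. -/
theorem sum_weight_le {μ : ℝ} (hμ : μ = (1 + overlap hle C.output D.output) / 2) {δ : ℝ}
    (hδ : 0 < δ) (hR : 3 * R ≤ 4 * δ ^ 2) {s : Finset ℕ} (hs : s ⊆ Finset.range (R + 1))
    (h : ∀ m ∈ s, δ ≤ |R * μ - (R - m)|) :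
    ∑ m ∈ s, weight (R := R) hle C D R m ≤ 1 / 3 := by
  have h1 : δ ^ 2 * ∑ m ∈ s, weight (R := R) hle C D R m ≤ R / 4 := by
    refine le_trans ?_ (variance_weight hle C D hμ)
    rw [Finset.mul_sum]
    refine (Finset.sum_le_sum fun m hm => ?_).trans
      (Finset.sum_le_sum_of_subset_of_nonneg hs fun m _ _ =>
        mul_nonneg (sq_nonneg _) (weight_nonneg hle C D R m))
    refine mul_le_mul_of_nonneg_right ?_ (weight_nonneg hle C D R m)
    rw [← sq_abs (R * μ - (R - m))]
    exact pow_le_pow_left₀ hδ.le (h m hm) 2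
  have h2 : 0 < δ ^ 2 := by positivity
  by_contra hlt
  rw [not_le] at hlt
  nlinarith [mul_lt_mul_of_pos_left hlt h2]

theorem two_thirds_le_decisionProb {T : ℕ} (hT : T ≤ R) {δ : ℝ} (hδ : 0 < δ)
    (hR : 3 * R ≤ 4 * δ ^ 2)
    (h : δ ≤ R * ((1 + overlap hle C.output D.output) / 2) - (R - T)) :
    2 / 3 ≤ decisionProb hle C D R T := by
  have h1 := sum_weight_le (R := R) hle C D rfl hδ hR (s := Finset.Ico T (R + 1))
    (by intro m hm; simp only [Finset.mem_Ico, Finset.mem_range] at hm ⊢; omega) (by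
      intro m hm
      have : (T : ℝ) ≤ m := by exact_mod_cast (Finset.mem_Ico.1 hm).1
      exact le_trans (by linarith) (le_abs_self _))
  have h2 := sum_weight_le_decisionProb hle C D hT
  have h3 := sum_weight_eq_one (R := R) hle C D
  rw [← Finset.sum_range_add_sum_Ico _ (show T ≤ R + 1 by omega)] at h3
  linarith

/-- Accepting positions are strictly below `T`, so they mean at least `R - T + 1` successes. The
extra 1 absorbs part of the rounding of the threshold. -/
theorem decisionProb_le_one_third {T : ℕ} (hT : T ≤ R) {δ : ℝ} (hδ : 0 < δ)
    (hR : 3 * R ≤ 4 * δ ^ 2)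
    (h : δ ≤ (R - T + 1) - R * ((1 + overlap hle C.output D.output) / 2)) :
    decisionProb hle C D R T ≤ 1 / 3 := by
  have h1 := sum_weight_le (R := R) hle C D rfl hδ hR (s := Finset.range T)
    (by intro m hm; simp only [Finset.mem_range] at hm ⊢; omega) (by
      intro m hm
      have : (m : ℝ) + 1 ≤ T := by exact_mod_cast Finset.mem_range.1 hm
      rw [abs_sub_comm]
      exact le_trans (by linarith) (le_abs_self _))
  have h2 := decisionProb_le hle C D hT
  have h3 := sum_weight_eq_one (R := R) hle C D
  rw [← Finset.sum_range_add_sum_Ico _ (show T ≤ R + 1 by omega)] at h3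
  linarith

end Decision

end QOver

end

/-! ### A calculus for programs that read and write descriptions. -/

noncomputable section

namespace QOver

/-! ### Programs with an output register -/

section Trans

variable {R : Type}

/-- The contents of the output register and of the other registers. -/
def memory (S : R → List Bool) (o : List Bool) : Option R → List Bool
  | none => o
  | some r => S r

@[simp] theorem memory_none (S : R → List Bool) (o : List Bool) : memory S o none = o := rfl

@[simp] theorem memory_some (S : R → List Bool) (o : List Bool) (r : R) :
    memory S o (some r) = S r := rfl

variable [DecidableEq R]

@[simp] theorem update_memory_none (S : R → List Bool) (o v : List Bool) :
    Function.update (memory S o) none v = memory S v := by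
  funext a
  cases a with
  | none => simp
  | some r => simp

@[simp] theorem update_memory_some (S : R → List Bool) (o : List Bool) (r : R) (v : List Bool) :
    Function.update (memory S o) (some r) v = memory (Function.update S r v) o := by
  funext a
  cases a with
  | none => simp
  | some r' =>
    by_cases h : r' = r
    · subst h; simp
    · simp [h]

/-- The program takes the registers from `S` to `S'` and emits the word `w`. -/
def Trans (N : ℕ) (p : Prog (Option R)) (S S' : R → List Bool) (w : List Bool) : Prop :=
  ∀ o, p.eval N (memory S o) = memory S' (w.reverse ++ o)

/-- Emitting a bit. -/
abbrev Prog.emit (b : Bool) : Prog (Option R) := .push none b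

/-- Running programs one after the other. -/
def Prog.seqs : List (Prog (Option R)) → Prog (Option R)
  | [] => .skip
  | p :: l => .seq p (Prog.seqs l)

/-- Emitting a word. -/
def Prog.emits (w : List Bool) : Prog (Option R) := .seqs (w.map Prog.emit)

namespace Trans

variable {N : ℕ} {p q z : Prog (Option R)} {S S' S'' : R → List Bool} {w w' : List Bool}

theorem skip : Trans N .skip S S [] := fun _ => rfl

theorem emit (b : Bool) : Trans N (.emit b) S S [b] := fun o => by simp [Prog.eval]

theorem push (r : R) (b : Bool) :
    Trans N (.push (some r) b) S (Function.update S r (b :: S r)) [] :=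
  fun o => by simp [Prog.eval]

theorem seq (hp : Trans N p S S' w) (hq : Trans N q S' S'' w') :
    Trans N (.seq p q) S S'' (w ++ w') := fun o => by
  rw [Prog.eval, hp, hq, List.reverse_append, List.append_assoc]

theorem seqs {α : Type} {l : List α} {f : α → Prog (Option R)} {w : α → List Bool}
    (h : ∀ x ∈ l, Trans N (f x) S S (w x)) : Trans N (.seqs (l.map f)) S S (l.flatMap w) := by
  induction l with
  | nil => exact skip
  | cons x l ih =>
    exact (h x (by simp)).seq (ih fun y hy => h y (by simp [hy]))

theorem emits (w : List Bool) : Trans N (.emits w) S S w := by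
  have h := seqs (S := S) (l := w) (w := fun b => [b]) fun b _ => emit (N := N) b
  rwa [List.flatMap_singleton'] at h

theorem popCase {r : R} (t : List Bool) (b : Bool) (hr : S r = b :: t)
    (h : Trans N (bif b then p else q) (Function.update S r t) S' w) :
    Trans N (.popCase (some r) p q z) S S' w := fun o => by
  cases b <;> simp_all [Prog.eval, ← h o]

theorem popCase_nil {r : R} (hr : S r = []) (h : Trans N z S S' w) :
    Trans N (.popCase (some r) p q z) S S' w := fun o => by
  rw [← h o]
  have : Function.update S r [] = S := by rw [← hr, Function.update_eq_self]
  simp [Prog.eval, hr, this]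

end Trans

theorem flatMap_const_singleton {α β : Type} (l : List α) (b : β) :
    (l.flatMap fun _ => [b]) = List.replicate l.length b := by
  induction l with
  | nil => rfl
  | cons x l ih => rw [List.flatMap_cons, ih, List.length_cons, List.replicate_succ]; rfl

theorem flatMap_const_nil {α β : Type} (l : List α) : (l.flatMap fun _ => ([] : List β)) = [] := by
  induction l with
  | nil => rfl
  | cons x l ih => rw [List.flatMap_cons, ih]; rfl

/-- The program `q` runs the program `p` repeatedly, `m` times. -/
def Repeats (N : ℕ) (p q : Prog (Option R)) (m : ℕ) : Prop :=
  ∀ (S : ℕ → R → List Bool) (w : ℕ → List Bool), (∀ i < m, Trans N p (S i) (S (i + 1)) (w i)) →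
    Trans N q (S 0) (S m) ((List.range m).flatMap w)

theorem Repeats.refl (N : ℕ) (p : Prog (Option R)) : Repeats N p p 1 := fun S w h => by
  simpa using h 0 one_pos

theorem Repeats.seq {N : ℕ} {p q q' : Prog (Option R)} {m m' : ℕ} (h : Repeats N p q m)
    (h' : Repeats N p q' m') : Repeats N p (.seq q q') (m + m') := fun S w hS => by
  rw [List.range_add, List.flatMap_append, List.flatMap_map]
  exact (h S w fun i hi => hS i (by omega)).seq
    (h' (fun i => S (m + i)) (fun i => w (m + i)) fun i hi => hS (m + i) (by omega))

/-- A loop without guard has exactly `N` rounds, so nesting such loops yields powers of `N`. -/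
theorem Repeats.loop {N : ℕ} {p q : Prog (Option R)} {m : ℕ} (h : Repeats N p q m) :
    Repeats N p (.loop none q) (N * m) := by
  intro S w hS o
  rw [Prog.eval]
  have key : ∀ c, c ≤ N → ∀ (S : ℕ → R → List Bool) (w : ℕ → List Bool) (o : List Bool),
      (∀ i < c * m, Trans N p (S i) (S (i + 1)) (w i)) →
      Prog.rounds none (Prog.eval N q) c (memory (S 0) o) =
        memory (S (c * m)) (((List.range (c * m)).flatMap w).reverse ++ o) := by
    intro c
    induction c with
    | zero => intro _ S w o _; simp [Prog.rounds]
    | succ c ih =>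
      intro hc S w o hS
      rw [Nat.succ_mul, Nat.add_comm (c * m)] at hS ⊢
      change Prog.rounds none (Prog.eval N q) c (Prog.eval N q (memory (S 0) o)) = _
      have h2 := ih (by omega) (fun i => S (m + i)) (fun i => w (m + i))
        (((List.range m).flatMap w).reverse ++ o) fun i hi => hS (m + i) (by omega)
      rw [h S w (fun i hi => hS i (by omega)) o]
      refine h2.trans ?_
      rw [List.range_add, List.flatMap_append, List.flatMap_map, List.reverse_append,
        List.append_assoc]
  exact key N le_rfl S w o hS

/-- Running a program `N ^ e` times. -/
def Prog.iter : ℕ → Prog (Option R) → Prog (Option R)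
  | 0, p => p
  | e + 1, p => .loop none (Prog.iter e p)

theorem Repeats.iter (N : ℕ) (p : Prog (Option R)) (e : ℕ) :
    Repeats N p (.iter e p) (N ^ e) := by
  induction e with
  | zero => exact .refl N p
  | succ e ih => rw [pow_succ, Nat.mul_comm]; exact ih.loop

/-- Running a program `4 * N ^ e` times. -/
def Prog.iter₄ (e : ℕ) (p : Prog (Option R)) : Prog (Option R) :=
  .seq (.seq (.iter e p) (.iter e p)) (.seq (.iter e p) (.iter e p))

theorem Repeats.iter₄ (N : ℕ) (p : Prog (Option R)) (e : ℕ) :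
    Repeats N p (.iter₄ e p) (4 * N ^ e) := by
  have h := Repeats.iter N p e
  have h4 : 4 * N ^ e = N ^ e + N ^ e + (N ^ e + N ^ e) := by ring
  rw [h4]
  exact (h.seq h).seq (h.seq h)

theorem Repeats.const {N : ℕ} {p q : Prog (Option R)} {m : ℕ} (h : Repeats N p q m)
    {S : R → List Bool} {b : Bool} (hp : Trans N p S S [b]) :
    Trans N q S S (List.replicate m b) := by
  have := h (fun _ => S) (fun _ => [b]) fun _ _ => hp
  rwa [flatMap_const_singleton, List.length_range] at this

/-! ### Reading an input register -/

/-- With the other registers as in `S`, the program reads the word `c` from the register `r` and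
emits the word `w`. -/
def Reads (N : ℕ) (r : R) (S : R → List Bool) (p : Prog (Option R)) (c w : List Bool) : Prop :=
  ∀ t, (c ++ t).length ≤ N →
    Trans N p (Function.update S r (c ++ t)) (Function.update S r t) w

namespace Reads

variable {N : ℕ} {r : R} {S : R → List Bool} {p q z : Prog (Option R)} {c c' w w' : List Bool}

theorem seq (hp : Reads N r S p c w) (hq : Reads N r S q c' w') :
    Reads N r S (.seq p q) (c ++ c') (w ++ w') := fun t ht => by
  rw [List.append_assoc] at ht ⊢
  exact (hp _ ht).seq (hq t (by simp only [List.length_append] at ht ⊢; omega))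

theorem skip : Reads N r S .skip [] [] := fun _ _ => .skip

theorem emit (b : Bool) : Reads N r S (.emit b) [] [b] := fun _ _ => .emit b

theorem emit_seq {b : Bool} (hp : Reads N r S p c w) :
    Reads N r S (.seq (.emit b) p) c (b :: w) := (emit b).seq hp

theorem seq_emit {b : Bool} (hp : Reads N r S p c w) :
    Reads N r S (.seq p (.emit b)) c (w ++ [b]) := by
  simpa using hp.seq (emit b)

theorem popCase {b : Bool} (h : Reads N r S (bif b then p else q) c w) :
    Reads N r S (.popCase (some r) p q z) (b :: c) w := fun t ht => by
  refine Trans.popCase (c ++ t) b (by simp) ?_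
  rw [Function.update_idem]
  exact h t (by simp only [List.length_append, List.length_cons] at ht ⊢; omega)

theorem length_le_length_encList {α : Type} (e : α → List Bool) (l : List α) :
    l.length < (encList e l).length := by
  induction l with
  | nil => simp [encList]
  | cons x l ih => simp only [encList, List.length_cons, List.length_append]; omega

/-- The guard of the loop consumes the bit that precedes each cell, and finally the terminating
`false`. This takes one more test than there are cells, which the length bound in `Reads` allows
for. -/
theorem scan {α : Type} {e f : α → List Bool} {l : List α}
    (h : ∀ x ∈ l, Reads N r S p (e x) (f x)) :
    Reads N r S (.loop (some (some r)) p) (encList e l) (l.flatMap f) := by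
  intro t ht o
  rw [Prog.eval]
  have key : ∀ m, l.length < m → ∀ o, Prog.rounds (some (some r)) (Prog.eval N p) m
      (memory (Function.update S r (encList e l ++ t)) o) =
      memory (Function.update S r t) ((l.flatMap f).reverse ++ o) := by
    clear o
    induction l with
    | nil =>
      intro m hm o
      obtain ⟨m, rfl⟩ := Nat.exists_eq_succ_of_ne_zero hm.ne'
      simp [Prog.rounds, Prog.test, encList]
    | cons x l ih =>
      intro m hm o
      obtain ⟨m, rfl⟩ := Nat.exists_eq_succ_of_ne_zero (Nat.ne_of_gt (Nat.zero_lt_of_lt hm))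
      have hlen : (e x ++ (encList e l ++ t)).length ≤ N := by
        simp only [encList, List.length_append, List.length_cons] at ht ⊢; omega
      have h1 := h x (by simp) _ hlen o
      have h2 := ih (fun y hy => h y (by simp [hy])) (by
        simp only [List.length_append] at hlen ⊢; omega) m
        (by simp only [List.length_cons] at hm; omega) ((f x).reverse ++ o)
      rw [Prog.rounds]
      simp only [Prog.test, encList, memory_some, Function.update_self, List.cons_append,
        List.head?_cons, beq_self_eq_true, cond_true, List.tail_cons, update_memory_some,
        Function.update_idem, List.append_assoc, h1, h2, List.flatMap_cons, List.reverse_append]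
  refine key N ?_ o
  have := length_le_length_encList e l
  simp only [List.length_append] at ht
  omega

theorem seqs {α : Type} {l : List α} {f : α → Prog (Option R)} {c w : α → List Bool}
    (h : ∀ x ∈ l, Reads N r S (f x) (c x) (w x)) :
    Reads N r S (.seqs (l.map f)) (l.flatMap c) (l.flatMap w) := by
  induction l with
  | nil => exact skip
  | cons x l ih =>
    exact (h x (by simp)).seq (ih fun y hy => h y (by simp [hy]))

end Reads

/-- Unary numbers are lists with empty cells, and in `encBits_eq` bit strings are lists with one-bit
cells, so `Reads.scan` covers all three kinds of code. -/
theorem encUnary_eq (n : ℕ) : encUnary n = encList (fun _ => []) (List.replicate n ()) := by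
  induction n with
  | zero => rfl
  | succ n ih =>
    simp only [List.replicate_succ, encList, List.nil_append, ← ih]
    rfl

theorem encBits_eq (l : List Bool) : encBits l = encList (fun b => [b]) l := by
  induction l with
  | nil => rfl
  | cons b l ih => simp [encBits, encList, ih]

/-! ### Copying descriptions -/

/-- Skipping a number in unary. -/
def skipUnary (r : R) : Prog (Option R) := .loop (some (some r)) .skip

/-- Copying the ones of a number in unary. -/
def copyOnes (r : R) : Prog (Option R) := .loop (some (some r)) (.emit true)

def copyUnary (r : R) : Prog (Option R) := .seq (copyOnes r) (.emit false)

def copyBit (r : R) : Prog (Option R) := .popCase (some r) (.emit true) (.emit false) .skip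

def copyBits (r : R) : Prog (Option R) :=
  .seq (.loop (some (some r)) (.seq (.emit true) (copyBit r))) (.emit false)

def copyRat (r : R) : Prog (Option R) := .seq (copyBit r) (.seq (copyBits r) (copyBits r))

def copyAmp (r : R) : Prog (Option R) :=
  .seq (copyRat r) (.seq (copyRat r) (.seq (copyRat r) (copyRat r)))

/-- Copying a gate, with the program `pre` prefixed to the indices of the qubits. -/
def copyGate (r : R) (pre : Prog (Option R)) : Prog (Option R) :=
  .popCase (some r)
    (.seq (.emit true) (.seq (.seq pre (copyUnary r)) (.seq (.seq pre (copyUnary r))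
      (.seqs ([(0, 0), (0, 1), (1, 0), (1, 1)].map fun _ : Fin 2 × Fin 2 =>
        .seqs ([(0, 0), (0, 1), (1, 0), (1, 1)].map fun _ : Fin 2 × Fin 2 => copyAmp r))))))
    (.seq (.emit false) (.seq (.seq pre (copyUnary r))
      (.seqs ([(0, 0), (0, 1), (1, 0), (1, 1)].map fun _ : Fin 2 × Fin 2 => copyAmp r))))
    .skip

/-- Copying the cells of a list of gates, without the end. -/
def copyGates (r : R) (pre : Prog (Option R)) : Prog (Option R) :=
  .loop (some (some r)) (.seq (.emit true) (copyGate r pre))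

section Copy

variable {N : ℕ} {r : R} {S : R → List Bool}

theorem reads_skipUnary (n : ℕ) : Reads N r S (skipUnary r) (encUnary n) [] := by
  rw [encUnary_eq]
  have h := Reads.scan (l := List.replicate n ()) (f := fun _ => []) (e := fun _ => [])
    fun _ _ => (Reads.skip : Reads N r S _ _ _)
  rwa [flatMap_const_nil] at h

theorem reads_copyOnes (n : ℕ) :
    Reads N r S (copyOnes r) (encUnary n) (List.replicate n true) := by
  rw [encUnary_eq]
  have h := Reads.scan (l := List.replicate n ()) (f := fun _ => [true]) (e := fun _ => [])
    fun _ _ => (Reads.emit true : Reads N r S _ _ _)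
  rwa [flatMap_const_singleton, List.length_replicate] at h

theorem reads_copyUnary (n : ℕ) : Reads N r S (copyUnary r) (encUnary n) (encUnary n) :=
  (reads_copyOnes n).seq_emit

theorem reads_copyBit (b : Bool) : Reads N r S (copyBit r) [b] [b] := by
  refine Reads.popCase ?_
  cases b
  · exact .emit false
  · exact .emit true

theorem reads_copyBits (l : List Bool) : Reads N r S (copyBits r) (encBits l) (encBits l) := by
  rw [encBits_eq]
  have h : encList (fun b => [b]) l = l.flatMap (fun b => [true, b]) ++ [false] := by
    induction l with
    | nil => rfl
    | cons b l ih => simp [encList, ih]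
  nth_rw 2 [h]
  exact (Reads.scan fun b _ => (reads_copyBit b).emit_seq).seq_emit

theorem reads_copyRat (x : ℚ) : Reads N r S (copyRat r) (encRat x) (encRat x) :=
  (reads_copyBit _).seq ((reads_copyBits _).seq (reads_copyBits _))

theorem reads_copyAmp (x : Amp) : Reads N r S (copyAmp r) x.enc x.enc :=
  (reads_copyRat _).seq ((reads_copyRat _).seq ((reads_copyRat _).seq (reads_copyRat _)))

/-- Shifting the indices of the qubits of a gate in its description. -/
def Gate.encShift {n : ℕ} (m : ℕ) : Gate n → List Bool
  | .one i U => false :: (encUnary (m + i) ++ U.enc)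
  | .two i j _ U => true :: (encUnary (m + i) ++ (encUnary (m + j) ++ U.enc))

theorem replicate_append_encUnary (m i : ℕ) :
    List.replicate m true ++ encUnary i = encUnary (m + i) := by
  rw [encUnary, encUnary, List.replicate_add, List.append_assoc]

/-- Indices are in unary, so writing `m` ones in front of each of them shifts the gate by `m`
qubits. -/
theorem reads_copyGate {n m : ℕ} {pre : Prog (Option R)}
    (hpre : Reads N r S pre [] (List.replicate m true)) (g : Gate n) :
    Reads N r S (copyGate r pre) g.enc (g.encShift m) := by
  have hU : ∀ i, Reads N r S (.seq pre (copyUnary r)) (encUnary i) (encUnary (m + i)) := by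
    intro i
    rw [← replicate_append_encUnary]
    exact hpre.seq (reads_copyUnary i)
  cases g with
  | one i U =>
    exact .popCase (b := false) (((hU i).seq (Reads.seqs fun _ _ => reads_copyAmp _)).emit_seq)
  | two i j h U =>
    exact .popCase (b := true) (((hU i).seq ((hU j).seq
      (Reads.seqs fun _ _ => Reads.seqs fun _ _ => reads_copyAmp _))).emit_seq)

theorem reads_copyGates {n m : ℕ} {pre : Prog (Option R)}
    (hpre : Reads N r S pre [] (List.replicate m true)) (C : Circuit n) :
    Reads N r S (copyGates r pre) (encList Gate.enc C)
      (C.flatMap fun g => true :: g.encShift m) :=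
  .scan fun g _ => (reads_copyGate hpre g).emit_seq

end Copy

end Trans

theorem encList_eq {α : Type} (e : α → List Bool) (l : List α) :
    encList e l = (l.flatMap fun x => true :: e x) ++ [false] := by
  induction l with
  | nil => rfl
  | cons x l ih => simp [encList, ih]

end QOver

end

/-! ### Hardness: an acceptance probability as an overlap. -/

noncomputable section

namespace QOver

/-! ### Hardness -/

section Hardness

/-- The qubits of a shifted circuit. -/
def shiftFin (n q : ℕ) (i : Fin q) : Fin (n + q + 1) := ⟨n + i, by omega⟩

theorem shiftFin_injective (n q : ℕ) : Function.Injective (shiftFin n q) := by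
  intro i j h
  have := congrArg Fin.val h
  simp only [shiftFin] at this
  exact Fin.ext (by omega)

/-- Running a circuit on later qubits, and then writing the negation of its result to the first
qubit. -/
def shiftedCircuit {q : ℕ} (n : ℕ) (C : Circuit q) : List (LGate (Fin (n + q + 1))) :=
  (C.map Gate.toL).map (LGate.map (shiftFin n q) (shiftFin_injective n q)) ++
    (Std.cx (⟨n, by omega⟩ : Fin (n + q + 1)) 0 :: xGate 0).flatMap Std.gates

/-- Overlap with the all-zero state is the probability of measuring zeros on the first `n` qubits.
-/
theorem overlap_nil {n k : ℕ} (hle : n ≤ k) (D : Circuit k) :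
    overlap hle (Circuit.output ([] : Circuit n)) D.output =
      ∑ v : Basis k with firstPart hle v = 0, ‖D.output v‖ ^ 2 := by
  have h0 : Circuit.output ([] : Circuit n) = vac := by rw [← run_map_toL]; rfl
  rw [overlap_eq, h0, Finset.sum_eq_single 0]
  · rw [Complex.re_sum, Finset.sum_filter]
    refine Finset.sum_congr rfl fun v _ => ?_
    by_cases hv : firstPart hle v = 0
    · have h1 : replaceFirst (0 : Basis n) v = v := by
        have := replaceFirst_firstPart hle 0 v
        rw [hv] at this
        funext j
        by_cases hj : j.1 < n
        · have := congrFun hv ⟨j.1, hj⟩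
          simp only [replaceFirst, hj, dif_pos]
          exact this.symm
        · simp [replaceFirst, hj]
      rw [if_pos hv, h1, hv]
      simp only [vac, if_true, one_mul]
      rw [Complex.star_def, Complex.mul_conj, Complex.ofReal_re, Complex.normSq_eq_norm_sq]
    · simp [vac, hv]
  · intro u _ hu
    simp [vac, hu]
  · simp

/-- Of the first `n` qubits only qubit 0 is ever touched, and it ends as the negation of the result
of `Q`. So these qubits are all zero exactly when `Q` accepts. -/
theorem overlap_shiftedCircuit {n : ℕ} (hn : 0 < n) {Q : QCircuit}
    (hle : n ≤ n + Q.qubits + 1) :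
    overlap hle (Circuit.output ([] : Circuit n))
      (Circuit.output ((shiftedCircuit n Q.gates).map LGate.toGate)) = Q.acceptProb := by
  classical
  obtain ⟨q, C⟩ := Q
  simp only at hle ⊢
  set ψ : LState (Fin (n + q + 1)) :=
    run ((C.map Gate.toL).map (LGate.map (shiftFin n q) (shiftFin_injective n q))) vac
    with hψ
  let c : Fin (n + q + 1) := ⟨n, by omega⟩
  have hc : c ≠ 0 := by
    intro h
    have := congrArg Fin.val h
    simp only [c, Fin.val_zero] at this
    omega
  have hout : ∀ v : Basis (n + q + 1), run (shiftedCircuit n C) vac v =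
      ψ (Function.update v 0 (1 + v 0 + v c)) := by
    intro v
    rw [shiftedCircuit, run_append, ← hψ]
    change runStd _ _ _ = _
    rw [runStd_cons, runStd_xGate, runStd_cx hc, Function.update_self,
      Function.update_of_ne hc, Function.update_idem, add_comm (v c)]
  have hsupp : ∀ v : Basis (n + q + 1), (∃ j, (∀ i, shiftFin n q i ≠ j) ∧ v j ≠ 0) → ψ v = 0 :=
    fun v h => run_map_vac_eq_zero (shiftFin_injective n q) _ v h
  have hlow : ∀ (j : Fin (n + q + 1)), j.1 < n → ∀ i, shiftFin n q i ≠ j := by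
    intro j hj i h
    have := congrArg Fin.val h
    simp only [shiftFin] at this
    omega
  rw [overlap_nil, output_map_toGate]
  have h1 : ∑ v : Basis (n + q + 1) with firstPart hle v = 0, ‖run (shiftedCircuit n C) vac v‖ ^ 2 =
      ∑ v, 1 * (if ∃ h : 0 < q, (v ∘ shiftFin n q) ⟨0, h⟩ = 1 then 1 else 0) * ‖ψ v‖ ^ 2 := by
    rw [Finset.sum_filter]
    refine Finset.sum_congr rfl fun v _ => ?_
    by_cases hv : firstPart hle v = 0
    · have hv0 : v 0 = 0 := congrFun hv ⟨0, hn⟩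
      rw [if_pos hv, hout, hv0, add_zero, one_mul]
      have hvc : v c = 0 ∨ v c = 1 := by omega
      rcases hvc with hvc | hvc
      · rw [hvc, add_zero, hsupp (Function.update v 0 1) ⟨0, hlow 0 hn, by simp⟩, if_neg]
        · simp
        · rintro ⟨h, h'⟩
          exact absurd (hvc.symm.trans h') (by decide)
      · have h2 : Function.update v 0 (1 + v c) = v := by
          rw [hvc, Function.update_eq_self_iff, hv0]
          rfl
        rw [h2]
        -- A circuit without qubits never accepts. The additional last qubit is for this case: the
        -- CNOT then reads it, and it is zero.
        by_cases hq : 0 < q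
        · rw [if_pos ⟨hq, hvc⟩, one_mul]
        · rw [if_neg fun h => hq h.1, zero_mul, hsupp v ⟨c, fun i => absurd i.pos hq, by
            rw [hvc]; decide⟩]
          simp
    · obtain ⟨i, hi⟩ := Function.ne_iff.1 hv
      rw [if_neg hv, hsupp v ⟨Fin.castLE hle i, hlow _ i.2, hi⟩]
      simp
  rw [h1, hψ, weight_block (shiftFin_injective n q) (C.map Gate.toL) vac ?_ (fun _ => 1)
    (fun _ => rfl) fun x => if ∃ h : 0 < q, x ⟨0, h⟩ = 1 then 1 else 0, run_map_toL,
    QCircuit.acceptProb, Finset.sum_filter]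
  · simp only [one_mul, norm_vac]
    refine Finset.sum_congr rfl fun x _ => ?_
    split_ifs <;> simp
  · intro z hz
    rw [vac, if_neg]
    rintro rfl
    exact hz rfl

end Hardness

/-! ### Descriptions of circuits with named qubits -/

section Words

variable {ι κ : Type}

/-- The cell of a gate in the description of a circuit, for an enumeration of the qubits. -/
def LGate.word (f : ι → ℕ) : LGate ι → List Bool
  | .one i U => true :: false :: (encUnary (f i) ++ U.enc)
  | .two i j _ U => true :: true :: (encUnary (f i) ++ (encUnary (f j) ++ U.enc))

theorem LGate.word_map (e : κ → ι) (he : Function.Injective e) (f : ι → ℕ) (g : LGate κ) :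
    (g.map e he).word f = g.word (f ∘ e) := by
  cases g <;> rfl

theorem encShift_eq {n : ℕ} (m : ℕ) (g : Gate n) :
    true :: g.encShift m = g.toL.word fun i : Fin n => m + i.1 := by
  cases g <;> rfl

theorem enc_mk_map_toGate {q : ℕ} (C : List (LGate (Fin q))) :
    encList Gate.enc (C.map LGate.toGate) = C.flatMap (LGate.word Fin.val) ++ [false] := by
  rw [encList_eq, List.flatMap_map]
  congr 2
  funext g
  cases g <;> rfl

theorem flatMap_word_map (e : κ → ι) (he : Function.Injective e) (f : ι → ℕ) (C : List (LGate κ)) :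
    (C.map (LGate.map e he)).flatMap (LGate.word f) = C.flatMap (LGate.word (f ∘ e)) := by
  rw [List.flatMap_map]
  congr 1
  funext g
  exact LGate.word_map e he f g

variable [DecidableEq ι] [DecidableEq κ]

/-- The cells of a list of standard gates. -/
def stdWord (f : ι → ℕ) (C : List (Std ι)) : List Bool :=
  (C.flatMap Std.gates).flatMap (LGate.word f)

theorem stdWord_append (f : ι → ℕ) (C D : List (Std ι)) :
    stdWord f (C ++ D) = stdWord f C ++ stdWord f D := by
  simp only [stdWord, List.flatMap_append]

theorem stdWord_map {e : κ → ι} (he : Function.Injective e) (f : ι → ℕ) (C : List (Std κ)) :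
    stdWord f (C.map (Std.map e)) = stdWord (f ∘ e) C := by
  rw [stdWord, ← map_flatMap_gates he, flatMap_word_map, stdWord]

variable {R : Type} [DecidableEq R]

/-- Emitting the cell of a standard gate, with given programs for the indices of the qubits. -/
def Prog.std (pr : ι → Prog (Option R)) : Std ι → Prog (Option R)
  | .h i => .seq (.emits [true, false]) (.seq (.seq (pr i) (.emit false)) (.emits hadamard.enc))
  | .t i => .seq (.emits [true, false]) (.seq (.seq (pr i) (.emit false)) (.emits tGate.enc))
  | .cx i j => if i ≠ j then .seq (.emits [true, true]) (.seq (.seq (pr i) (.emit false))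
      (.seq (.seq (pr j) (.emit false)) (.emits cnot.enc))) else .skip

/-- Emitting the cells of a list of standard gates. -/
def Prog.stds (pr : ι → Prog (Option R)) (C : List (Std ι)) : Prog (Option R) :=
  .seqs (C.map (Prog.std pr))

/-- The cell of a standard gate is a constant word except for the unary indices, so programs writing
these indices are all that is required. -/
theorem Trans.stds {N : ℕ} {S : R → List Bool} {pr : ι → Prog (Option R)} {f : ι → ℕ}
    (h : ∀ i, Trans N (pr i) S S (List.replicate (f i) true)) (C : List (Std ι)) :
    Trans N (.stds pr C) S S (stdWord f C) := by
  rw [stdWord, List.flatMap_assoc]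
  refine Trans.seqs fun g _ => ?_
  have hU : ∀ i, Trans N (.seq (pr i) (.emit false)) S S (encUnary (f i)) :=
    fun i => (h i).seq (.emit false)
  cases g with
  | h i =>
    rw [Std.gates, List.flatMap_singleton]
    exact (Trans.emits _).seq ((hU i).seq (.emits _))
  | t i =>
    rw [Std.gates, List.flatMap_singleton]
    exact (Trans.emits _).seq ((hU i).seq (.emits _))
  | cx i j =>
    rw [Std.gates, Prog.std]
    by_cases hij : i ≠ j
    · rw [dif_pos hij, if_pos hij, List.flatMap_singleton]
      exact (Trans.emits _).seq ((hU i).seq ((hU j).seq (.emits _)))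
    · rw [dif_neg hij, if_neg hij]
      exact .skip

end Words

end QOver

end

noncomputable section

namespace QOver

/-! ### The gates of a circuit with named qubits -/

section IsIn

variable {ι κ : Type}

/-- The gate belongs to the gate set. -/
def LGate.IsIn (G : GateSet) : LGate ι → Prop
  | .one _ U => U ∈ G.oneQubit
  | .two _ _ _ U => U ∈ G.twoQubit

theorem LGate.isIn_map {G : GateSet} {e : κ → ι} (he : Function.Injective e) {g : LGate κ} :
    (g.map e he).IsIn G ↔ g.IsIn G := by
  cases g <;> rfl

theorem isOver_map_toGate {G : GateSet} {n : ℕ} {C : List (LGate (Fin n))}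
    (h : ∀ g ∈ C, g.IsIn G) : Circuit.IsOver (C.map LGate.toGate) G := by
  intro g hg
  obtain ⟨g', hg', rfl⟩ := List.mem_map.1 hg
  have := h g' hg'
  cases g' <;> exact this

theorem Circuit.IsOver.toL {G : GateSet} {n : ℕ} {C : Circuit n} (h : C.IsOver G) :
    ∀ g ∈ C.map Gate.toL, g.IsIn G := by
  intro g hg
  obtain ⟨g', hg', rfl⟩ := List.mem_map.1 hg
  have := h g' hg'
  cases g' <;> exact this

theorem GateSet.ContainsCliffordT.isIn_gates {G : GateSet} (hG : G.ContainsCliffordT)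
    [DecidableEq ι] (C : List (Std ι)) : ∀ g ∈ C.flatMap Std.gates, g.IsIn G := by
  intro g hg
  obtain ⟨s, -, hg⟩ := List.mem_flatMap.1 hg
  cases s with
  | h i =>
    rw [Std.gates, List.mem_singleton] at hg
    subst hg
    exact hG.hadamard_mem
  | t i =>
    rw [Std.gates, List.mem_singleton] at hg
    subst hg
    exact hG.tGate_mem
  | cx i j =>
    rw [Std.gates] at hg
    split_ifs at hg
    · rw [List.mem_singleton] at hg
      subst hg
      exact hG.cnot_mem
    · simp at hg

end IsIn

/-! ### The output of a program -/

section Emitted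

variable {R : Type} [DecidableEq R]

/-- The word that a program emits, with its input in the register `r`. -/
def Prog.emitted (p : Prog (Option R)) (r : R) (x : List Bool) : List Bool :=
  (Prog.eval x.length p (Function.update (fun _ => []) (some r) x) none).reverse

theorem PolyTime.emitted [Fintype R] {f : List Bool → List Bool} (hf : PolyTime f)
    (p : Prog (Option R)) (r : R) : PolyTime fun x => p.emitted r (f x) :=
  hf.program p (some r) none

theorem Trans.emitted_eq {p : Prog (Option R)} {r : R} {x : List Bool} {S : R → List Bool}
    {w : List Bool} (h : Trans x.length p (Function.update (fun _ => []) r x) S w) :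
    p.emitted r x = w := by
  have h0 : (fun _ => [] : Option R → List Bool) = memory (fun _ => []) [] := by
    funext a
    cases a <;> rfl
  rw [Prog.emitted, h0, update_memory_some, h]
  simp

theorem Reads.emitted_eq {p : Prog (Option R)} {r : R} {x w : List Bool}
    (h : Reads x.length r (fun _ => []) p x w) : p.emitted r x = w := by
  have := h []
  rw [List.append_nil] at this
  exact (this le_rfl).emitted_eq

theorem Reads.of_trans {N : ℕ} {r : R} {S : R → List Bool} {p : Prog (Option R)} {w : List Bool}
    (h : ∀ t, Trans N p (Function.update S r t) (Function.update S r t) w) : Reads N r S p [] w :=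
  fun t _ => h t

end Emitted

/-! ### The reduction -/

section Reduction

/-- Emitting a number in unary: the length of the input. -/
def Prog.clock {R : Type} : Prog (Option R) := .loop none (.emit true)

theorem Trans.clock {R : Type} [DecidableEq R] {N : ℕ} {S : R → List Bool} :
    Trans N .clock S S (List.replicate N true) := by
  have := (Repeats.refl N (.emit true)).loop.const (Trans.emit (N := N) (S := S) true)
  rwa [mul_one] at this

/-- The gates that are added to a shifted circuit. -/
def finalStds : List (Std (Fin 2)) := .cx 1 0 :: xGate 0

/-- The program of the reduction. -/
def reductionProg : Prog (Option Unit) :=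
  .seq (.seq .clock (.emit false)) <|
  .seq (.emit false) <|
  .seq (.seq (.seq .clock (copyOnes ())) (.emits [true, false])) <|
  .seq (copyGates () .clock) <|
  .seq (.stds ![.skip, .clock] finalStds) <|
  .emits (false :: (encRat (2 / 5) ++ encRat (3 / 5)))

/-- The instance to which the description of a circuit is mapped. -/
def reductionInstance (n : ℕ) (Q : QCircuit) : OverInstance where
  n := n
  k := n + Q.qubits + 1
  le := by omega
  C := []
  D := (shiftedCircuit n Q.gates).map LGate.toGate
  a := 2 / 5
  b := 3 / 5

/-- Each part of the program writes one field of the instance. The number `n` is the length of the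
input, which a guardless loop can write in unary. -/
theorem emitted_reductionProg (Q : QCircuit) :
    reductionProg.emitted () Q.enc = (reductionInstance Q.enc.length Q).enc := by
  set N := Q.enc.length with hN
  have hN0 : 0 < N := by
    rw [hN, QCircuit.enc, encUnary]
    simp only [List.length_append, List.length_singleton]
    omega
  obtain ⟨q, C⟩ := Q
  have hclock : Reads N () (fun _ => []) .clock [] (List.replicate N true) :=
    .of_trans fun _ => .clock
  -- The two qubits of the final CNOT; they are distinct since `N` is positive.
  let e : Fin 2 → Fin (N + q + 1) := ![0, ⟨N, by omega⟩]
  have he : Function.Injective e := by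
    intro i j h
    have := congrArg Fin.val h
    fin_cases i <;> fin_cases j <;> simp [e] at this <;> first | rfl | omega
  have hstd : Reads N () (fun _ => []) (.stds ![.skip, .clock] finalStds) []
      (stdWord (Fin.val ∘ e) finalStds) := by
    refine .of_trans fun t => Trans.stds (fun i => ?_) _
    fin_cases i
    · exact .skip
    · exact .clock
  have h : Reads N () (fun _ => []) reductionProg (QCircuit.enc ⟨q, C⟩)
      ((List.replicate N true ++ [false]) ++ ([false] ++ (((List.replicate N true ++
        List.replicate q true) ++ [true, false]) ++ ((C.flatMap fun g => true :: g.encShift N) ++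
        (stdWord (Fin.val ∘ e) finalStds ++ (false :: (encRat (2 / 5) ++ encRat (3 / 5)))))))) := by
    have := (hclock.seq_emit (b := false)).seq ((Reads.emit false).seq
      (((hclock.seq (reads_copyOnes q)).seq (.of_trans fun _ => .emits [true, false])).seq
      ((reads_copyGates hclock C).seq (hstd.seq (.of_trans fun _ =>
        .emits (false :: (encRat (2 / 5) ++ encRat (3 / 5))))))))
    have hc : QCircuit.enc ⟨q, C⟩ =
        [] ++ ([] ++ ([] ++ encUnary q ++ [] ++ (encList Gate.enc C ++ ([] ++ [])))) := by
      simp only [QCircuit.enc, List.nil_append, List.append_nil]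
    rw [hc]
    exact this
  rw [Reads.emitted_eq h]
  have h1 : shiftedCircuit N C = (C.map Gate.toL).map
      (LGate.map (shiftFin N q) (shiftFin_injective N q)) ++
      (finalStds.map (Std.map e)).flatMap Std.gates := rfl
  rw [reductionInstance, OverInstance.enc, QCircuit.enc, QCircuit.enc]
  simp only
  rw [enc_mk_map_toGate, h1, List.flatMap_append, flatMap_word_map]
  change _ = (encUnary N ++ [false]) ++ (encUnary (N + q + 1) ++ ((_ ++ stdWord Fin.val _) ++ _) ++ _)
  rw [stdWord_map he, List.flatMap_map]
  have h2 : (C.flatMap fun g => true :: g.encShift N) =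
      C.flatMap fun g => g.toL.word (Fin.val ∘ shiftFin N q) := by
    congr 1
    funext g
    exact encShift_eq N g
  -- The last one before the terminator is the additional qubit.
  have h3 : encUnary (N + q + 1) =
      List.replicate N true ++ List.replicate q true ++ [true, false] := by
    rw [encUnary, List.replicate_add, List.replicate_add, List.append_assoc]
    rfl
  rw [h2, h3, encUnary]
  simp only [List.append_assoc, List.cons_append, List.nil_append]

/-- The length of the description exceeds both the number of qubits and the number of gates of `Q`.
The second circuit has at most seven gates more than `Q`, and a gap of 1/5 needs p(n) > 5. -/
theorem valid_reductionInstance {G : GateSet} (hG : G.ContainsCliffordT) {p : Polynomial ℕ}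
    (hp : ∀ n, (2 * Polynomial.X + 10 : Polynomial ℕ).eval n ≤ p.eval n) {Q : QCircuit}
    (hQ : Q.gates.IsOver G) : (reductionInstance Q.enc.length Q).Valid G p := by
  have hlen : Q.enc.length = Q.qubits + 1 + (encList Gate.enc Q.gates).length := by
    simp only [QCircuit.enc, encUnary, List.length_append, List.length_replicate,
      List.length_singleton]
  have hlen' := Reads.length_le_length_encList Gate.enc Q.gates
  have hp' := hp Q.enc.length
  simp only [Polynomial.eval_add, Polynomial.eval_mul, Polynomial.eval_ofNat,
    Polynomial.eval_X] at hp'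
  refine ⟨fun g hg => absurd hg List.not_mem_nil, isOver_map_toGate ?_,
    by simp [reductionInstance], ?_, ?_, ?_, ?_, ?_, ?_, ?_⟩
  · intro g hg
    rcases List.mem_append.1 hg with hg | hg
    · obtain ⟨g', hg', rfl⟩ := List.mem_map.1 hg
      exact (LGate.isIn_map _).2 (hQ.toL g' hg')
    · exact hG.isIn_gates _ g hg
  · simp only [reductionInstance]
    omega
  · simp only [reductionInstance, shiftedCircuit, List.length_map, List.length_append]
    have : ∀ (m : ℕ) (a b : Fin (m + 1)), ((Std.cx a b :: xGate b).flatMap Std.gates).length ≤ 7 := by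
      intro m a b
      by_cases hab : a = b <;> simp [xGate, tPow, Std.gates, hab]
    have := this _ ⟨Q.enc.length, by omega⟩ (0 : Fin (Q.enc.length + Q.qubits + 1))
    omega
  all_goals simp only [reductionInstance]
  · norm_num
  · norm_num
  · norm_num
  · norm_num
  · have : (10 : ℚ) ≤ (p.eval Q.enc.length : ℕ) := by
      exact_mod_cast (show 10 ≤ p.eval Q.enc.length by omega)
    linarith

theorem promiseBQPHard {G : GateSet} (hG : G.ContainsCliffordT) {p : Polynomial ℕ}
    (hp : ∀ n, (2 * Polynomial.X + 10 : Polynomial ℕ).eval n ≤ p.eval n) :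
    PromiseBQPHard G (approxQCircuitOver G p) := by
  rintro A ⟨f, hf, hyes, hno⟩
  have hval : ∀ Q : QCircuit, (reductionInstance Q.enc.length Q).value = Q.acceptProb := by
    intro Q
    refine overlap_shiftedCircuit (n := Q.enc.length) ?_ _
    rw [QCircuit.enc, encUnary]
    simp only [List.length_append, List.length_singleton]
    omega
  refine ⟨_, hf.emitted reductionProg (), fun x hx => ?_, fun x hx => ?_⟩
  · obtain ⟨Q, hQ, hfx, hacc⟩ := hyes x hx
    refine ⟨reductionInstance Q.enc.length Q, ?_, valid_reductionInstance hG hp hQ, ?_⟩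
    · simp only [hfx, emitted_reductionProg]
    · rw [hval]
      simp only [reductionInstance]
      push_cast
      linarith
  · obtain ⟨Q, hQ, hfx, hacc⟩ := hno x hx
    refine ⟨reductionInstance Q.enc.length Q, ?_, valid_reductionInstance hG hp hQ, ?_⟩
    · simp only [hfx, emitted_reductionProg]
    · rw [hval]
      simp only [reductionInstance]
      push_cast
      linarith

end Reduction

end QOver

end

/-! ### The program that writes the decision circuit. -/

noncomputable section

namespace QOver

/-! ### Moving the contents of registers -/

section Routines

variable {R : Type} [DecidableEq R] {N : ℕ}

theorem Trans.congr {p : Prog (Option R)} {S S' T T' : R → List Bool} {w w' : List Bool}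
    (h : Trans N p S S' w) (hS : S = T) (hS' : S' = T') (hw : w = w') : Trans N p T T' w' := by
  subst hS hS' hw
  exact h

/-- Pushing a bit on several registers. -/
def Prog.pushes (as : List R) (b : Bool) : Prog (Option R) :=
  .seqs (as.map fun a => .push (some a) b)

theorem Trans.pushes {as : List R} (h : as.Nodup) (b : Bool) (S : R → List Bool) :
    Trans N (.pushes as b) S (fun a => if a ∈ as then b :: S a else S a) [] := by
  induction as generalizing S with
  | nil => exact Trans.skip.congr rfl (by simp) rfl
  | cons a as ih =>
    rw [List.nodup_cons] at h
    refine ((Trans.push a b).seq (ih h.2 (Function.update S a (b :: S a)))).congr rfl ?_ rfl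
    funext a'
    by_cases ha : a' = a
    · subst ha
      simp [h.1]
    · simp [ha]

/-- Moving the contents of a register to other registers, in reverse. -/
def Prog.drain (e : ℕ) (r : R) (as : List R) : Prog (Option R) :=
  .iter e (.popCase (some r) (.pushes as true) (.pushes as false) .skip)

/-- After `i` rounds the first `i` bits have moved; once the register is empty, the remaining rounds
are idle. -/
theorem Trans.drain {e : ℕ} {r : R} {as : List R} (h : as.Nodup) (hr : r ∉ as) {S : R → List Bool}
    (hS : (S r).length ≤ N ^ e) :
    Trans N (.drain e r as) S
      (fun a => if a = r then [] else if a ∈ as then (S r).reverse ++ S a else S a) [] := by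
  have key := Repeats.iter N (.popCase (some r) (.pushes as true) (.pushes as false) .skip) e
    (fun i a => if a = r then (S r).drop i else if a ∈ as then ((S r).take i).reverse ++ S a else S a)
    (fun _ => []) fun i _ => ?_
  · rw [flatMap_const_nil, List.take_of_length_le hS, List.drop_of_length_le hS] at key
    refine key.congr ?_ rfl rfl
    funext a
    by_cases ha : a = r
    · subst ha; simp
    · simp [ha]
  · rcases lt_or_ge i (S r).length with hi | hi
    · refine Trans.popCase ((S r).drop (i + 1)) (S r)[i] (by simp) ?_
      have := Trans.pushes (N := N) h (S r)[i] (Function.update (fun a => if a = r then (S r).drop i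
        else if a ∈ as then ((S r).take i).reverse ++ S a else S a) r ((S r).drop (i + 1)))
      have hb : ∀ b, (bif b then Prog.pushes as true else Prog.pushes as false) =
          Prog.pushes as b := by
        intro b; cases b <;> rfl
      rw [hb]
      refine this.congr rfl ?_ rfl
      funext a
      by_cases ha : a = r
      · subst ha
        simp [hr]
      · by_cases ha' : a ∈ as
        · simp only [ha, ha', if_true, if_false, Function.update_of_ne, ne_eq, not_false_eq_true]
          rw [← List.take_append_getElem hi, List.reverse_append]
          rfl
        · simp [ha, ha']
    · refine Trans.popCase_nil (by simp [hi]) ?_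
      rw [List.drop_of_length_le hi, List.drop_of_length_le (by omega),
        List.take_of_length_le hi, List.take_of_length_le (by omega)]
      exact .skip

/-- Emitting a number in unary that is in a register, by means of an empty register. -/
def Prog.emitReg (e : ℕ) (tmp r : R) : Prog (Option R) :=
  .seq (.iter e (.popCase (some r) (.seq (.emit true) (.push (some tmp) true)) .skip .skip))
    (.drain e tmp [r])

/-- Reading a register destroys it, so its contents are saved in `tmp` and moved back afterwards.
The reversals are harmless as all bits are equal. -/
theorem Trans.emitReg {e : ℕ} {tmp r : R} (hne : r ≠ tmp) {S : R → List Bool} (ht : S tmp = [])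
    {m : ℕ} (hr : S r = List.replicate m true) (hm : m ≤ N ^ e) :
    Trans N (.emitReg e tmp r) S S (List.replicate m true) := by
  have key := Repeats.iter N (.popCase (some r) (.seq (.emit true) (.push (some tmp) true))
    .skip .skip) e (fun i a => if a = r then List.replicate (m - i) true
      else if a = tmp then List.replicate (min i m) true else S a)
    (fun i => if i < m then [true] else []) fun i _ => ?_
  · have hw : ∀ k, ((List.range k).flatMap fun i => if i < m then [true] else []) =
        List.replicate (min k m) true := by
      intro k
      induction k with
      | zero => simp
      | succ k ih =>
        rw [List.range_succ, List.flatMap_append, ih, List.flatMap_singleton]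
        split_ifs with h
        · rw [min_eq_left h.le, min_eq_left h, List.replicate_succ']
        · rw [min_eq_right (by omega), min_eq_right (by omega), List.append_nil]
    rw [hw, min_eq_right hm] at key
    have h2 := Trans.drain (N := N) (e := e) (r := tmp) (as := [r]) (by simp)
      (by simpa using hne.symm) (S := fun a => if a = r then List.replicate (m - N ^ e) true
      else if a = tmp then List.replicate m true else S a) (by simpa [hne.symm] using hm)
    refine (key.seq h2).congr ?_ ?_ ?_
    · funext a
      by_cases ha : a = r
      · subst ha
        simp [hr]
      · by_cases ha' : a = tmp
        · subst ha'
          simp [ha, ht]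
        · simp [ha, ha']
    · funext a
      by_cases ha : a = r
      · subst ha
        simp [hne, hne.symm, hr, show m - N ^ e = 0 by omega]
      · by_cases ha' : a = tmp
        · subst ha'
          simp [ht]
        · simp [ha, ha']
    · simp
  · by_cases hi : i < m
    · refine Trans.popCase (List.replicate (m - (i + 1)) true) true ?_ ?_
      · rw [if_pos rfl, show m - i = m - (i + 1) + 1 by omega, List.replicate_succ]
      · rw [if_pos hi, cond_true]
        refine ((Trans.emit true).seq (Trans.push tmp true)).congr rfl ?_ rfl
        funext a
        by_cases ha : a = r
        · subst ha
          simp [hne]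
        · by_cases ha' : a = tmp
          · subst ha'
            simp [ha, min_eq_left hi.le, min_eq_left (show i + 1 ≤ m from hi),
              List.replicate_succ]
          · simp [ha, ha']
    · refine Trans.popCase_nil (by simp; omega) ?_
      rw [if_neg hi, show m - i = 0 by omega, show m - (i + 1) = 0 by omega,
        min_eq_right (by omega), min_eq_right (by omega)]
      exact .skip

/-- Running a program for every one of a number in unary. -/
theorem Trans.scanUnary {r : R} {p : Prog (Option R)} {n : ℕ} (hn : n < N)
    (S : ℕ → R → List Bool) (w : ℕ → List Bool) (t : List Bool)
    (h : ∀ i < n, ∀ t, Trans N p (Function.update (S i) r t) (Function.update (S (i + 1)) r t)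
      (w i)) :
    Trans N (.loop (some (some r)) p) (Function.update (S 0) r (encUnary n ++ t))
      (Function.update (S n) r t) ((List.range n).flatMap w) := by
  intro o
  rw [Prog.eval]
  have key : ∀ (m n : ℕ), n < m → ∀ (S : ℕ → R → List Bool) (w : ℕ → List Bool) (o : List Bool),
      (∀ i < n, ∀ t, Trans N p (Function.update (S i) r t) (Function.update (S (i + 1)) r t)
        (w i)) →
      Prog.rounds (some (some r)) (Prog.eval N p) m
        (memory (Function.update (S 0) r (encUnary n ++ t)) o) =
      memory (Function.update (S n) r t) (((List.range n).flatMap w).reverse ++ o) := by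
    intro m
    induction m with
    | zero => intro n hn; omega
    | succ m ih =>
      intro n hn S w o h
      cases n with
      | zero => simp [Prog.rounds, Prog.test, encUnary]
      | succ n =>
        have h1 := h 0 (by omega) (encUnary n ++ t) o
        have h2 := ih n (by omega) (fun i => S (i + 1)) (fun i => w (i + 1)) ((w 0).reverse ++ o)
          fun i hi => h (i + 1) (by omega)
        have h3 : encUnary (n + 1) = true :: encUnary n := rfl
        rw [Prog.rounds]
        simp only [Prog.test, h3, memory_some, Function.update_self, List.cons_append,
          List.head?_cons, beq_self_eq_true, cond_true, List.tail_cons, update_memory_some,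
          Function.update_idem, h1]
        refine h2.trans ?_
        rw [List.range_succ_eq_map, List.flatMap_cons, List.flatMap_map, List.reverse_append,
          List.append_assoc]
  exact key N n hn S w o h

/-- Reading a bit, which is `false` if the register is empty. -/
def Prog.popBit (r : R) (k : Bool → Prog (Option R)) : Prog (Option R) :=
  .popCase (some r) (k true) (k false) (k false)

theorem Trans.popBit {r : R} {k : Bool → Prog (Option R)} {S S' : R → List Bool} {w : List Bool}
    (h : Trans N (k ((S r).headD false)) (Function.update S r (S r).tail) S' w) :
    Trans N (.popBit r k) S S' w := by
  cases hr : S r with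
  | nil =>
    rw [hr] at h
    refine Trans.popCase_nil hr ?_
    refine h.congr ?_ rfl rfl
    rw [List.tail_nil, ← hr, Function.update_eq_self]
  | cons b t =>
    rw [hr] at h
    refine Trans.popCase t b hr ?_
    cases b <;> exact h

end Routines

end QOver

end

noncomputable section

namespace QOver

/-! ### The program that writes the rounds of swap tests -/

/-- Registers: the input, its unread part, auxiliary registers, and numbers in unary and in
binary. -/
inductive Reg : Type
  | sav | inp | tmp | base | idx | cnt | num | den | acc | numCopy | denCopy | sum | dif | cy | bo
  deriving DecidableEq

instance : Fintype Reg :=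
  Fintype.ofList [.sav, .inp, .tmp, .base, .idx, .cnt, .num, .den, .acc, .numCopy, .denCopy, .sum,
    .dif, .cy, .bo] fun r => by cases r <;> simp

/-- The contents of the registers between the steps of the program. -/
def main (x t : List Bool) (P I : ℕ) (u nm dn ac : List Bool) : Reg → List Bool
  | .sav => x
  | .inp => t
  | .base => List.replicate P true
  | .idx => List.replicate I true
  | .cnt => u
  | .num => nm
  | .den => dn
  | .acc => ac
  | _ => []

section Main

variable {N : ℕ} (x t : List Bool) (P I : ℕ) (u nm dn ac : List Bool)

theorem update_main_inp (t' : List Bool) :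
    Function.update (main x t P I u nm dn ac) .inp t' = main x t' P I u nm dn ac := by
  funext r
  cases r <;> simp [main]

theorem update_main_cnt (u' : List Bool) :
    Function.update (main x t P I u nm dn ac) .cnt u' = main x t P I u' nm dn ac := by
  funext r
  cases r <;> simp [main]

theorem trans_push_cnt (b : Bool) : Trans N (.push (some .cnt) b)
    (main x t P I u nm dn ac) (main x t P I (b :: u) nm dn ac) [] :=
  (Trans.push _ b).congr rfl (update_main_cnt x t P I u nm dn ac _) rfl

theorem trans_push_idx : Trans N (.push (some .idx) true)
    (main x t P I u nm dn ac) (main x t P (I + 1) u nm dn ac) [] :=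
  (Trans.push _ true).congr rfl
    (by funext r; cases r <;> simp [main, List.replicate_succ]) rfl

theorem trans_push_base : Trans N (.push (some .base) true)
    (main x t P I u nm dn ac) (main x t (P + 1) I u nm dn ac) [] :=
  (Trans.push _ true).congr rfl
    (by funext r; cases r <;> simp [main, List.replicate_succ]) rfl

theorem Repeats.push_base {q : Prog (Option Reg)} {m : ℕ}
    (h : Repeats N (.push (some .base) true) q m) :
    Trans N q (main x t P I u nm dn ac) (main x t (P + m) I u nm dn ac) [] :=
  (h (fun i => main x t (P + i) I u nm dn ac) (fun _ => []) fun i _ =>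
    trans_push_base x t (P + i) I u nm dn ac).congr rfl rfl (flatMap_const_nil _)

/-- Restoring the unread part of the input. -/
def reload : Prog (Option Reg) :=
  .seq (.drain 1 .inp []) (.seq (.drain 1 .sav [.tmp]) (.drain 1 .tmp [.sav, .inp]))

/-- The saved input goes to `tmp` and from there to both registers, so it survives for the next
round and is reversed twice. -/
theorem trans_reload (hx : x.length ≤ N) (ht : t.length ≤ N) :
    Trans N reload (main x t P I u nm dn ac) (main x x P I u nm dn ac) [] := by
  rw [← pow_one N] at hx ht
  refine ((Trans.drain (by simp) (by simp) ht).seq ((Trans.drain (by simp) (by simp)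
    (by simpa [main] using hx)).seq (Trans.drain (by simp) (by simp)
    (by simpa [main] using hx)))).congr rfl ?_ rfl
  funext r
  cases r <;> simp [main]

/-- Clearing the index. -/
def clearIdx (E : ℕ) : Prog (Option Reg) := .drain E .idx []

theorem trans_clearIdx {E : ℕ} (hI : I ≤ N ^ E) :
    Trans N (clearIdx E) (main x t P I u nm dn ac) (main x t P 0 u nm dn ac) [] := by
  refine (Trans.drain (by simp) (by simp) (by simpa [main] using hI)).congr rfl ?_ rfl
  funext r
  cases r <;> simp [main]

def emitBase (E : ℕ) : Prog (Option Reg) := .emitReg E .tmp .base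

def emitIdx (E : ℕ) : Prog (Option Reg) := .emitReg E .tmp .idx

variable {P I} in
theorem trans_emitBase {E : ℕ} (hP : P ≤ N ^ E) : Trans N (emitBase E)
    (main x t P I u nm dn ac) (main x t P I u nm dn ac) (List.replicate P true) :=
  Trans.emitReg (by simp) rfl rfl hP

variable {P I} in
theorem trans_emitIdx {E : ℕ} (hI : I ≤ N ^ E) : Trans N (emitIdx E)
    (main x t P I u nm dn ac) (main x t P I u nm dn ac) (List.replicate I true) :=
  Trans.emitReg (by simp) rfl rfl hI

/-- The programs for the indices of the qubits of a controlled swap in a swap test. -/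
def swapProgs (E : ℕ) : Fin 3 → Prog (Option Reg) :=
  ![.seq (emitBase E) (.seq .clock .clock), .seq (emitBase E) (emitIdx E),
    .seq (emitBase E) (.seq .clock (emitIdx E))]

/-- The programs for the indices of the qubits of a controlled swap in the counter. -/
def countProgs (E : ℕ) : Fin 3 → Prog (Option Reg) :=
  ![.seq (emitBase E) (.seq .clock .clock), .seq (.emit true) (emitIdx E),
    .seq (.emits [true, true]) (emitIdx E)]

variable {P I} in
theorem trans_swapStds {E : ℕ} (hP : P ≤ N ^ E) (hI : I ≤ N ^ E) (C : List (Std (Fin 3))) :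
    Trans N (.stds (swapProgs E) C) (main x t P I u nm dn ac) (main x t P I u nm dn ac)
      (stdWord ![P + (N + N), P + I, P + (N + I)] C) := by
  refine Trans.stds (fun i => ?_) C
  fin_cases i
  · exact ((trans_emitBase _ _ _ _ _ _ hP).seq (Trans.clock.seq .clock)).congr rfl rfl
      (by simp only [List.replicate_append_replicate]; rfl)
  · exact ((trans_emitBase _ _ _ _ _ _ hP).seq (trans_emitIdx _ _ _ _ _ _ hI)).congr rfl rfl
      (by simp only [List.replicate_append_replicate]; rfl)
  · exact ((trans_emitBase _ _ _ _ _ _ hP).seq (Trans.clock.seq (trans_emitIdx _ _ _ _ _ _ hI))).congr rfl rfl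
      (by simp only [List.replicate_append_replicate]; rfl)

variable {P I} in
theorem trans_countStds {E : ℕ} (hP : P ≤ N ^ E) (hI : I ≤ N ^ E) (C : List (Std (Fin 3))) :
    Trans N (.stds (countProgs E) C) (main x t P I u nm dn ac) (main x t P I u nm dn ac)
      (stdWord ![P + (N + N), 1 + I, 1 + (1 + I)] C) := by
  have h1 : List.replicate 1 true = [true] := rfl
  have h2 : List.replicate 2 true = [true, true] := rfl
  refine Trans.stds (fun i => ?_) C
  fin_cases i
  · exact ((trans_emitBase _ _ _ _ _ _ hP).seq (Trans.clock.seq .clock)).congr rfl rfl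
      (by simp only [List.replicate_append_replicate]; rfl)
  · exact ((Trans.emit true).seq (trans_emitIdx _ _ _ _ _ _ hI)).congr rfl rfl
      (by rw [← h1, List.replicate_append_replicate]; rfl)
  · exact ((Trans.emits [true, true]).seq (trans_emitIdx _ _ _ _ _ _ hI)).congr rfl rfl
      (by rw [← h2, List.replicate_append_replicate, show 2 + I = 1 + (1 + I) by omega]; rfl)

/-- One swap test, after which the counter is moved. -/
def roundProg (e E : ℕ) : Prog (Option Reg) :=
  .seq reload <|
  .seq (.seq (.push (some .cnt) false) (.loop (some (some .inp)) (.push (some .cnt) true))) <|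
  .seq (copyGates .inp (emitBase E)) <|
  .seq (skipUnary .inp) <|
  .seq (copyGates .inp (.seq (emitBase E) .clock)) <|
  .seq (.stds (swapProgs E) [.h 0]) <|
  .seq (.loop (some (some .cnt))
    (.seq (.stds (swapProgs E) (cswap 0 1 2)) (.push (some .idx) true))) <|
  .seq (.stds (swapProgs E) (tPow 0 4 ++ [.h 0])) <|
  .seq (clearIdx E) <|
  .seq (.iter₄ e (.seq (.stds (countProgs E) (cswap 0 1 2)) (.push (some .idx) true))) <|
  .seq (clearIdx E) <|
  .seq (.seq (.iter 1 (.push (some .base) true)) (.iter 1 (.push (some .base) true)))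
    (.push (some .base) true)

/-- The cells of the gates of a round, for circuits on `n` and `k` qubits and a counter with `R + 1`
positions. -/
def roundWord {n k : ℕ} (C : Circuit n) (D : Circuit k) (N R P : ℕ) : List Bool :=
  (C.flatMap fun g => g.toL.word fun i : Fin n => P + i.1) ++
  (D.flatMap fun g => g.toL.word fun j : Fin k => P + N + j.1) ++
  stdWord ![P + (N + N), P + 0, P + (N + 0)] [.h 0] ++
  ((List.range n).flatMap fun i => stdWord ![P + (N + N), P + i, P + (N + i)] (cswap 0 1 2)) ++
  stdWord ![P + (N + N), P + n, P + (N + n)] (tPow 0 4 ++ [.h 0]) ++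
  (List.range R).flatMap fun i => stdWord ![P + (N + N), 1 + i, 1 + (1 + i)] (cswap 0 1 2)

variable {P} in
-- The block of a round starts at `P` and has the fixed width 2N + 1, with `N` places for each
-- circuit and one for the control. As `N` exceeds the numbers of qubits, these offsets can be
-- written from the clock instead of being computed.
theorem trans_roundProg (A : OverInstance) (hx : x = A.enc) (hN : N = x.length)
    (ht : t.length ≤ N) {e E : ℕ} (hP : P ≤ N ^ E) (he : 4 * N ^ e ≤ N ^ E) (hE : E ≠ 0) :
    Trans N (roundProg e E) (main x t P 0 [] [] [] [])
      (main x (encRat A.a ++ encRat A.b) (P + (N + N + 1)) 0 [] [] [] [])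
      (roundWord A.C A.D N (4 * N ^ e) P) := by
  obtain ⟨n, k, hle, C, D, a, b⟩ := A
  set rats := encRat a ++ encRat b
  have hx' : x = encUnary n ++ (encList Gate.enc C ++ (encUnary k ++ (encList Gate.enc D ++ rats))) := by
    rw [hx, OverInstance.enc, QCircuit.enc, QCircuit.enc]
    simp only [List.append_assoc]
    rfl
  have hlen : N = n + 1 + ((encList Gate.enc C).length + (k + 1 + ((encList Gate.enc D).length +
      rats.length))) := by
    rw [hN, hx']
    simp only [List.length_append, encUnary, List.length_replicate, List.length_singleton]
  have hNE : N ≤ N ^ E := Nat.le_self_pow hE N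
  have h1 := trans_reload (N := N) x t P 0 [] [] [] [] hN.ge ht
  have h2 := trans_push_cnt (N := N) x x P 0 [] [] [] [] false
  -- The number `n` is copied together with its terminator, which was pushed first, so that it can
  -- guard the loop over the controlled swaps.
  have h3 : Trans N (.loop (some (some .inp)) (.push (some .cnt) true))
      (main x x P 0 [false] [] [] [])
      (main x (encList Gate.enc C ++ (encUnary k ++ (encList Gate.enc D ++ rats))) P 0 (encUnary n)
        [] [] []) [] := by
    refine (Trans.scanUnary (n := n) (by omega) (fun i => main x [] P 0 (encUnary i) [] [] [])
      (fun _ => []) (encList Gate.enc C ++ (encUnary k ++ (encList Gate.enc D ++ rats)))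
      fun i _ t => ?_).congr ?_ ?_ (flatMap_const_nil _)
    · rw [update_main_inp, update_main_inp]
      exact trans_push_cnt _ _ _ _ _ _ _ _ _
    · rw [update_main_inp, ← hx']
      rfl
    · rw [update_main_inp]
  have hb : ∀ u, Reads N .inp (main x [] P 0 u [] [] []) (emitBase E) [] (List.replicate P true) := by
    refine fun u => .of_trans fun t => ?_
    rw [update_main_inp]
    exact trans_emitBase _ _ _ _ _ _ hP
  have h4 := reads_copyGates (hb (encUnary n)) C (encUnary k ++ (encList Gate.enc D ++ rats)) (by
    simp only [List.length_append, encUnary, List.length_replicate, List.length_singleton]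
    omega)
  have h5 := reads_skipUnary (N := N) (r := .inp) (S := main x [] P 0 (encUnary n) [] [] []) k
    (encList Gate.enc D ++ rats) (by
      simp only [List.length_append, encUnary, List.length_replicate, List.length_singleton]
      omega)
  have h6 := reads_copyGates (m := P + N) (pre := .seq (emitBase E) .clock) (by
    rw [List.replicate_add]
    exact (hb (encUnary n)).seq (.of_trans fun _ => .clock)) D rats (by
      simp only [List.length_append]
      omega)
  rw [update_main_inp, update_main_inp] at h4 h5 h6
  have h7 := trans_swapStds x rats (encUnary n) [] [] [] hP (Nat.zero_le (N ^ E)) [.h 0]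
  have h8 : Trans N (.loop (some (some .cnt))
      (.seq (.stds (swapProgs E) (cswap 0 1 2)) (.push (some .idx) true)))
      (main x rats P 0 (encUnary n) [] [] []) (main x rats P n [] [] [] [])
      ((List.range n).flatMap fun i =>
        stdWord ![P + (N + N), P + i, P + (N + i)] (cswap 0 1 2)) := by
    refine (Trans.scanUnary (n := n) (by omega) (fun i => main x rats P i [] [] [] [])
      (fun i => stdWord ![P + (N + N), P + i, P + (N + i)] (cswap 0 1 2)) [] fun i hi t => ?_).congr
      ?_ ?_ rfl
    · rw [update_main_cnt, update_main_cnt]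
      exact ((trans_swapStds _ _ _ _ _ _ hP (by omega) _).seq
        (trans_push_idx _ _ _ _ _ _ _ _)).congr rfl rfl (List.append_nil _)
    · rw [update_main_cnt, List.append_nil]
    · rw [update_main_cnt]
  have h9 := trans_swapStds (I := n) x rats [] [] [] [] hP (by omega) (tPow 0 4 ++ [.h 0])
  have h10 := trans_clearIdx (N := N) (E := E) x rats P n [] [] [] [] (by omega)
  have h11 := Repeats.iter₄ N (.seq (.stds (countProgs E) (cswap 0 1 2)) (.push (some .idx) true)) e
    -- The register `idx` serves as the loop variable, here for the positions of the counter.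
    (fun i => main x rats P i [] [] [] [])
    (fun i => stdWord ![P + (N + N), 1 + i, 1 + (1 + i)] (cswap 0 1 2)) fun i hi =>
      ((trans_countStds _ _ _ _ _ _ hP (by omega) _).seq
        (trans_push_idx _ _ _ _ _ _ _ _)).congr rfl rfl (List.append_nil _)
  have h12 := trans_clearIdx (N := N) (E := E) x rats P (4 * N ^ e) [] [] [] [] he
  have h13 := (((Repeats.iter N (.push (some Reg.base) true) 1).push_base x rats P 0 [] [] [] []).seq
    ((Repeats.iter N (.push (some Reg.base) true) 1).push_base x rats (P + N ^ 1) 0 [] [] [] [])).seq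
    (trans_push_base _ _ _ _ _ _ _ _)
  refine (h1.seq ((h2.seq h3).seq (h4.seq (h5.seq (h6.seq (h7.seq (h8.seq (h9.seq (h10.seq
    (h11.seq (h12.seq h13))))))))))).congr rfl ?_ ?_
  · rw [pow_one, Nat.add_assoc, Nat.add_assoc, Nat.add_assoc]
  · simp only [roundWord, List.nil_append, List.append_nil, List.append_assoc]
    simp only [encShift_eq]

end Main

end QOver

end

noncomputable section

namespace QOver

/-! ### Binary arithmetic -/

section Bits

/-- A binary digit of an integer. -/
def ibit (v : ℤ) (i : ℕ) : Bool := decide (v / 2 ^ i % 2 = 1)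

/-- The lowest `N` binary digits of an integer. -/
def bits (N : ℕ) (v : ℤ) : List Bool := (List.range N).map (ibit v)

@[simp] theorem length_bits (N : ℕ) (v : ℤ) : (bits N v).length = N := by simp [bits]

theorem drop_bits {N i : ℕ} (hi : i < N) (v : ℤ) :
    (bits N v).drop i = ibit v i :: (bits N v).drop (i + 1) := by
  rw [List.drop_eq_getElem_cons (by simpa using hi)]
  simp [bits]

theorem take_bits {N i : ℕ} (hi : i < N) (v : ℤ) :
    ((bits N v).take (i + 1)).reverse = ibit v i :: ((bits N v).take i).reverse := by
  rw [← List.take_append_getElem (by simpa using hi), List.reverse_append]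
  simp [bits]

/-- The number with the given binary digits, the lowest one first. -/
def bitsVal : List Bool → ℕ
  | [] => 0
  | b :: l => b.toNat + 2 * bitsVal l

theorem bitsVal_lt (l : List Bool) : bitsVal l < 2 ^ l.length := by
  induction l with
  | nil => simp [bitsVal]
  | cons b l ih =>
    have := Bool.toNat_le b
    simp only [bitsVal, List.length_cons, pow_succ]
    omega

theorem ibit_bitsVal (l : List Bool) (i : ℕ) : (l.drop i).headD false = ibit (bitsVal l) i := by
  induction l generalizing i with
  | nil => simp [bitsVal, ibit]
  | cons b l ih =>
    cases i with
    | zero =>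
      cases b <;> simp [bitsVal, ibit]
    | succ i =>
      rw [List.drop_succ_cons, ih, ibit, ibit, pow_succ', ← Int.ediv_ediv_of_nonneg (by norm_num)]
      have : ((bitsVal (b :: l) : ℕ) : ℤ) / 2 = bitsVal l := by
        cases b <;> simp only [bitsVal, Bool.toNat_true, Bool.toNat_false] <;> omega
      rw [this]

theorem bitsVal_encodeNat (v : ℕ) : bitsVal (Computability.encodeNat v) = v := by
  have h : ∀ p : PosNum, bitsVal (Computability.encodePosNum p) = p := by
    intro p
    induction p with
    | one => rfl
    | bit0 p ih =>
      rw [Computability.encodePosNum, bitsVal, ih, PosNum.cast_bit0]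
      simp only [Bool.toNat_false]
      omega
    | bit1 p ih =>
      rw [Computability.encodePosNum, bitsVal, ih, PosNum.cast_bit1]
      simp only [Bool.toNat_true]
      omega
  rw [Computability.encodeNat]
  have h2 : ((v : Num) : ℕ) = v := Num.to_of_nat v
  cases hv : (v : Num) with
  | zero =>
    rw [hv] at h2
    rw [Computability.encodeNum, bitsVal, ← h2]
    rfl
  | pos p =>
    rw [hv] at h2
    rw [Computability.encodeNum, h, ← h2]
    rfl

theorem length_encBits (l : List Bool) : (encBits l).length = 2 * l.length + 1 := by
  induction l with
  | nil => rfl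
  | cons b l ih => simp only [encBits, List.length_cons, ih]; omega

/-- The carry of an addition. -/
theorem carry_cases (A B : ℤ) (i : ℕ) :
    (A + B) / 2 ^ i - A / 2 ^ i - B / 2 ^ i = 0 ∨ (A + B) / 2 ^ i - A / 2 ^ i - B / 2 ^ i = 1 := by
  have hp : (0 : ℤ) < 2 ^ i := by positivity
  have h1 := Int.emod_add_mul_ediv A (2 ^ i)
  have h2 := Int.emod_add_mul_ediv B (2 ^ i)
  have h3 := Int.emod_nonneg A hp.ne'
  have h4 := Int.emod_nonneg B hp.ne'
  have h5 := Int.emod_lt_of_pos A hp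
  have h6 := Int.emod_lt_of_pos B hp
  have h7 : A + B = (A % 2 ^ i + B % 2 ^ i) + 2 ^ i * (A / 2 ^ i + B / 2 ^ i) := by
    rw [mul_add]; linarith
  rw [h7, Int.add_mul_ediv_left _ _ hp.ne']
  have h8 : 0 ≤ (A % 2 ^ i + B % 2 ^ i) / 2 ^ i := Int.ediv_nonneg (by omega) hp.le
  have h9 : (A % 2 ^ i + B % 2 ^ i) / 2 ^ i < 2 := Int.ediv_lt_of_lt_mul hp (by omega)
  omega

end Bits

/-! ### Multiples of a rational number -/

/-- The contents of the registers while the bits of numbers are added. -/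
def adding (x t : List Bool) (P I : ℕ) (nm dn ac nc dc sm df cy bo : List Bool) :
    Reg → List Bool
  | .sav => x
  | .inp => t
  | .base => List.replicate P true
  | .idx => List.replicate I true
  | .num => nm
  | .den => dn
  | .acc => ac
  | .numCopy => nc
  | .denCopy => dc
  | .sum => sm
  | .dif => df
  | .cy => cy
  | .bo => bo
  | _ => []

/-- Adding the next bits of the registers `acc` and `num`, and subtracting that of `den`. -/
def addBit : Prog (Option Reg) :=
  .popBit .cy fun c => .popBit .bo fun b => .popBit .acc fun a => .popBit .num fun y =>
  .popBit .den fun z =>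
    .seq (.push (some .numCopy) y) <|
    .seq (.push (some .denCopy) z) <|
    .seq (.push (some .sum) ((a ^^ y) ^^ c)) <|
    .seq (.push (some .dif) ((((a ^^ y) ^^ c) ^^ z) ^^ b)) <|
    .seq (.push (some .cy) ((a && y) || (c && (a || y))))
      (.push (some .bo) ((!((a ^^ y) ^^ c) && (z || b)) || (z && b)))

section Arithmetic

variable {N : ℕ} (x t : List Bool) (P I : ℕ)

theorem trans_addBit (nm dn ac nc dc sm df : List Bool) (c b a y z : Bool) :
    Trans N addBit
      (adding x t P I (y :: nm) (z :: dn) (a :: ac) nc dc sm df [c] [b])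
      (adding x t P I nm dn ac (y :: nc) (z :: dc) (((a ^^ y) ^^ c) :: sm)
        (((((a ^^ y) ^^ c) ^^ z) ^^ b) :: df) [(a && y) || (c && (a || y))]
        [(!((a ^^ y) ^^ c) && (z || b)) || (z && b)]) [] := by
  refine Trans.popBit (Trans.popBit (Trans.popBit (Trans.popBit (Trans.popBit ?_))))
  refine ((Trans.push _ _).seq ((Trans.push _ _).seq ((Trans.push _ _).seq ((Trans.push _ _).seq
    ((Trans.push _ _).seq (Trans.push _ _)))))).congr rfl ?_ rfl
  funext r
  cases r <;> simp [adding]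

/-- The registers after adding the lowest `i` bits. -/
def addingAt (N : ℕ) (A B Z : ℤ) (i : ℕ) : Reg → List Bool :=
  adding x t P I ((bits N B).drop i) ((bits N Z).drop i) ((bits N A).drop i)
    ((bits N B).take i).reverse ((bits N Z).take i).reverse
    ((bits N (A + B)).take i).reverse ((bits N (A + B - Z)).take i).reverse
    [decide ((A + B) / 2 ^ i - A / 2 ^ i - B / 2 ^ i = 1)]
    [decide ((A + B) / 2 ^ i - Z / 2 ^ i - (A + B - Z) / 2 ^ i = 1)]

/-- The carry into position `i` is the defect of additivity of division by 2 ^ i. The digits of the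
possibly negative difference are those of two's complement, since integer division rounds down. -/
theorem trans_addingAt (A B Z : ℤ) {i : ℕ} (hi : i < N) :
    Trans N addBit (addingAt x t P I N A B Z i) (addingAt x t P I N A B Z (i + 1)) [] := by
  have hc := carry_cases A B i
  have hb := carry_cases Z (A + B - Z) i
  -- The borrow of a subtraction is the carry of the addition of `Z` and the difference.
  rw [add_sub_cancel] at hb
  have hs : ∀ v : ℤ, v / 2 ^ (i + 1) = v / 2 ^ i / 2 := by
    intro v
    rw [pow_succ, ← Int.ediv_ediv_of_nonneg (by positivity)]
  rw [addingAt, drop_bits hi, drop_bits hi, drop_bits hi]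
  refine (trans_addBit x t P I _ _ _ _ _ _ _ _ _ _ _ _).congr rfl ?_ rfl
  rw [addingAt, take_bits hi, take_bits hi, take_bits hi, take_bits hi]
  simp only [hs, ibit]
  -- What remains is arithmetic of parities and halves, with carry and borrow in {0, 1}.
  generalize A / 2 ^ i = a at *
  generalize B / 2 ^ i = b at *
  generalize Z / 2 ^ i = z at *
  generalize (A + B) / 2 ^ i = s at *
  generalize (A + B - Z) / 2 ^ i = d at *
  have e1 : ((decide (a % 2 = 1) ^^ decide (b % 2 = 1)) ^^ decide (s - a - b = 1)) =
      decide (s % 2 = 1) := by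
    by_cases h1 : a % 2 = 1 <;> by_cases h2 : b % 2 = 1 <;> by_cases h3 : s - a - b = 1 <;>
      by_cases h4 : s % 2 = 1 <;> simp [h1, h2, h3, h4] <;> omega
  have e2 : ((decide (s % 2 = 1) ^^ decide (z % 2 = 1)) ^^ decide (s - z - d = 1)) =
      decide (d % 2 = 1) := by
    by_cases h1 : s % 2 = 1 <;> by_cases h2 : z % 2 = 1 <;> by_cases h3 : s - z - d = 1 <;>
      by_cases h4 : d % 2 = 1 <;> simp [h1, h2, h3, h4] <;> omega
  have e3 : (decide (a % 2 = 1) && decide (b % 2 = 1) ||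
      decide (s - a - b = 1) && (decide (a % 2 = 1) || decide (b % 2 = 1))) =
      decide (s / 2 - a / 2 - b / 2 = 1) := by
    by_cases h1 : a % 2 = 1 <;> by_cases h2 : b % 2 = 1 <;> by_cases h3 : s - a - b = 1 <;>
      by_cases h4 : s / 2 - a / 2 - b / 2 = 1 <;> simp [h1, h2, h3, h4] <;> omega
  have e4 : (!decide (s % 2 = 1) && (decide (z % 2 = 1) || decide (s - z - d = 1)) ||
      decide (z % 2 = 1) && decide (s - z - d = 1)) =
      decide (s / 2 - z / 2 - d / 2 = 1) := by
    by_cases h1 : s % 2 = 1 <;> by_cases h2 : z % 2 = 1 <;> by_cases h3 : s - z - d = 1 <;>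
      by_cases h4 : s / 2 - z / 2 - d / 2 = 1 <;> simp [h1, h2, h3, h4] <;> omega
  rw [e1, e2, e3, e4]

/-- Adding a number to the register `acc` modulo another number; without overflow, a gate is
written and the index is increased. -/
def stepProg (E : ℕ) : Prog (Option Reg) :=
  .seq (.push (some .cy) false) <|
  .seq (.push (some .bo) false) <|
  .seq (.iter 1 addBit) <|
  .seq (.drain 1 .numCopy [.num]) <|
  .seq (.drain 1 .denCopy [.den]) <|
  .seq (.popCase (some .cy) .skip .skip .skip) <|
  .popCase (some .bo)
    (.seq (.drain 1 .sum [.acc]) <| .seq (.drain 1 .dif []) <|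
      .seq (.stds ![.seq (.emit true) (emitIdx E), .skip] [.cx (0 : Fin 2) 1])
        (.push (some .idx) true))
    (.seq (.drain 1 .dif [.acc]) (.drain 1 .sum []))
    .skip

/-- The sum and the difference are computed together, and the last borrow decides which of them is
kept. The last carry is zero because the sum fits into `N` bits. -/
theorem trans_stepProg {A B Z : ℤ} (hA : 0 ≤ A) (hB : 0 ≤ B) (hZ : 0 ≤ Z) (hAB : A + B < 2 ^ N)
    (hZN : Z < 2 ^ N) {E : ℕ} (hI : I ≤ N ^ E) :
    Trans N (stepProg E) (main x t P I [] (bits N B) (bits N Z) (bits N A))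
      (main x t P (if A + B < Z then I + 1 else I) [] (bits N B) (bits N Z)
        (bits N (if A + B < Z then A + B else A + B - Z)))
      (if A + B < Z then stdWord ![1 + I, 0] [.cx (0 : Fin 2) 1] else []) := by
  have hp : (0 : ℤ) < 2 ^ N := by positivity
  have hN1 : N ≤ N ^ 1 := (pow_one N).ge
  have h1 : Trans N (.seq (.push (some .cy) false) (.push (some .bo) false))
      (main x t P I [] (bits N B) (bits N Z) (bits N A)) (addingAt x t P I N A B Z 0) [] := by
    refine ((Trans.push _ _).seq (Trans.push _ _)).congr rfl ?_ rfl
    funext r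
    cases r <;> simp [main, addingAt, adding]
  have h2 := Repeats.iter N addBit 1 (addingAt x t P I N A B Z) (fun _ => []) fun i hi =>
    trans_addingAt x t P I A B Z (by simpa using hi)
  rw [flatMap_const_nil, pow_one] at h2
  have h3 : addingAt x t P I N A B Z N = adding x t P I [] [] [] (bits N B).reverse
      (bits N Z).reverse (bits N (A + B)).reverse (bits N (A + B - Z)).reverse [false]
      [decide (A + B < Z)] := by
    have hl : ∀ v, (bits N v).drop N = [] := fun v => List.drop_of_length_le (by simp)
    have hl' : ∀ v, (bits N v).take N = bits N v := fun v => List.take_of_length_le (by simp)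
    rw [addingAt, hl, hl, hl, hl', hl', hl', hl', Int.ediv_eq_zero_of_lt hA (by omega),
      Int.ediv_eq_zero_of_lt hB (by omega), Int.ediv_eq_zero_of_lt (by omega) hAB,
      Int.ediv_eq_zero_of_lt hZ hZN]
    -- Beyond all digits, the quotient of the difference is its sign, 0 or -1.
    have h4 : (0 - 0 - (A + B - Z) / 2 ^ N = 1) ↔ A + B < Z := by
      rcases lt_or_ge (A + B) Z with h | h
      · have : (A + B - Z) / 2 ^ N = -1 := by
          rw [Int.ediv_eq_iff_of_pos hp]
          constructor <;> linarith
        simp [this, h]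
      · rw [Int.ediv_eq_zero_of_lt (by omega) (by omega)]
        simp [h]
    simp only [h4]
    simp
  rw [h3] at h2
  have h4 : Trans N (.seq (.drain 1 .numCopy [.num]) (.seq (.drain 1 .denCopy [.den])
      (.popCase (some .cy) .skip .skip .skip)))
      (adding x t P I [] [] [] (bits N B).reverse
        (bits N Z).reverse (bits N (A + B)).reverse (bits N (A + B - Z)).reverse [false]
        [decide (A + B < Z)])
      (adding x t P I (bits N B) (bits N Z) [] [] [] (bits N (A + B)).reverse
        (bits N (A + B - Z)).reverse [] [decide (A + B < Z)]) [] := by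
    refine ((Trans.drain (by simp) (by simp) (by simp [adding])).seq
      ((Trans.drain (by simp) (by simp) (by simp [adding])).seq
      (Trans.popCase [] false ?_ Trans.skip))).congr rfl ?_ rfl
    · simp [adding]
    · funext r
      cases r <;> simp [adding]
  have h5 : Trans N (.popCase (some .bo)
      (.seq (.drain 1 .sum [.acc]) <| .seq (.drain 1 .dif []) <|
        .seq (.stds ![.seq (.emit true) (emitIdx E), .skip] [.cx (0 : Fin 2) 1])
          (.push (some .idx) true))
      (.seq (.drain 1 .dif [.acc]) (.drain 1 .sum [])) .skip)
      (adding x t P I (bits N B) (bits N Z) [] [] [] (bits N (A + B)).reverse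
        (bits N (A + B - Z)).reverse [] [decide (A + B < Z)])
      (main x t P (if A + B < Z then I + 1 else I) [] (bits N B) (bits N Z)
        (bits N (if A + B < Z then A + B else A + B - Z)))
      (if A + B < Z then stdWord ![1 + I, 0] [.cx (0 : Fin 2) 1] else []) := by
    refine Trans.popCase [] (decide (A + B < Z)) (by simp [adding]) ?_
    by_cases h : A + B < Z
    · simp only [h, decide_true, cond_true, if_true]
      have h6 : Trans N (.stds ![.seq (.emit true) (emitIdx E), .skip] [.cx (0 : Fin 2) 1])
          (main x t P I [] (bits N B) (bits N Z) (bits N (A + B)))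
          (main x t P I [] (bits N B) (bits N Z) (bits N (A + B)))
          (stdWord ![1 + I, 0] [.cx (0 : Fin 2) 1]) := by
        refine Trans.stds (fun i => ?_) _
        fin_cases i
        · exact ((Trans.emit true).seq (trans_emitIdx _ _ _ _ _ _ hI)).congr rfl rfl
            (by rw [Nat.add_comm]; rfl)
        · exact .skip
      have h7 : Trans N (.seq (.drain 1 .sum [.acc]) (.drain 1 .dif []))
          (Function.update (adding x t P I (bits N B) (bits N Z) [] [] []
            (bits N (A + B)).reverse (bits N (A + B - Z)).reverse [] [true]) .bo [])
          (main x t P I [] (bits N B) (bits N Z) (bits N (A + B))) [] := by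
        refine ((Trans.drain (by simp) (by simp) (by simp [adding])).seq
          (Trans.drain (by simp) (by simp) (by simp [adding]))).congr rfl ?_ rfl
        funext r
        cases r <;> simp [adding, main]
      have h8 := h7.seq (h6.seq (trans_push_idx _ _ _ _ _ _ _ _))
      rw [List.nil_append, List.append_nil] at h8
      intro o
      rw [← h8 o]
      rfl
    · simp only [h, decide_false, cond_false, if_false]
      refine ((Trans.drain (by simp) (by simp) (by simp [adding])).seq
        (Trans.drain (by simp) (by simp) (by simp [adding]))).congr rfl ?_ rfl
      funext r
      cases r <;> simp [adding, main]
  intro o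
  have := (h1.seq (h2.seq (h4.seq h5))) o
  simp only [List.nil_append] at this
  rw [← this]
  rfl

end Arithmetic

end QOver

end

noncomputable section

namespace QOver

/-- Moving a bit string in its description to a register, in reverse. -/
def readBits (r s : Reg) : Prog (Option Reg) :=
  .loop (some (some r)) (.popCase (some r) (.push (some s) true) (.push (some s) false) .skip)

theorem trans_readBits {N : ℕ} {r s : Reg} (hne : s ≠ r) (S : Reg → List Bool) (l t : List Bool)
    (hl : l.length < N) : Trans N (readBits r s) (Function.update S r (encBits l ++ t))
      (Function.update (Function.update S s (l.reverse ++ S s)) r t) [] := by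
  intro o
  rw [readBits, Prog.eval]
  have key : ∀ (l : List Bool) (m : ℕ) (S : Reg → List Bool), l.length < m →
      Prog.rounds (some (some r)) (Prog.eval N (.popCase (some r) (.push (some s) true)
        (.push (some s) false) .skip)) m (memory (Function.update S r (encBits l ++ t)) o) =
      memory (Function.update (Function.update S s (l.reverse ++ S s)) r t) o := by
    intro l
    induction l with
    | nil =>
      intro m S hm
      obtain ⟨m, rfl⟩ := Nat.exists_eq_succ_of_ne_zero hm.ne'
      simp [Prog.rounds, Prog.test, encBits]
    | cons b l ih =>
      intro m S hm
      obtain ⟨m, rfl⟩ := Nat.exists_eq_succ_of_ne_zero (Nat.ne_of_gt (Nat.zero_lt_of_lt hm))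
      have h1 : Prog.eval N (.popCase (some r) (.push (some s) true)
          (.push (some s) false) .skip)
          (memory (Function.update S r (b :: (encBits l ++ t))) o) =
          memory (Function.update (Function.update S s (b :: S s)) r (encBits l ++ t)) o := by
        cases b <;> simp [Prog.eval, hne, Function.update_comm hne]
      have h2 := ih m (Function.update S s (b :: S s))
        (by simp only [List.length_cons] at hm; omega)
      rw [Prog.rounds]
      simp only [Prog.test, encBits, memory_some, Function.update_self, List.cons_append,
        List.head?_cons, beq_self_eq_true, cond_true, List.tail_cons, update_memory_some,
        Function.update_idem, h1, h2]
      simp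
  exact key l N S hl

/-- Padding the contents of a register with zeros, which are moved in reverse to another one. -/
theorem trans_pad {N : ℕ} {r s : Reg} (hne : s ≠ r) (S : Reg → List Bool)
    (hr : (S r).length ≤ N) (ht : S s = []) :
    Trans N (.iter 1 (.popBit r fun b => .push (some s) b)) S
      (Function.update (Function.update S s (bits N (bitsVal (S r))).reverse) r []) [] := by
  have h := Repeats.iter N (.popBit r fun b => .push (some s) b) 1
    (fun i => Function.update (Function.update S s ((bits N (bitsVal (S r))).take i).reverse) r
      ((S r).drop i)) (fun _ => []) fun i hi => ?_
  · rw [flatMap_const_nil, pow_one, List.drop_of_length_le hr,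
      List.take_of_length_le (length_bits N _).le] at h
    refine h.congr ?_ rfl rfl
    have h0 : Function.update S s [] = S := by rw [← ht, Function.update_eq_self]
    simp [h0]
  · rw [pow_one] at hi
    refine Trans.popBit ?_
    refine (Trans.push _ _).congr rfl ?_ rfl
    rw [Function.update_self, ibit_bitsVal, take_bits hi, Function.update_idem,
      Function.update_of_ne hne, Function.update_self, Function.update_comm hne.symm,
      Function.update_idem, List.tail_drop]

/-- Reading a number into a register, with as many bits as the input has. -/
def readNumber (r : Reg) : Prog (Option Reg) :=
  .seq (readBits .inp .tmp) <| .seq (.drain 1 .tmp [r]) <|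
  .seq (.iter 1 (.popBit r fun b => .push (some .tmp) b)) (.drain 1 .tmp [r])

/-- Padding to exactly `N` bits lets the addition run over all digits with a guardless loop. Each of
the two passes through `tmp` reverses twice. -/
theorem trans_readNumber {N : ℕ} {r : Reg} (h1 : r ≠ .inp) (h2 : r ≠ .tmp) {S : Reg → List Bool}
    (hr : S r = []) (ht : S .tmp = []) (v : ℕ) (t : List Bool) (hN : (encBinary v).length ≤ N) :
    Trans N (readNumber r) (Function.update S .inp (encBinary v ++ t))
      (Function.update (Function.update S r (bits N v)) .inp t) [] := by
  set l := Computability.encodeNat v with hl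
  have hlen : l.length < N := by
    rw [encBinary, length_encBits, ← hl] at hN
    omega
  have hN1 := (pow_one N)
  have e1 := trans_readBits (N := N) (r := .inp) (s := .tmp) (by simp) S l t hlen
  have e2 := Trans.drain (N := N) (e := 1) (r := .tmp) (as := [r]) (by simp)
    (by simpa using h2.symm)
    (S := Function.update (Function.update S .tmp (l.reverse ++ S .tmp)) .inp t)
    (by simp [ht, hlen.le])
  have e3 := trans_pad (N := N) (r := r) (s := .tmp) h2.symm
    (Function.update (Function.update S r l) .inp t)
    (by simp [h1, hlen.le]) (by simp [h2.symm, ht])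
  have e4 := Trans.drain (N := N) (e := 1) (r := .tmp) (as := [r]) (by simp)
    (by simpa using h2.symm) (S := Function.update (Function.update S .tmp (bits N v).reverse) .inp t)
    (by simp)
  have e5 : (fun a => if a = Reg.tmp then [] else if a ∈ [r] then
      (Function.update (Function.update S .tmp (l.reverse ++ S .tmp)) .inp t .tmp).reverse ++
        Function.update (Function.update S .tmp (l.reverse ++ S .tmp)) .inp t a else
        Function.update (Function.update S .tmp (l.reverse ++ S .tmp)) .inp t a) =
      Function.update (Function.update S r l) .inp t := by
    funext a
    by_cases ha : a = .tmp
    · subst ha; simp [h2.symm, ht]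
    · by_cases ha' : a = r
      · subst ha'; simp [h1, h2, ht, hr]
      · by_cases ha'' : a = .inp
        · subst ha''; simp [h1.symm]
        · simp [ha, ha', ha'']
  have e6 : Function.update (Function.update (Function.update (Function.update S r l) .inp t) .tmp
      (bits N (bitsVal (Function.update (Function.update S r l) .inp t r))).reverse) r [] =
      Function.update (Function.update S .tmp (bits N v).reverse) .inp t := by
    rw [Function.update_of_ne h1, Function.update_self, hl, bitsVal_encodeNat]
    funext a
    by_cases ha' : a = r
    · subst ha'; simp [h1, h2, hr]
    · by_cases ha : a = .tmp
      · subst ha; simp [h2.symm]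
      · by_cases ha'' : a = .inp
        · subst ha''; simp [h1.symm]
        · simp [ha, ha', ha'']
  refine (e1.seq ((e2.congr rfl e5 rfl).seq ((e3.congr rfl e6 rfl).seq e4))).congr rfl ?_ rfl
  funext a
  by_cases ha : a = .tmp
  · subst ha; simp [h2.symm, ht]
  · by_cases ha' : a = r
    · subst ha'; simp [h1, h2, hr]
    · by_cases ha'' : a = .inp
      · subst ha''; simp [h1.symm]
      · simp [ha, ha', ha'']

/-- Reading a rational number `c` in the unit interval, and writing `N ^ e - ⌊c * N ^ e⌋` gates. -/
def ratProg (e E : ℕ) : Prog (Option Reg) :=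
  .seq (.popCase (some .inp) .skip .skip .skip) <|
  .seq (readNumber .num) <|
  .seq (readNumber .den) <|
  .seq (.iter 1 (.push (some .acc) false)) <|
  .seq (.iter e (stepProg E)) <|
  .seq (.drain 1 .num []) <| .seq (.drain 1 .den []) (.drain 1 .acc [])

/-- When `c` is added to the residue of `j * c` modulo `d`, an overflow occurs exactly when the
quotient ⌊jc/d⌋ increases by one. Hence m - ⌊mc/d⌋ of the first `m` additions are without overflow.
-/
theorem flatMap_steps {α : Type} (c d : ℕ) (hd : 0 < d) (hc : c ≤ d) (g : ℕ → List α) (m : ℕ) :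
    ((List.range m).flatMap fun j =>
      if j * c % d + c < d then g (j - j * c / d) else []) =
    (List.range (m - m * c / d)).flatMap g ∧ m * c / d ≤ m := by
  induction m with
  | zero => simp
  | succ m ih =>
    obtain ⟨ih, hm⟩ := ih
    rw [List.range_succ, List.flatMap_append, ih, List.flatMap_singleton]
    have h1 := Nat.div_add_mod (m * c) d
    have h2 : (m + 1) * c = m * c + c := by ring
    rcases lt_or_ge (m * c % d + c) d with h | h
    · have h3 : (m + 1) * c / d = m * c / d := by
        rw [h2, Nat.div_eq_iff hd]
        constructor
        · rw [Nat.mul_comm (m * c / d)]; omega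
        · rw [Nat.mul_comm (m * c / d)]; omega
      rw [if_pos h, h3, show m + 1 - m * c / d = m - m * c / d + 1 by omega, List.range_succ,
        List.flatMap_append, List.flatMap_singleton]
      exact ⟨rfl, by omega⟩
    · have hlt := Nat.mod_lt (m * c) hd
      have h3 : (m + 1) * c / d = m * c / d + 1 := by
        have h4 : (m * c / d + 1) * d = d * (m * c / d) + d := by ring
        rw [h2, Nat.div_eq_iff hd]
        constructor
        · rw [h4]; omega
        · rw [h4]; omega
      rw [if_neg (by omega), h3, show m + 1 - (m * c / d + 1) = m - m * c / d by omega,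
        List.append_nil]
      exact ⟨rfl, by omega⟩

end QOver

end

noncomputable section

namespace QOver

/-- The number of gates that are written for a rational number. -/
def gateCount (c : ℚ) (m : ℕ) : ℕ := m - m * c.num.natAbs / c.den

theorem natAbs_num_le {c : ℚ} (h0 : 0 ≤ c) (h1 : c ≤ 1) : c.num.natAbs ≤ c.den := by
  have h2 := Rat.num_nonneg.2 h0
  have h3 : c.num ≤ c.den := by
    have := Rat.num_div_den c
    have hd : (0 : ℚ) < c.den := by exact_mod_cast c.den_pos
    rw [← this, div_le_one hd] at h1
    exact_mod_cast h1
  omega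

theorem gateCount_bounds {c : ℚ} (h0 : 0 ≤ c) (h1 : c ≤ 1) (m : ℕ) :
    (m : ℝ) - m * c ≤ gateCount c m ∧ (gateCount c m : ℝ) < m - m * c + 1 := by
  have hd : 0 < c.den := c.den_pos
  have h2 := (flatMap_steps (α := ℕ) _ _ hd (natAbs_num_le h0 h1) (fun _ => []) m).2
  have hd' : (0 : ℝ) < c.den := by exact_mod_cast hd
  have h3 : (c : ℝ) = c.num.natAbs / c.den := by
    have h4 : ((c.num.natAbs : ℕ) : ℤ) = c.num := Int.natAbs_of_nonneg (Rat.num_nonneg.2 h0)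
    have h5 : ((c.num.natAbs : ℕ) : ℝ) = (c.num : ℝ) := by rw [← Int.cast_natCast, h4]
    rw [h5]
    exact Rat.cast_def c
  have h6 : (m : ℝ) * c = ((m * c.num.natAbs : ℕ) : ℝ) / c.den := by
    rw [h3]; push_cast; ring
  have h7 : ((m * c.num.natAbs / c.den : ℕ) : ℝ) ≤ m * c := by
    rw [h6]; exact Nat.cast_div_le
  have h8 : (m : ℝ) * c < (m * c.num.natAbs / c.den : ℕ) + 1 := by
    rw [h6, div_lt_iff₀ hd']
    exact_mod_cast Nat.lt_mul_of_div_lt (Nat.lt_succ_self _) hd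
  rw [gateCount, Nat.cast_sub h2]
  constructor <;> linarith

section Rational

variable {N : ℕ} (x : List Bool) (P : ℕ) {I : ℕ}

theorem trans_loadRat (c : ℚ) (t : List Bool) (hN : (encRat c ++ t).length ≤ N) :
    Trans N (.seq (.popCase (some .inp) .skip .skip .skip) <| .seq (readNumber .num) <|
      .seq (readNumber .den) (.iter 1 (.push (some .acc) false)))
      (main x (encRat c ++ t) P I [] [] [] [])
      (main x t P I [] (bits N c.num.natAbs) (bits N c.den) (bits N 0)) [] := by
  have hN' : (encBinary c.num.natAbs).length + (encBinary c.den).length + 1 ≤ N := by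
    simp only [encRat, List.length_append, List.length_cons] at hN
    omega
  have e1 : Trans N (.popCase (some .inp) .skip .skip .skip)
      (main x (encRat c ++ t) P I [] [] [] [])
      (main x (encBinary c.num.natAbs ++ (encBinary c.den ++ t)) P I [] [] [] []) [] := by
    refine Trans.popCase (encBinary c.num.natAbs ++ (encBinary c.den ++ t))
      (decide (c.num < 0)) ?_ ?_
    · simp only [main, encRat, List.cons_append, List.append_assoc]
    · rw [update_main_inp]
      -- The sign bit is discarded: the program is only used for nonnegative numbers.
      cases decide (c.num < 0) <;> exact .skip
  have e2 := trans_readNumber (N := N) (r := .num) (by simp) (by simp)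
    (S := main x [] P I [] [] [] []) rfl rfl c.num.natAbs (encBinary c.den ++ t) (by omega)
  have e3 := trans_readNumber (N := N) (r := .den) (by simp) (by simp)
    (S := main x [] P I [] (bits N c.num.natAbs) [] []) rfl rfl c.den t (by omega)
  have e4 : Trans N (.iter 1 (.push (some .acc) false))
      (main x t P I [] (bits N c.num.natAbs) (bits N c.den) [])
      (main x t P I [] (bits N c.num.natAbs) (bits N c.den) (bits N 0)) [] := by
    refine (Repeats.iter N (.push (some .acc) false) 1
      (fun i => main x t P I [] (bits N c.num.natAbs) (bits N c.den) (List.replicate i false))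
      (fun _ => []) fun i _ => (Trans.push _ false).congr rfl ?_ rfl).congr rfl ?_
      (flatMap_const_nil _)
    · funext r
      cases r <;> simp [main, List.replicate_succ]
    · rw [pow_one]
      congr 1
      have : ibit 0 = fun _ => false := by
        funext i
        simp [ibit]
      rw [bits, this, List.map_const', List.length_range]
  rw [update_main_inp] at e2 e3
  refine (e1.seq ((e2.congr rfl ?_ rfl).seq ((e3.congr rfl ?_ rfl).seq e4))).congr rfl rfl rfl
  · funext r
    cases r <;> simp [main]
  · funext r
    cases r <;> simp [main]

/-- After `j` steps the accumulator holds the residue of `j` times the numerator. The index is not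
reset, so a second run continues with the next positions of the counter. -/
theorem trans_ratProg {c : ℚ} (h0 : 0 ≤ c) (h1 : c ≤ 1) (t : List Bool)
    (hN : (encRat c ++ t).length ≤ N) {e E : ℕ} (hI : I + N ^ e ≤ N ^ E) :
    Trans N (ratProg e E) (main x (encRat c ++ t) P I [] [] [] [])
      (main x t P (I + gateCount c (N ^ e)) [] [] [] [])
      ((List.range (gateCount c (N ^ e))).flatMap fun i =>
        stdWord ![1 + (I + i), 0] [.cx (0 : Fin 2) 1]) := by
  have hlen : (encBinary c.den).length + 1 ≤ N := by
    simp only [encRat, List.length_append, List.length_cons] at hN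
    omega
  set B := c.num.natAbs with hB
  set d := c.den with hd
  have hd0 : 0 < d := c.den_pos
  have hBd : B ≤ d := natAbs_num_le h0 h1
  -- The self-delimiting code is longer than twice the binary expansion, which leaves the spare bit
  -- needed for sums below `2 * d`.
  have hdN : 2 * d < 2 ^ N := by
    have h2 := bitsVal_lt (Computability.encodeNat d)
    rw [bitsVal_encodeNat] at h2
    rw [encBinary, length_encBits] at hlen
    calc 2 * d < 2 * 2 ^ (Computability.encodeNat d).length := by omega
      _ = 2 ^ ((Computability.encodeNat d).length + 1) := by ring
      _ ≤ 2 ^ N := Nat.pow_le_pow_right (by norm_num) (by omega)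
  have hdN' : (2 : ℤ) * d < 2 ^ N := by exact_mod_cast hdN
  have hBd' : (B : ℤ) ≤ d := by exact_mod_cast hBd
  have e1 := trans_loadRat (N := N) x P (I := I) c t hN
  have hsub : ∀ j, j * B / d ≤ j := fun j =>
    (flatMap_steps (α := ℕ) B d hd0 hBd (fun _ => []) j).2
  have e2 := Repeats.iter N (stepProg E) e
    (fun j => main x t P (I + (j - j * B / d)) [] (bits N B) (bits N d) (bits N (j * B % d : ℕ)))
    (fun j => if j * B % d + B < d then stdWord ![1 + (I + (j - j * B / d)), 0]
      [.cx (0 : Fin 2) 1] else []) fun j hj => ?_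
  · rw [(flatMap_steps B d hd0 hBd (fun i => stdWord ![1 + (I + i), 0] [.cx (0 : Fin 2) 1]) _).1]
      at e2
    have e3 : Trans N (.seq (.drain 1 .num []) (.seq (.drain 1 .den []) (.drain 1 .acc [])))
        (main x t P (I + gateCount c (N ^ e)) [] (bits N B) (bits N d)
          (bits N (N ^ e * B % d : ℕ)))
        (main x t P (I + gateCount c (N ^ e)) [] [] [] []) [] := by
      refine ((Trans.drain (by simp) (by simp) (by simp [main])).seq
        ((Trans.drain (by simp) (by simp) (by simp [main])).seq
        (Trans.drain (by simp) (by simp) (by simp [main])))).congr rfl ?_ rfl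
      funext r
      cases r <;> simp [main]
    have e4 := e1.seq ((e2.congr (by
      simp only [Nat.zero_mul, Nat.zero_div, Nat.sub_zero, Nat.add_zero, Nat.zero_mod,
        Nat.cast_zero]
      rfl) rfl rfl).seq e3)
    rw [List.nil_append, List.append_nil] at e4
    exact fun o => e4 o
  · have h2 := Nat.mod_lt (j * B) hd0
    have h3 := trans_stepProg (N := N) x t P (I + (j - j * B / d)) (A := (j * B % d : ℕ)) (B := B)
      (Z := d) (by positivity) (by positivity) (by positivity) (by omega) (by omega) (E := E)
      (by have := Nat.sub_le j (j * B / d); omega)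
    have h4 := Nat.div_add_mod (j * B) d
    have h5 : (j + 1) * B = j * B + B := by ring
    have hlt : (((j * B % d : ℕ) : ℤ) + B < d) ↔ j * B % d + B < d := by
      constructor <;> intro h <;> exact_mod_cast h
    simp only [hlt] at h3
    refine h3.congr rfl ?_ rfl
    have h6 := hsub j
    by_cases h : j * B % d + B < d
    · have h7 : (j + 1) * B / d = j * B / d ∧ (j + 1) * B % d = j * B % d + B :=
        (Nat.div_mod_unique hd0).2 ⟨by rw [h5]; omega, h⟩
      rw [if_pos h, if_pos h, h7.1, h7.2]
      congr 1
      omega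
    · have h7 : (j + 1) * B / d = j * B / d + 1 ∧ (j + 1) * B % d = j * B % d + B - d :=
        (Nat.div_mod_unique hd0).2 ⟨by rw [h5, mul_add]; omega, by omega⟩
      rw [if_neg h, if_neg h, h7.1, h7.2]
      congr 1
      · omega
      · congr 1
        push_cast [Nat.cast_sub (show d ≤ j * B % d + B by omega)]
        ring

end Rational

end QOver

end

/-! ### Membership: layout of the circuit, and choice of the parameters. -/

noncomputable section

namespace QOver

/-! ### Membership -/

/-- For `N ≥ 2`, a coefficient `c` is at most `2 ^ c ≤ N ^ c`, and the factor 2 from adding two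
bounds costs one more power. -/
theorem exists_eval_le_pow (p : Polynomial ℕ) : ∃ e : ℕ, ∀ N, 2 ≤ N → p.eval N ≤ N ^ e := by
  induction p using Polynomial.induction_on' with
  | add p q hp hq =>
    obtain ⟨d, hd⟩ := hp
    obtain ⟨e, he⟩ := hq
    refine ⟨max d e + 1, fun N hN => ?_⟩
    have h1 := Nat.pow_le_pow_right (show 0 < N by omega) (le_max_left d e)
    have h2 := Nat.pow_le_pow_right (show 0 < N by omega) (le_max_right d e)
    rw [Polynomial.eval_add, pow_succ]
    nlinarith [hd N hN, he N hN]
  | monomial d c =>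
    refine ⟨c + d, fun N hN => ?_⟩
    rw [Polynomial.eval_monomial, pow_add]
    exact Nat.mul_le_mul_right _ (Nat.lt_two_pow_self.le.trans (Nat.pow_le_pow_left hN c))

theorem flatMap_finRange {α : Type} (n : ℕ) (F : ℕ → List α) :
    ((List.finRange n).flatMap fun i : Fin n => F i.1) = (List.range n).flatMap F := by
  rw [← List.map_coe_finRange_eq_range, List.flatMap_map]

section Layout

variable {n k R : ℕ} (N : ℕ)

/-- The number of a qubit; the circuits have at most `N` qubits. -/
def wireIdx : Wire n k R → ℕ
  | .out => 0
  | .cnt i => 1 + i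
  | .blk r (.inl i) => R + 2 + r * (N + N + 1) + i
  | .blk r (.inr (.inl j)) => R + 2 + r * (N + N + 1) + N + j
  | .blk r (.inr (.inr _)) => R + 2 + r * (N + N + 1) + (N + N)

/-- Blocks have width 2N + 1, so the block and the offset in it are recovered by division with
remainder. -/
theorem wireIdx_injective (hn : n ≤ N) (hk : k ≤ N) :
    Function.Injective (wireIdx N : Wire n k R → ℕ) := by
  have hblk : ∀ (r : Fin R) (w : SwapWire n k), ∃ m < N + N + 1,
      wireIdx N (.blk r w) = R + 2 + (r * (N + N + 1) + m) := by
    rintro r (i | j | u)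
    · exact ⟨i, by omega, by simp only [wireIdx]; omega⟩
    · exact ⟨N + j, by omega, by simp only [wireIdx]; omega⟩
    · exact ⟨N + N, by omega, by simp only [wireIdx]; omega⟩
  intro a b h
  cases a with
  | out =>
    cases b with
    | out => rfl
    | cnt i => simp only [wireIdx] at h; omega
    | blk r w =>
      obtain ⟨m, -, hm⟩ := hblk r w
      rw [hm] at h
      simp only [wireIdx] at h
      omega
  | cnt i =>
    cases b with
    | out => simp only [wireIdx] at h; omega
    | cnt j => simp only [wireIdx] at h; rw [Wire.cnt.injEq]; omega
    | blk r w =>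
      obtain ⟨m, -, hm⟩ := hblk r w
      rw [hm] at h
      simp only [wireIdx] at h
      omega
  | blk r w =>
    cases b with
    | out =>
      obtain ⟨m, -, hm⟩ := hblk r w
      rw [hm] at h
      simp only [wireIdx] at h
      omega
    | cnt i =>
      obtain ⟨m, -, hm⟩ := hblk r w
      rw [hm] at h
      simp only [wireIdx] at h
      omega
    | blk r' w' =>
      obtain ⟨m, hm, h1⟩ := hblk r w
      obtain ⟨m', hm', h2⟩ := hblk r' w'
      have h3 : r.1 * (N + N + 1) + m = r'.1 * (N + N + 1) + m' := by
        rw [h1, h2] at h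
        omega
      have h4 : r = r' := by
        have h5 := congrArg (· / (N + N + 1)) h3
        simp only [Nat.mul_comm _ (N + N + 1)] at h5
        rw [Nat.mul_add_div (by omega), Nat.mul_add_div (by omega), Nat.div_eq_of_lt hm,
          Nat.div_eq_of_lt hm'] at h5
        exact Fin.ext (by omega)
      subst h4
      congr 1
      rcases w with i | j | u <;> rcases w' with i' | j' | u' <;> simp only [wireIdx] at h
      · congr 1; omega
      · omega
      · omega
      · omega
      · congr 2; omega
      · omega
      · omega
      · omega
      · rfl

theorem wireIdx_lt (hn : n ≤ N) (hk : k ≤ N) (a : Wire n k R) :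
    wireIdx N a < R + 2 + R * (N + N + 1) := by
  have hr : ∀ r : Fin R, r.1 * (N + N + 1) + (N + N + 1) ≤ R * (N + N + 1) := by
    intro r
    rw [← Nat.succ_mul]
    exact Nat.mul_le_mul_right _ r.2
  rcases a with - | i | ⟨r, i | j | u⟩ <;> simp only [wireIdx]
  · omega
  · omega
  all_goals have := hr r; omega

/-- On distinct qubits the word depends only on three indices, so one gate pattern on three abstract
qubits serves for all controlled swaps. -/
theorem stdWord_cswap {ι : Type} [DecidableEq ι] (f : ι → ℕ) {c i j : ι} (hci : c ≠ i) (hcj : c ≠ j)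
    (hij : i ≠ j) : stdWord f (cswap c i j) = stdWord ![f c, f i, f j] (cswap 0 1 2) := by
  have he : Function.Injective ![c, i, j] := by
    intro a b h
    fin_cases a <;> fin_cases b <;> simp_all [eq_comm]
  have h1 : cswap c i j = (cswap 0 1 2 : List (Std (Fin 3))).map (Std.map ![c, i, j]) := rfl
  have h2 : f ∘ ![c, i, j] = ![f c, f i, f j] := by
    funext a
    fin_cases a <;> rfl
  rw [h1, stdWord_map he, h2]

theorem stdWord_flatMap {ι α : Type} [DecidableEq ι] (f : ι → ℕ) (l : List α)
    (g : α → List (Std ι)) : stdWord f (l.flatMap g) = l.flatMap fun a => stdWord f (g a) := by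
  simp only [stdWord, List.flatMap_assoc]

variable (hle : n ≤ k) (C : Circuit n) (D : Circuit k)

theorem word_round (r : Fin R) :
    (round hle C D r).flatMap (LGate.word (wireIdx N)) =
      roundWord C D N R (R + 2 + r * (N + N + 1)) := by
  set P := R + 2 + r.1 * (N + N + 1) with hP
  have h1 : ((List.finRange n).flatMap fun i => stdWord (wireIdx N ∘ Wire.blk r)
      (cswap ctrl (.inl i) (.inr (.inl (Fin.castLE hle i))))) =
      (List.range n).flatMap fun i => stdWord ![P + (N + N), P + i, P + (N + i)] (cswap 0 1 2) := by
    rw [← flatMap_finRange]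
    refine List.flatMap_congr fun i _ => ?_
    rw [stdWord_cswap _ (by simp [ctrl]) (by simp [ctrl]) (by simp)]
    have : P + (N + i.1) = P + N + i := (Nat.add_assoc _ _ _).symm
    rw [this]
    rfl
  have h2 : stdWord (wireIdx N) (countGates (.blk r ctrl : Wire n k R) R) =
      (List.range R).flatMap fun i =>
        stdWord ![P + (N + N), 1 + i, 1 + (1 + i)] (cswap 0 1 2) := by
    rw [countGates, stdWord_flatMap]
    refine List.flatMap_congr fun i hi => ?_
    have hi' : i < R := List.mem_range.1 hi
    rw [stdWord_cswap _ (by simp) (by simp) (by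
      rw [ne_eq, Wire.pos_inj (by omega) (by omega)]; omega)]
    have h3 : wireIdx N (.pos i : Wire n k R) = 1 + i := by
      simp only [wireIdx, Fin.val_ofNat, Nat.mod_eq_of_lt (show i < R + 1 by omega)]
    have h4 : wireIdx N (.pos (i + 1) : Wire n k R) = 1 + (1 + i) := by
      simp only [wireIdx, Fin.val_ofNat, Nat.mod_eq_of_lt (show i + 1 < R + 1 by omega)]
      omega
    rw [h3, h4]
    rfl
  rw [round, List.flatMap_append, flatMap_word_map, swapTest, List.flatMap_append,
    List.flatMap_append, flatMap_word_map, flatMap_word_map, List.flatMap_map, List.flatMap_map]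
  change _ ++ stdWord (wireIdx N ∘ Wire.blk r) (swapGates hle) ++ stdWord (wireIdx N) _ = _
  rw [swapGates, stdWord_append, stdWord_append, stdWord_flatMap, h1, h2, roundWord]
  simp only [List.append_assoc]
  rfl

theorem word_decisionCircuit {T : ℕ} (hT : T ≤ R) :
    (decisionCircuit hle C D R T).flatMap (LGate.word (wireIdx N)) =
      stdWord (fun _ : Unit => 1 + R) (xGate ()) ++
      ((List.range R).flatMap fun r => roundWord C D N R (R + 2 + r * (N + N + 1))) ++
      (List.range T).flatMap fun i => stdWord ![1 + i, 0] [.cx (0 : Fin 2) 1] := by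
  have h1 : stdWord (wireIdx N) (xGate (.pos R : Wire n k R)) =
      stdWord (fun _ : Unit => 1 + R) (xGate ()) := by
    have he : Function.Injective fun _ : Unit => (.pos R : Wire n k R) := fun _ _ _ => rfl
    have h2 : xGate (.pos R : Wire n k R) =
        (xGate ()).map (Std.map fun _ : Unit => (.pos R : Wire n k R)) := rfl
    have h3 : (wireIdx N ∘ fun _ : Unit => (.pos R : Wire n k R)) = fun _ => 1 + R := by
      funext u
      simp only [Function.comp_apply, wireIdx, Fin.val_ofNat,
        Nat.mod_eq_of_lt (show R < R + 1 by omega)]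
    rw [h2, stdWord_map he, h3]
  have h2 : stdWord (wireIdx N) (finalGates T : List (Std (Wire n k R))) =
      (List.range T).flatMap fun i => stdWord ![1 + i, 0] [.cx (0 : Fin 2) 1] := by
    rw [finalGates, List.map_eq_flatMap, stdWord_flatMap]
    refine List.flatMap_congr fun i hi => ?_
    have hi' : i < T := List.mem_range.1 hi
    have he : Function.Injective ![(.pos i : Wire n k R), .out] := by
      intro a b h
      fin_cases a <;> fin_cases b <;> simp_all
    have h3 : [Std.cx (.pos i : Wire n k R) .out] =
        [Std.cx (0 : Fin 2) 1].map (Std.map ![(.pos i : Wire n k R), .out]) := rfl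
    have h4 : wireIdx N ∘ ![(.pos i : Wire n k R), .out] = ![1 + i, 0] := by
      funext a
      fin_cases a
      · simp [wireIdx, Nat.mod_eq_of_lt (show i < R + 1 by omega)]
      · rfl
    rw [h3, stdWord_map he, h4]
  have h3 : (List.finRange R).take R = List.finRange R := List.take_of_length_le (by simp)
  rw [decisionCircuit, List.flatMap_append, rounds, List.flatMap_append, h3]
  change stdWord (wireIdx N) (xGate (Wire.pos R : Wire n k R)) ++ _ ++
    stdWord (wireIdx N) (finalGates T : List (Std (Wire n k R))) = _
  rw [h1, h2, List.flatMap_assoc,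
    ← flatMap_finRange R fun r => roundWord C D N R (R + 2 + r * (N + N + 1))]
  simp only [word_round]

theorem isIn_decisionCircuit {G : GateSet} (hG : G.ContainsCliffordT) (hC : C.IsOver G)
    (hD : D.IsOver G) (T : ℕ) : ∀ g ∈ decisionCircuit hle C D R T, g.IsIn G := by
  intro g hg
  rcases List.mem_append.1 hg with hg | hg
  · rcases List.mem_append.1 hg with hg | hg
    · exact hG.isIn_gates _ g hg
    · obtain ⟨r, -, hg⟩ := List.mem_flatMap.1 hg
      rcases List.mem_append.1 hg with hg | hg
      · obtain ⟨g', hg', rfl⟩ := List.mem_map.1 hg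
        rw [LGate.isIn_map]
        rcases List.mem_append.1 hg' with hg' | hg'
        · rcases List.mem_append.1 hg' with hg' | hg'
          · obtain ⟨g'', hg'', rfl⟩ := List.mem_map.1 hg'
            exact (LGate.isIn_map _).2 (hC.toL g'' hg'')
          · obtain ⟨g'', hg'', rfl⟩ := List.mem_map.1 hg'
            exact (LGate.isIn_map _).2 (hD.toL g'' hg'')
        · exact hG.isIn_gates _ g' hg'
      · exact hG.isIn_gates _ g hg
  · exact hG.isIn_gates _ g hg

end Layout

end QOver

end

noncomputable section

namespace QOver

section Membership

/-- The program that writes the circuit deciding an instance of the overlap problem. -/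
def decisionProg (e : ℕ) : Prog (Option Reg) :=
  .seq (.seq (.iter (e + 5) (.emit true)) (.emit false)) <|
  .seq (.stds (fun _ : Unit => .seq (.emit true) (.iter₄ e (.emit true))) (xGate ())) <|
  .seq (.seq (.iter₄ e (.push (some .base) true))
    (.seq (.push (some .base) true) (.push (some .base) true))) <|
  .seq (.iter₄ e (roundProg e (e + 5))) <|
  .seq (ratProg e (e + 5)) <|
  .seq (ratProg e (e + 5)) (.emit false)

/-- The number of positions of the counter that lead to acceptance. -/
def threshold (a b : ℚ) (m : ℕ) : ℕ := gateCount a m + gateCount b m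

/-- The word that the program writes. -/
def decisionWord (A : OverInstance) (N e : ℕ) : List Bool :=
  encUnary (N ^ (e + 5)) ++
    ((stdWord (fun _ : Unit => 1 + 4 * N ^ e) (xGate ()) ++
      ((List.range (4 * N ^ e)).flatMap fun r =>
        roundWord A.C A.D N (4 * N ^ e) (4 * N ^ e + 2 + r * (N + N + 1))) ++
      (List.range (threshold A.a A.b (N ^ e))).flatMap fun i =>
        stdWord ![1 + i, 0] [.cx (0 : Fin 2) 1]) ++ [false])

variable {p : Polynomial ℕ} {G : GateSet} {A : OverInstance}

/-- The constant counts two unary terminators, the ends of two lists, and three bits for each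
rational number. It makes `N ≥ 10`, so that a few powers of `N` absorb all constants. -/
theorem length_enc (A : OverInstance) : A.n + A.k + 10 ≤ A.enc.length := by
  have h1 := Reads.length_le_length_encList Gate.enc A.C
  have h2 := Reads.length_le_length_encList Gate.enc A.D
  have h3 : ∀ c : ℚ, 3 ≤ (encRat c).length := by
    intro c
    simp only [encRat, List.length_cons, List.length_append, encBinary, length_encBits]
    omega
  have h4 := h3 A.a
  have h5 := h3 A.b
  simp only [OverInstance.enc, QCircuit.enc, List.length_append, encUnary, List.length_replicate,
    List.length_singleton]
  omega

theorem emitted_decisionProg (hA : A.Valid G p) (e : ℕ) :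
    (decisionProg e).emitted .sav A.enc = decisionWord A A.enc.length e := by
  set x := A.enc with hx
  set N := x.length with hN
  have hN10 : 10 ≤ N := by rw [hN, hx]; have := length_enc A; omega
  have hE : N ^ (e + 5) = N ^ e * N ^ 5 := pow_add N e 5
  have hpos : 0 < N ^ e := Nat.pow_pos (by omega)
  -- The five extra powers make `N ^ (e + 5)` exceed every index that is written; the same number
  -- serves as the number of qubits.
  have h5 : 10 ^ 4 * N ≤ N ^ 5 := by
    rw [pow_succ N 4]
    exact Nat.mul_le_mul_right _ (Nat.pow_le_pow_left hN10 4)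
  have hE' : N ^ e * (10 ^ 4 * N) ≤ N ^ (e + 5) := by
    rw [hE]
    exact Nat.mul_le_mul_left _ h5
  have hP : ∀ i < 4 * N ^ e, 4 * N ^ e + 2 + i * (N + N + 1) ≤ N ^ (e + 5) := by
    intro i hi
    have h6 : i * (N + N + 1) ≤ 4 * N ^ e * (N + N + 1) := Nat.mul_le_mul_right _ hi.le
    nlinarith
  set rats := encRat A.a ++ encRat A.b with hrats
  have hrl : rats.length ≤ N := by
    rw [hN, hx, OverInstance.enc, ← hrats]
    simp only [List.length_append]
    omega
  have e1 : Trans N (.seq (.iter (e + 5) (.emit true)) (.emit false))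
      (main x [] 0 0 [] [] [] []) (main x [] 0 0 [] [] [] []) (encUnary (N ^ (e + 5))) :=
    ((Repeats.iter N (.emit true) (e + 5)).const (.emit true)).seq (.emit false)
  have e2 : Trans N (.stds (fun _ : Unit => .seq (.emit true) (.iter₄ e (.emit true))) (xGate ()))
      (main x [] 0 0 [] [] [] []) (main x [] 0 0 [] [] [] [])
      (stdWord (fun _ : Unit => 1 + 4 * N ^ e) (xGate ())) := by
    refine Trans.stds (fun _ => ?_) _
    rw [List.replicate_add]
    exact (Trans.emit true).seq ((Repeats.iter₄ N (.emit true) e).const (.emit true))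
  have e3 := ((Repeats.iter₄ N (.push (some Reg.base) true) e).push_base x [] 0 0 [] [] [] []).seq
    ((trans_push_base (N := N) x [] (0 + 4 * N ^ e) 0 [] [] [] []).seq
      (trans_push_base x [] (0 + 4 * N ^ e + 1) 0 [] [] [] []))
  -- Before the first round nothing has been loaded into the reading register; each round leaves the
  -- two thresholds there, and after the last one they are read.
  have e4 := Repeats.iter₄ N (roundProg e (e + 5)) e
    (fun i => main x (if i = 0 then [] else rats) (4 * N ^ e + 2 + i * (N + N + 1)) 0 [] [] [] [])
    (fun i => roundWord A.C A.D N (4 * N ^ e) (4 * N ^ e + 2 + i * (N + N + 1))) fun i hi => ?_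
  · rw [if_pos rfl, if_neg (by omega), Nat.zero_mul, Nat.add_zero] at e4
    have e5 := trans_ratProg (N := N) x (4 * N ^ e + 2 + 4 * N ^ e * (N + N + 1)) (I := 0)
      hA.a_nonneg hA.a_le_one (encRat A.b) hrl (e := e) (E := e + 5) (by nlinarith)
    have hga : gateCount A.a (N ^ e) ≤ N ^ e := Nat.sub_le _ _
    have e6 := trans_ratProg (N := N) x (4 * N ^ e + 2 + 4 * N ^ e * (N + N + 1))
      (I := 0 + gateCount A.a (N ^ e)) hA.b_nonneg hA.b_le_one [] (by
        rw [hrats] at hrl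
        simp only [List.length_append, List.append_nil] at hrl ⊢
        omega) (e := e) (E := e + 5) (by nlinarith)
    rw [List.append_nil] at e6
    have e7 := e1.seq (e2.seq ((e3.congr rfl (by rw [Nat.zero_add]) rfl).seq (e4.seq (e5.seq
      (e6.seq (Trans.emit false))))))
    refine Trans.emitted_eq (S := _) (e7.congr ?_ rfl ?_)
    · funext r
      cases r <;> simp [main]
    · rw [decisionWord, threshold, List.range_add, List.flatMap_append, List.flatMap_map]
      simp only [List.append_assoc, List.nil_append, Nat.zero_add]
  · refine (trans_roundProg x _ A hx hN ?_ (hP i hi) (by nlinarith) (by omega)).congr rfl ?_ rfl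
    · split_ifs
      · simp
      · exact hrl
    · rw [if_neg (by omega), Nat.add_one_mul i, Nat.add_assoc (4 * N ^ e + 2)]

/-- The number of qubits is rounded up to a power of `N`, which is easy to write in unary; the
unused qubits do not affect the acceptance probability. -/
theorem exists_decisionQCircuit (hG : G.ContainsCliffordT) (hA : A.Valid G p) (e : ℕ) :
    ∃ Q : QCircuit, Q.gates.IsOver G ∧ (decisionProg e).emitted .sav A.enc = Q.enc ∧
      Q.acceptProb = decisionProb A.le A.C A.D (4 * A.enc.length ^ e)
        (threshold A.a A.b (A.enc.length ^ e)) := by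
  have hlen := length_enc A
  rw [emitted_decisionProg hA]
  set N := A.enc.length with hN
  have hT : threshold A.a A.b (N ^ e) ≤ 4 * N ^ e := by
    have h1 : gateCount A.a (N ^ e) ≤ N ^ e := Nat.sub_le _ _
    have h2 : gateCount A.b (N ^ e) ≤ N ^ e := Nat.sub_le _ _
    rw [threshold]
    omega
  have hq : 4 * N ^ e + 2 + 4 * N ^ e * (N + N + 1) ≤ N ^ (e + 5) := by
    have hpos : 0 < N ^ e := Nat.pow_pos (by omega)
    have h5 : 10 ^ 4 * N ≤ N ^ 5 := by
      rw [pow_succ N 4]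
      exact Nat.mul_le_mul_right _ (Nat.pow_le_pow_left (by omega) 4)
    have h6 := Nat.mul_le_mul_left (N ^ e) h5
    rw [pow_add]
    nlinarith
  let w : Wire A.n A.k (4 * N ^ e) → Fin (N ^ (e + 5)) :=
    fun a => ⟨wireIdx N a, (wireIdx_lt N (by omega) (by omega) a).trans_le hq⟩
  have hw : Function.Injective w :=
    fun a b h => wireIdx_injective N (by omega) (by omega) (congrArg Fin.val h)
  refine ⟨⟨N ^ (e + 5), ((decisionCircuit A.le A.C A.D (4 * N ^ e)
    (threshold A.a A.b (N ^ e))).map (LGate.map w hw)).map LGate.toGate⟩, ?_, ?_, ?_⟩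
  · refine isOver_map_toGate fun g hg => ?_
    obtain ⟨g', hg', rfl⟩ := List.mem_map.1 hg
    exact (LGate.isIn_map hw).2 (isIn_decisionCircuit A.le A.C A.D hG hA.C_over hA.D_over _ g' hg')
  · rw [QCircuit.enc]
    simp only
    rw [enc_mk_map_toGate, flatMap_word_map]
    change _ = _ ++ ((decisionCircuit A.le A.C A.D (4 * N ^ e) (threshold A.a A.b (N ^ e))).flatMap
      (LGate.word (wireIdx N)) ++ _)
    rw [word_decisionCircuit N A.le A.C A.D hT, decisionWord]
  · rw [acceptProb_map w hw .out rfl]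
    rfl

/-- With R = 4m tests and T ≈ 2m - m(a + b), the number R - T is about R(1 + (a + b)/2)/2, the mean
for an overlap midway between the thresholds. Under the promise the true mean is farther than m(b -
a) > m/p(n) from it, up to rounding. -/
theorem overlap_bounds (hA : A.Valid G p) {e : ℕ}
    (he : ∀ N, 2 ≤ N → (12 * p ^ 2).eval N ≤ N ^ e) :
    (A.b < A.value → 2 / 3 ≤ decisionProb A.le A.C A.D (4 * A.enc.length ^ e)
      (threshold A.a A.b (A.enc.length ^ e))) ∧
    (A.value < A.a → decisionProb A.le A.C A.D (4 * A.enc.length ^ e)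
      (threshold A.a A.b (A.enc.length ^ e)) ≤ 1 / 3) := by
  have hlen := length_enc A
  set N := A.enc.length with hN
  set m := N ^ e with hm
  have hT : threshold A.a A.b m ≤ 4 * m := by
    have h1 : gateCount A.a m ≤ m := Nat.sub_le _ _
    have h2 : gateCount A.b m ≤ m := Nat.sub_le _ _
    rw [threshold]
    omega
  set P : ℝ := ((p.eval A.n : ℕ) : ℝ) with hP
  have hgap : 1 < ((A.b : ℝ) - A.a) * P := by
    have := hA.gap
    rw [hP]
    exact_mod_cast this
  have hP1 : 1 ≤ P := by
    rw [hP]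
    by_contra h
    have h0 : p.eval A.n = 0 := by
      by_contra h0
      exact h (by exact_mod_cast Nat.one_le_iff_ne_zero.2 h0)
    rw [hP, h0, Nat.cast_zero, mul_zero] at hgap
    linarith
  have hmP : 12 * P ^ 2 ≤ m := by
    have h1 := he N (by omega)
    rw [Polynomial.eval_mul, Polynomial.eval_pow, Polynomial.eval_ofNat] at h1
    have h2 := natPolynomial_eval_mono p (show A.n ≤ N by omega)
    have h3 := Nat.pow_le_pow_left h2 2
    rw [hP]
    exact_mod_cast (Nat.mul_le_mul_left 12 h3).trans h1
  obtain ⟨ha1, ha2⟩ := gateCount_bounds hA.a_nonneg hA.a_le_one m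
  obtain ⟨hb1, hb2⟩ := gateCount_bounds hA.b_nonneg hA.b_le_one m
  have hm0 : (0 : ℝ) < m := by nlinarith
  have hgap' : (m : ℝ) / P < m * (A.b - A.a) := by
    rw [div_lt_iff₀ (by linarith)]
    nlinarith
  have hδ2 : 2 ≤ (m : ℝ) / P := by
    rw [le_div_iff₀ (by linarith)]
    nlinarith
  -- Rounding raises the threshold by less than 2, and one unit is regained from the strict
  -- inequality in acceptance, so subtracting 1 suffices.
  have hδ : 0 < (m : ℝ) / P - 1 := by linarith
  -- As the deviation is at least m/(2P), the condition of Chebyshev's inequality follows from 12m ≤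
  -- m²/P², which is where 12 P² ≤ m comes from.
  have hR : 3 * ((4 * m : ℕ) : ℝ) ≤ 4 * ((m : ℝ) / P - 1) ^ 2 := by
    have h1 : (m : ℝ) / P / 2 ≤ m / P - 1 := by linarith
    have h2 : ((m : ℝ) / P / 2) ^ 2 ≤ (m / P - 1) ^ 2 := pow_le_pow_left₀ (by positivity) h1 2
    have h3 : 3 * (m : ℝ) ≤ (m / P / 2) ^ 2 := by
      have h4 : ((m : ℝ) / P / 2) ^ 2 = m * m / (4 * P ^ 2) := by
        field_simp
        ring
      rw [h4, le_div_iff₀ (by positivity)]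
      nlinarith
    push_cast
    linarith
  have hTc : ((threshold A.a A.b m : ℕ) : ℝ) = gateCount A.a m + gateCount A.b m := by
    rw [threshold, Nat.cast_add]
  rw [OverInstance.value]
  constructor
  · intro h
    refine two_thirds_le_decisionProb A.le A.C A.D hT hδ hR ?_
    have := mul_lt_mul_of_pos_left h hm0
    rw [hTc]
    push_cast
    linarith
  · intro h
    refine decisionProb_le_one_third A.le A.C A.D hT hδ hR ?_
    have := mul_lt_mul_of_pos_left h hm0
    rw [hTc]
    push_cast
    linarith

theorem approxQCircuitOver_mem (hG : G.ContainsCliffordT) (p : Polynomial ℕ) :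
    approxQCircuitOver G p ∈ PromiseBQP G := by
  obtain ⟨e, he⟩ := exists_eval_le_pow (12 * p ^ 2)
  refine ⟨_, PolyTime.emitted ⟨Turing.idComputableInPolyTime id⟩ (decisionProg e) Reg.sav, ?_, ?_⟩
  · rintro x ⟨A, rfl, hA, h⟩
    obtain ⟨Q, hQ, henc, hacc⟩ := exists_decisionQCircuit hG hA e
    exact ⟨Q, hQ, henc, hacc ▸ (overlap_bounds hA he).1 h⟩
  · rintro x ⟨A, rfl, hA, h⟩
    obtain ⟨Q, hQ, henc, hacc⟩ := exists_decisionQCircuit hG hA e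
    exact ⟨Q, hQ, henc, hacc ▸ (overlap_bounds hA he).2 h⟩

end Membership

end QOver

end

theorem lemma1 (G : QOver.GateSet) (hG : G.ContainsCliffordT) :
    (∀ p : Polynomial ℕ, QOver.approxQCircuitOver G p ∈ QOver.PromiseBQP G) ∧
    (∃ p₀ : Polynomial ℕ, ∀ p : Polynomial ℕ, (∀ n : ℕ, p₀.eval n ≤ p.eval n) →
      QOver.PromiseBQPComplete G (QOver.approxQCircuitOver G p)) :=
  ⟨QOver.approxQCircuitOver_mem hG, 2 * Polynomial.X + 10, fun p hp =>
    ⟨QOver.approxQCircuitOver_mem hG p, QOver.promiseBQPHard hG hp⟩⟩
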